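/- For a finite simple graph $G=(V,E)$ let $d_G(u,v)$ be the number of edges on a shortest path from $u$ to $v$ (with $d_G(u,v)=\infty$ if there is none, and $1/\infty=0$), and let the inverse geodesic length be $\mathrm{IGL}(G)=\sum_{\{u,v\}\subseteq V,\,u\neq v} 1/d_G(u,v)$. The problem MinIGL asks, given a graph $G$, an integer $k$ and a real target $\tau$, whether there is a set $S\subseteq V$ of exactly $k$ vertices with $\mathrm{IGL}(G-S)\le\tau$. Theorem. MinIGL on trees is fixed-parameter tractable for the parameter $n/k$, on a real RAM. That is, there are a real RAM program, a computable function $f:\mathbb{N}\to\mathbb{N}$ and a constant $c\in\mathbb{N}$ such that for every tree $T$ with $n$ vertices, every integer $k\ge 1$ and every real $\tau$, the program, on input $(T,k,\tau)$, halts after at most $f(\lceil n/k\rceil)\cdot n^{c}$ steps and decides correctly whether there is a set $S$ of $k$ vertices of $T$ with $\mathrm{IGL}(T-S)\le\tau$. Here a real RAM is a random access machine whose registers and memory cells hold real numbers, with integer constants, addition, subtraction, multiplication, division, comparison and indirect memory access (at natural-number addresses) at unit cost, and without rounding or modulo; the tree is given by its adjacency matrix. -/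

import Mathlib

/-! ### The real RAM -/

namespace RealRAM

/-- Instructions of a real RAM. The numbers `d`, `a`, `b` name registers, `l` is a line number of
the program. Every register and every memory cell holds one real number. Each instruction costs one
unit of time. There is no rounding and no modulo, and the only constants are integers. -/
inductive Instr : Type
  /-- `R[d] := z` -/
  | const (d : ℕ) (z : ℤ)
  /-- `R[d] := R[a]` -/
  | move (d a : ℕ)
  /-- `R[d] := R[a] + R[b]` -/
  | add (d a b : ℕ)
  /-- `R[d] := R[a] - R[b]` -/
  | sub (d a b : ℕ)
  /-- `R[d] := R[a] * R[b]` -/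
  | mul (d a b : ℕ)
  /-- `R[d] := R[a] / R[b]`; the machine gets stuck if `R[b] = 0` -/
  | div (d a b : ℕ)
  /-- `R[d] := M[R[a]]`; the machine gets stuck if `R[a]` is not a natural number -/
  | load (d a : ℕ)
  /-- `M[R[a]] := R[b]`; the machine gets stuck if `R[a]` is not a natural number -/
  | store (a b : ℕ)
  /-- go to line `l` -/
  | jump (l : ℕ)
  /-- if `R[a] ≤ R[b]` go to line `l` -/
  | jle (a b l : ℕ)
  /-- if `R[a] < R[b]` go to line `l` -/
  | jlt (a b l : ℕ)
  /-- stop, with the answer `ans` -/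
  | halt (ans : Bool)

/-- A program is a finite list of instructions; lines are counted from `0`. -/
abbrev Program : Type := List Instr

/-- A configuration: program counter, registers, random access memory. -/
structure Config where
  pc : ℕ
  reg : ℕ → ℝ
  mem : ℕ → ℝ

/-- Write `x` into register `d` and go to the next line. -/
def Config.setReg (s : Config) (d : ℕ) (x : ℝ) : Config :=
  { pc := s.pc + 1, reg := Function.update s.reg d x, mem := s.mem }

/-- Write `x` into memory cell `i` and go to the next line. -/
def Config.setMem (s : Config) (i : ℕ) (x : ℝ) : Config :=
  { pc := s.pc + 1, reg := s.reg, mem := Function.update s.mem i x }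

/-- Go to line `l`. -/
def Config.goto (s : Config) (l : ℕ) : Config :=
  { pc := l, reg := s.reg, mem := s.mem }

/-- The effect of one instruction; `none` if there is no next configuration (the machine has
halted or is stuck). A real number `x` is a natural number if and only if `(⌊x⌋₊ : ℝ) = x`. -/
noncomputable def exec (s : Config) : Instr → Option Config
  | .const d z => some (s.setReg d z)
  | .move d a => some (s.setReg d (s.reg a))
  | .add d a b => some (s.setReg d (s.reg a + s.reg b))
  | .sub d a b => some (s.setReg d (s.reg a - s.reg b))
  | .mul d a b => some (s.setReg d (s.reg a * s.reg b))
  | .div d a b => if s.reg b = 0 then none else some (s.setReg d (s.reg a / s.reg b))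
  | .load d a =>
      if (⌊s.reg a⌋₊ : ℝ) = s.reg a then some (s.setReg d (s.mem ⌊s.reg a⌋₊)) else none
  | .store a b =>
      if (⌊s.reg a⌋₊ : ℝ) = s.reg a then some (s.setMem ⌊s.reg a⌋₊ (s.reg b)) else none
  | .jump l => some (s.goto l)
  | .jle a b l => some (s.goto (if s.reg a ≤ s.reg b then l else s.pc + 1))
  | .jlt a b l => some (s.goto (if s.reg a < s.reg b then l else s.pc + 1))
  | .halt _ => none

/-- `HaltsIn P s t ans`: started in the configuration `s`, the program `P` halts after executing
exactly `t` instructions, with the answer `ans`. A run that gets stuck or leaves the program does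
not halt. -/
inductive HaltsIn (P : Program) : Config → ℕ → Bool → Prop
  | halt {s : Config} {ans : Bool} (h : P[s.pc]? = some (.halt ans)) : HaltsIn P s 1 ans
  | step {s s' : Config} {i : Instr} {t : ℕ} {ans : Bool} (h : P[s.pc]? = some i)
      (hs : exec s i = some s') (hr : HaltsIn P s' t ans) : HaltsIn P s (t + 1) ans

/-- A decision problem with instances `I` is fixed-parameter tractable on the real RAM, for the
parameter `param`: one program decides every instance `x` (written into the machine as
`input x`) in time `f (param x) * (size x) ^ c`, with `f` computable and `c` constant. As the
parameter may be a fraction, `f` is applied to the parameter rounded up. -/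
def FixedParameterTractable {I : Type*} (input : I → Config) (size : I → ℕ) (param : I → ℚ)
    (yes : I → Prop) : Prop :=
  ∃ (P : Program) (f : ℕ → ℕ) (c : ℕ), Computable f ∧
    ∀ x : I, ∃ (t : ℕ) (ans : Bool), HaltsIn P (input x) t ans ∧
      (ans = true ↔ yes x) ∧ t ≤ f ⌈param x⌉₊ * size x ^ c

end RealRAM

/-! ### Inverse geodesic length -/

open Classical in
/-- `1 / d_G(u, v)`, where `1 / ∞ = 0`. -/
noncomputable def invDist {V : Type*} (G : SimpleGraph V) (u v : V) : ℝ :=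
  if G.Reachable u v then 1 / (G.dist u v : ℝ) else 0

open Classical in
/-- The inverse geodesic length: the sum of `1 / d_G(u, v)` over all unordered pairs of distinct
vertices, which is half the sum over all ordered pairs. -/
noncomputable def IGL {V : Type*} [Fintype V] (G : SimpleGraph V) : ℝ :=
  (∑ p ∈ (Finset.univ : Finset V).offDiag, invDist G p.1 p.2) / 2

/-- The problem MinIGL: can one delete a set `S` of `k` vertices so that the remaining graph has
inverse geodesic length at most `τ`? -/
def MinIGL {V : Type*} [Fintype V] [DecidableEq V] (G : SimpleGraph V) (k : ℕ) (τ : ℝ) : Prop :=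
  ∃ S : Finset V, S.card = k ∧ IGL (G.induce {v : V | v ∉ S}) ≤ τ

/-! ### MinIGL on trees as a parameterized problem -/

/-- An instance of MinIGL on trees: a tree on the vertices `0, …, n - 1`, a positive number `k` of
deletions (so that `n / k` makes sense) and a real target `τ`. -/
structure TreeInstance where
  n : ℕ
  T : SimpleGraph (Fin n)
  isTree : T.IsTree
  k : ℕ
  k_pos : 1 ≤ k
  τ : ℝ

namespace TreeInstance

open Classical in
/-- The input: registers `0`, `1`, `2` hold `n`, `k`, `τ`; the memory cells `0, …, n² - 1` hold the
adjacency matrix, row by row; everything else is `0`. The run starts at line `0`. -/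
noncomputable def input (x : TreeInstance) : RealRAM.Config where
  pc := 0
  reg := fun r => if r = 0 then (x.n : ℝ) else if r = 1 then (x.k : ℝ) else
    if r = 2 then x.τ else 0
  mem := fun a => if ∃ i j : Fin x.n, a = i.val * x.n + j.val ∧ x.T.Adj i j then 1 else 0

/-- The parameter `n / k`. -/
def ratio (x : TreeInstance) : ℚ := (x.n : ℚ) / (x.k : ℚ)

/-- `x` is a yes-instance. -/
def IsYes (x : TreeInstance) : Prop := MinIGL x.T x.k x.τ

end TreeInstance

/-! The proof combines a bound on the components that an optimal deletion leaves with a dynamic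
program whose number of states is controlled by that bound.

Let `r` be the least integer with `n ≤ r * k`, and let `S` be a set of `k` vertices that minimizes
the remaining inverse geodesic length. Root the tree and let each vertex be owned by the first
vertex of `S` on its way to the root, if there is one. The owned sets are disjoint, so some `x ∈ S`
owns a set `A` of at most `r` vertices; `A` consists of `x` and of whole components of `T - S`.
Suppose that the parent `p` of `x` is not deleted. Deleting `p` in place of `x` creates new
distances only inside `A`, at most `|A|²` over ordered pairs, and loses the harmonic centrality of
`p`. By optimality this centrality is at most `r²`. A centrality of at most `m` bounds the component
of the vertex: a shortest path of length `D` contributes the harmonic number of `D`, which forces `D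
< 3 ^ m`, and then every other vertex of the component contributes at least `3 ^ (-m)`. Hence the
component `C` of `p` is bounded. Undeleting `x` affects only `A ∪ C`, so exchanging `x` for any
other `y` bounds the component of `y` in the same way. This is `card_reachable_le_compBound`; the
bound `g = compBound r` depends on `r` alone.

The dynamic program strips leaves off the tree. While the vertices of `R` remain, each `v ∈ R` is
the root of its own component of `T.outside R`. A partial solution there is summarized by its number
of deletions, its profile (how many surviving vertices have distance `i` from the root, for each
`i`) and its inverse geodesic length. Stripping a leaf `u` with neighbour `p` joins two components
by the edge `p u`, and by `IsJoin.compIGL_eq` the length grows by an amount that depends only on the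
two profiles. If all components of `T - S` have at most `g` vertices, the profiles are numbers with
`g` digits to the base `g + 1`. The tables are sound for all `S` but complete only for `S` with
small components (`TableSound.merge`, `TableComplete.merge`); this suffices because an optimal `S`
is of that kind (`minIGL_iff_of_table`).

For the machine, the dynamic program is written in a small loop language and compiled;
`Stmt.arrives` gives correctness and running time of the compiled code. All loop bounds are at most
some `N` that is linear in `n` with a factor depending on `r`, so the time is a constant times `(N +
1)` to the nesting depth. -/

namespace RealRAM

/-! ### Running pieces of code -/

/-- The code `L` stands in `P` from line `off` on. -/
def CodeAt (P : Program) : ℕ → List Instr → Prop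
  | _, [] => True
  | off, i :: L => P[off]? = some i ∧ CodeAt P (off + 1) L

theorem codeAt_append {P : Program} {L₁ L₂ : List Instr} {off : ℕ} :
    CodeAt P off (L₁ ++ L₂) ↔ CodeAt P off L₁ ∧ CodeAt P (off + L₁.length) L₂ := by
  induction L₁ generalizing off with
  | nil => simp [CodeAt]
  | cons i L ih =>
    simp only [List.cons_append, CodeAt, ih, List.length_cons, and_assoc]
    rw [show off + 1 + L.length = off + (L.length + 1) by omega]

theorem codeAt_self_append (pre L post : List Instr) :
    CodeAt (pre ++ L ++ post) pre.length L := by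
  induction L generalizing pre with
  | nil => trivial
  | cons i L ih =>
    refine ⟨by simp, ?_⟩
    have := ih (pre ++ [i])
    simpa using this

/-- `P` leads from `s` to `s'` in exactly `t` steps. -/
inductive Reach (P : Program) : Config → ℕ → Config → Prop
  | refl (s : Config) : Reach P s 0 s
  | step {s s₁ s₂ : Config} {i : Instr} {t : ℕ} (h : P[s.pc]? = some i)
      (hs : exec s i = some s₁) (hr : Reach P s₁ t s₂) : Reach P s (t + 1) s₂

theorem Reach.trans {P : Program} {s₁ s₂ s₃ : Config} {t₁ t₂ : ℕ} (h₁ : Reach P s₁ t₁ s₂)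
    (h₂ : Reach P s₂ t₂ s₃) : Reach P s₁ (t₁ + t₂) s₃ := by
  induction h₁ with
  | refl => simpa using h₂
  | step h hs _ ih =>
    rw [Nat.add_right_comm]
    exact .step h hs (ih h₂)

theorem Reach.one {P : Program} {s s' : Config} {i : Instr} (h : P[s.pc]? = some i)
    (hs : exec s i = some s') : Reach P s 1 s' := .step h hs (.refl _)

theorem Reach.haltsIn {P : Program} {s s' : Config} {t u : ℕ} {ans : Bool} (h : Reach P s t s')
    (h' : HaltsIn P s' u ans) : HaltsIn P s (t + u) ans := by
  induction h with
  | refl => simpa using h'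
  | step h hs _ ih =>
    rw [Nat.add_right_comm]
    exact .step h hs (ih h')

/-- The straight-line code `L` leads from `s` to `s'`. -/
def Runs (L : List Instr) (s s' : Config) : Prop :=
  s'.pc = s.pc + L.length ∧ ∀ P : Program, CodeAt P s.pc L → Reach P s L.length s'

theorem Runs.nil (s : Config) : Runs [] s s := ⟨rfl, fun _ _ => .refl _⟩

theorem Runs.append {L₁ L₂ : List Instr} {s₁ s₂ s₃ : Config} (h₁ : Runs L₁ s₁ s₂)
    (h₂ : Runs L₂ s₂ s₃) : Runs (L₁ ++ L₂) s₁ s₃ := by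
  refine ⟨by rw [h₂.1, h₁.1, List.length_append]; omega, fun P hP => ?_⟩
  rw [codeAt_append, ← h₁.1] at hP
  rw [List.length_append]
  exact (h₁.2 P hP.1).trans (h₂.2 P hP.2)

theorem Runs.cons {i : Instr} {L : List Instr} {s₁ s₂ s₃ : Config} (h : exec s₁ i = some s₂)
    (hpc : s₂.pc = s₁.pc + 1) (h₂ : Runs L s₂ s₃) : Runs (i :: L) s₁ s₃ := by
  refine ⟨by rw [h₂.1, hpc, List.length_cons]; omega, fun P hP => ?_⟩
  exact .step hP.1 h (h₂.2 P (hpc ▸ hP.2))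

/-! ### A language of loop programs -/

/-- Expressions for natural numbers. -/
inductive NExp : Type
  | lit (z : ℕ)
  | var (x : ℕ)
  | add (a b : NExp)
  | mul (a b : NExp)
  /-- an entry of the array `t` -/
  | get (t : ℕ) (i j l : NExp)

/-- Expressions for real numbers. -/
inductive RExp : Type
  | var (x : ℕ)
  | nat (e : NExp)
  | add (a b : RExp)
  | mul (a b : RExp)
  /-- `a / (e + 1)` -/
  | divSucc (a : RExp) (e : NExp)
  /-- an entry of the array `t` -/
  | get (t : ℕ) (i j l : NExp)

/-- Statements. -/
inductive Stmt : Type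
  | setN (x : ℕ) (e : NExp)
  | setR (x : ℕ) (e : RExp)
  | putN (t : ℕ) (i j l e : NExp)
  | putR (t : ℕ) (i j l : NExp) (e : RExp)
  /-- read a cell of the input -/
  | inp (x : ℕ) (e : NExp)
  | seq (c₁ c₂ : Stmt)
  | iteN (a b : NExp) (c₁ c₂ : Stmt)
  | iteR (a b : RExp) (c₁ c₂ : Stmt)
  | skip
  /-- run `c` for `x = 0, 1, …` below the initial value of the variable `b` -/
  | loop (x b : ℕ) (c : Stmt)

/-- The variables and arrays of a loop program. -/
structure Store where
  n : ℕ → ℕ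
  r : ℕ → ℝ
  na : ℕ × ℕ × ℕ × ℕ → ℕ
  ra : ℕ × ℕ × ℕ × ℕ → ℝ

namespace Store

def setN (S : Store) (x v : ℕ) : Store := { S with n := Function.update S.n x v }
def setR (S : Store) (x : ℕ) (v : ℝ) : Store := { S with r := Function.update S.r x v }
def putN (S : Store) (q : ℕ × ℕ × ℕ × ℕ) (v : ℕ) : Store :=
  { S with na := Function.update S.na q v }
def putR (S : Store) (q : ℕ × ℕ × ℕ × ℕ) (v : ℝ) : Store :=
  { S with ra := Function.update S.ra q v }

end Store

def NExp.eval (S : Store) : NExp → ℕ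
  | lit z => z
  | var x => S.n x
  | add a b => a.eval S + b.eval S
  | mul a b => a.eval S * b.eval S
  | get t i j l => S.na (t, i.eval S, j.eval S, l.eval S)

noncomputable def RExp.eval (S : Store) : RExp → ℝ
  | var x => S.r x
  | nat e => e.eval S
  | add a b => a.eval S + b.eval S
  | mul a b => a.eval S * b.eval S
  | divSucc a e => a.eval S / (e.eval S + 1)
  | get t i j l => S.ra (t, i.eval S, j.eval S, l.eval S)

/-- The store after `m` rounds of a loop over `x` with body `f`. -/
def iter (x : ℕ) (f : Store → Store) (S : Store) : ℕ → Store
  | 0 => S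
  | m + 1 => f ((iter x f S m).setN x m)

open Classical in
/-- The effect of a statement, when the input cells are `A`. -/
noncomputable def Stmt.run (A : ℕ → ℕ) : Stmt → Store → Store
  | setN x e, S => S.setN x (e.eval S)
  | setR x e, S => S.setR x (e.eval S)
  | putN t i j l e, S => S.putN (t, i.eval S, j.eval S, l.eval S) (e.eval S)
  | putR t i j l e, S => S.putR (t, i.eval S, j.eval S, l.eval S) (e.eval S)
  | inp x e, S => S.setN x (A (e.eval S))
  | seq c₁ c₂, S => c₂.run A (c₁.run A S)
  | iteN a b c₁ c₂, S => if a.eval S < b.eval S then c₁.run A S else c₂.run A S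
  | iteR a b c₁ c₂, S => if a.eval S < b.eval S then c₁.run A S else c₂.run A S
  | skip, S => S
  | loop x b c, S => iter x (c.run A) S (S.n b)

/-! ### Compilation -/

/-- Turns the contents `x`, `y` of the temporaries `d`, `d + 1` into `(x + y) * (x + y) + x`. -/
def pairCode (d : ℕ) : List Instr :=
  [.add (4 * (d + 1) + 2) (4 * d + 2) (4 * (d + 1) + 2),
   .mul (4 * (d + 1) + 2) (4 * (d + 1) + 2) (4 * (d + 1) + 2),
   .add (4 * d + 2) (4 * (d + 1) + 2) (4 * d + 2)]

/-- The address of an array entry, for code computing its indices. -/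
def addrCode (d t z : ℕ) (ci cj cl : List Instr) : List Instr :=
  ci ++ (cj ++ (pairCode d ++ (cl ++ (pairCode d ++
    ([.const (4 * (d + 1) + 2) t] ++ (pairCode d ++
    [.add (4 * d + 2) (4 * d + 2) (4 * d + 2), .add (4 * d + 2) (4 * d + 2) 3,
     .const (4 * (d + 1) + 2) z, .add (4 * d + 2) (4 * d + 2) (4 * (d + 1) + 2)]))))))

/-- Code that writes the value of an expression into the temporary `d`, spoiling only later
temporaries. -/
def NExp.code (d : ℕ) : NExp → List Instr
  | lit z => [.const (4 * d + 2) z]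
  | var x => [.move (4 * d + 2) (4 * x)]
  | add a b => a.code d ++ (b.code (d + 1) ++ [.add (4 * d + 2) (4 * d + 2) (4 * (d + 1) + 2)])
  | mul a b => a.code d ++ (b.code (d + 1) ++ [.mul (4 * d + 2) (4 * d + 2) (4 * (d + 1) + 2)])
  | get t i j l => addrCode d t 0 (i.code d) (j.code (d + 1)) (l.code (d + 1)) ++
      [.load (4 * d + 2) (4 * d + 2)]

/-- Code that writes the value of a real expression into the temporary `d`. -/
def RExp.code (d : ℕ) : RExp → List Instr
  | var x => [.move (4 * d + 2) (4 * x + 1)]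
  | nat e => e.code d
  | add a b => a.code d ++ (b.code (d + 1) ++ [.add (4 * d + 2) (4 * d + 2) (4 * (d + 1) + 2)])
  | mul a b => a.code d ++ (b.code (d + 1) ++ [.mul (4 * d + 2) (4 * d + 2) (4 * (d + 1) + 2)])
  | divSucc a e => a.code d ++ (e.code (d + 1) ++ [.const (4 * (d + 2) + 2) 1,
      .add (4 * (d + 1) + 2) (4 * (d + 1) + 2) (4 * (d + 2) + 2),
      .div (4 * d + 2) (4 * d + 2) (4 * (d + 1) + 2)])
  | get t i j l => addrCode d t 1 (i.code d) (j.code (d + 1)) (l.code (d + 1)) ++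
      [.load (4 * d + 2) (4 * d + 2)]

/-- The number of lines a statement compiles to. -/
def Stmt.lines : Stmt → ℕ
  | setN _ e => (e.code 0).length + 1
  | setR _ e => (e.code 0).length + 1
  | putN t i j l e =>
      (addrCode 0 t 0 (i.code 0) (j.code 1) (l.code 1)).length + ((e.code 1).length + 1)
  | putR t i j l e =>
      (addrCode 0 t 1 (i.code 0) (j.code 1) (l.code 1)).length + ((e.code 1).length + 1)
  | inp _ e => (e.code 0).length + 4
  | seq c₁ c₂ => c₁.lines + c₂.lines
  | iteN a b c₁ c₂ => (a.code 0).length + ((b.code 1).length + (1 + (c₂.lines + (1 + c₁.lines))))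
  | iteR a b c₁ c₂ => (a.code 0).length + ((b.code 1).length + (1 + (c₂.lines + (1 + c₁.lines))))
  | skip => 0
  | loop _ _ c => 4 + (c.lines + 3)

/-- The code of a statement that starts in line `off` inside `lv` nested loops. -/
def Stmt.code : ℕ → ℕ → Stmt → List Instr
  | _, _, setN x e => e.code 0 ++ [.move (4 * x) 2]
  | _, _, setR x e => e.code 0 ++ [.move (4 * x + 1) 2]
  | _, _, putN t i j l e => addrCode 0 t 0 (i.code 0) (j.code 1) (l.code 1) ++
      (e.code 1 ++ [.store 2 6])
  | _, _, putR t i j l e => addrCode 0 t 1 (i.code 0) (j.code 1) (l.code 1) ++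
      (e.code 1 ++ [.store 2 6])
  | off, _, inp x e => e.code 0 ++
      [.const (4 * x) 0, .jle 3 2 (off + (e.code 0).length + 4), .load 2 2, .move (4 * x) 2]
  | off, lv, seq c₁ c₂ => c₁.code off lv ++ c₂.code (off + c₁.lines) lv
  | off, lv, iteN a b c₁ c₂ =>
      let o := off + ((a.code 0).length + (b.code 1).length)
      a.code 0 ++ (b.code 1 ++ ([.jlt 2 6 (o + 1 + c₂.lines + 1)] ++ (c₂.code (o + 1) lv ++
        ([.jump (o + 1 + c₂.lines + 1 + c₁.lines)] ++ c₁.code (o + 1 + c₂.lines + 1) lv))))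
  | off, lv, iteR a b c₁ c₂ =>
      let o := off + ((a.code 0).length + (b.code 1).length)
      a.code 0 ++ (b.code 1 ++ ([.jlt 2 6 (o + 1 + c₂.lines + 1)] ++ (c₂.code (o + 1) lv ++
        ([.jump (o + 1 + c₂.lines + 1 + c₁.lines)] ++ c₁.code (o + 1 + c₂.lines + 1) lv))))
  | _, _, skip => []
  | off, lv, loop x b c =>
      [.const (8 * lv + 11) 0, .move (8 * lv + 15) (4 * b),
       .jle (8 * lv + 15) (8 * lv + 11) (off + (4 + (c.lines + 3))),
       .move (4 * x) (8 * lv + 11)] ++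
      (c.code (off + 4) (lv + 1) ++
       [.const 2 1, .add (8 * lv + 11) (8 * lv + 11) 2, .jump (off + 2)])

theorem Stmt.length_code (c : Stmt) (off lv : ℕ) : (c.code off lv).length = c.lines := by
  induction c generalizing off lv <;> simp_all [Stmt.code, Stmt.lines] <;> omega

/-- An upper bound for the running time of the compiled code. -/
noncomputable def Stmt.cost (A : ℕ → ℕ) : Stmt → Store → ℕ
  | seq c₁ c₂, S => c₁.cost A S + c₂.cost A (c₁.run A S)
  | iteN a b c₁ c₂, S => (a.code 0).length + (b.code 1).length + 2 + (c₁.cost A S + c₂.cost A S)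
  | iteR a b c₁ c₂, S => (a.code 0).length + (b.code 1).length + 2 + (c₁.cost A S + c₂.cost A S)
  | loop x b c, S => 3 + ∑ m ∈ Finset.range (S.n b),
      (c.cost A ((iter x (c.run A) S m).setN x m) + 5)
  | setN x e, _ => (setN x e).lines
  | setR x e, _ => (setR x e).lines
  | putN t i j l e, _ => (putN t i j l e).lines
  | putR t i j l e, _ => (putR t i j l e).lines
  | inp x e, _ => (inp x e).lines
  | skip, _ => 0

/-! ### Correctness of the compilation -/

/-- A pairing that the machine can evaluate with addition and multiplication alone. It is injective
because its value lies in `[(x + y)², (x + y + 1)²)`, which determines `x + y`. -/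
def sqPair (x y : ℕ) : ℕ := (x + y) * (x + y) + x

theorem sqPair_inj {x y x' y' : ℕ} (h : sqPair x y = sqPair x' y') : x = x' ∧ y = y' := by
  unfold sqPair at h
  have h1 : x + y = x' + y' := by
    rcases lt_trichotomy (x + y) (x' + y') with hlt | heq | hlt
    · nlinarith
    · exact heq
    · nlinarith
  rw [h1] at h
  omega

/-- The number of an array entry. -/
def keyCode (q : ℕ × ℕ × ℕ × ℕ) : ℕ := sqPair (sqPair (sqPair q.2.1 q.2.2.1) q.2.2.2) q.1

theorem keyCode_injective : Function.Injective keyCode := by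
  rintro ⟨a, b, c, d⟩ ⟨a', b', c', d'⟩ h
  obtain ⟨h, rfl⟩ := sqPair_inj h
  obtain ⟨h, h'⟩ := sqPair_inj h
  obtain ⟨h1, h2⟩ := sqPair_inj h
  simp_all

/-- The machine configuration `s` represents the store `S`, with `A` the input, of length `w`. -/
structure Rel (A : ℕ → ℕ) (w : ℕ) (S : Store) (s : Config) : Prop where
  n : ∀ x, s.reg (4 * x) = S.n x
  r : ∀ x, s.reg (4 * x + 1) = S.r x
  base : s.reg 3 = w
  inp : ∀ a < w, s.mem a = A a
  na : ∀ q, s.mem (w + 2 * keyCode q) = S.na q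
  ra : ∀ q, s.mem (w + 2 * keyCode q + 1) = S.ra q

/-- Memory and all registers but the temporaries from `d` on are the same. -/
structure SameBut (d : ℕ) (s s' : Config) : Prop where
  mem : s'.mem = s.mem
  reg : ∀ x, (∀ m, d ≤ m → x ≠ 4 * m + 2) → s'.reg x = s.reg x

theorem SameBut.trans {d : ℕ} {s₁ s₂ s₃ : Config} (h₁ : SameBut d s₁ s₂) (h₂ : SameBut d s₂ s₃) :
    SameBut d s₁ s₃ :=
  ⟨h₂.mem.trans h₁.mem, fun x hx => (h₂.reg x hx).trans (h₁.reg x hx)⟩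

theorem SameBut.mono {d d' : ℕ} {s₁ s₂ : Config} (h₁ : SameBut d' s₁ s₂) (h : d ≤ d') :
    SameBut d s₁ s₂ :=
  ⟨h₁.mem, fun x hx => h₁.reg x fun m hm => hx m (h.trans hm)⟩

theorem SameBut.temp {d m : ℕ} {s₁ s₂ : Config} (h : SameBut d s₁ s₂) (hm : m < d) :
    s₂.reg (4 * m + 2) = s₁.reg (4 * m + 2) := h.reg _ fun _ _ => by omega

theorem SameBut.setReg (d m : ℕ) (hm : d ≤ m) (s : Config) (x : ℝ) :
    SameBut d s (s.setReg (4 * m + 2) x) :=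
  ⟨rfl, fun y hy => by simp [Config.setReg, Function.update_of_ne (hy m hm)]⟩

/-- Registers are allotted by residues modulo 4: natural variables 0, real variables 1, temporaries
2, and residue 3 for the array base (register 3) and the loop registers. So no temporary occurs in
the representation of a store. -/
theorem Rel.sameBut {A : ℕ → ℕ} {w d : ℕ} {S : Store} {s s' : Config} (h : Rel A w S s)
    (h' : SameBut d s s') : Rel A w S s' where
  n x := by rw [h'.reg _ fun _ _ => by omega, h.n]
  r x := by rw [h'.reg _ fun _ _ => by omega, h.r]
  base := by rw [h'.reg _ fun _ _ => by omega, h.base]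
  inp a ha := by rw [h'.mem, h.inp a ha]
  na q := by rw [h'.mem, h.na]
  ra q := by rw [h'.mem, h.ra]

/-- `L` computes the value `v` into the temporary `d`, starting in `s`. -/
def Yields (L : List Instr) (d : ℕ) (s : Config) (v : ℝ) : Prop :=
  ∃ s', Runs L s s' ∧ SameBut d s s' ∧ s'.reg (4 * d + 2) = v

theorem yields_pairCode {d : ℕ} {s : Config} {x y : ℕ} (hx : s.reg (4 * d + 2) = x)
    (hy : s.reg (4 * (d + 1) + 2) = y) : Yields (pairCode d) d s (sqPair x y : ℕ) := by
  refine ⟨_, .cons rfl rfl (.cons rfl rfl (.cons rfl rfl (.nil _))),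
    ((SameBut.setReg d (d + 1) (by omega) _ _).trans
      (SameBut.setReg d (d + 1) (by omega) _ _)).trans (SameBut.setReg d d le_rfl _ _), ?_⟩
  simp [Config.setReg, hx, hy, sqPair]

/-- Natural and real array cells alternate behind the `w` input cells, and `z` selects the parity.
The hypotheses range over all configurations that represent `S`, as the code for the later indices
starts with altered temporaries. -/
theorem yields_addrCode {A : ℕ → ℕ} {w : ℕ} {S : Store} {d t z : ℕ} {ci cj cl : List Instr}
    {i j l : ℕ} {s : Config} (h : Rel A w S s)
    (hi : ∀ s, Rel A w S s → Yields ci d s i) (hj : ∀ s, Rel A w S s → Yields cj (d + 1) s j)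
    (hl : ∀ s, Rel A w S s → Yields cl (d + 1) s l) :
    Yields (addrCode d t z ci cj cl) d s ((w + 2 * keyCode (t, i, j, l) + z : ℕ) : ℝ) := by
  obtain ⟨s₁, r₁, b₁, v₁⟩ := hi s h
  replace h := h.sameBut b₁
  obtain ⟨s₂, r₂, b₂, v₂⟩ := hj s₁ h
  replace h := h.sameBut b₂
  rw [← b₂.temp (Nat.lt_succ_self d)] at v₁
  obtain ⟨s₃, r₃, b₃, v₃⟩ := yields_pairCode v₁ v₂
  replace h := h.sameBut b₃
  obtain ⟨s₄, r₄, b₄, v₄⟩ := hl s₃ h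
  replace h := h.sameBut b₄
  rw [← b₄.temp (Nat.lt_succ_self d)] at v₃
  obtain ⟨s₅, r₅, b₅, v₅⟩ := yields_pairCode v₃ v₄
  replace h := h.sameBut b₅
  have b₆ := SameBut.setReg (d + 1) (d + 1) le_rfl s₅ (t : ℤ)
  have r₆ : Runs [.const (4 * (d + 1) + 2) t] s₅ (s₅.setReg (4 * (d + 1) + 2) (t : ℤ)) :=
    .cons rfl rfl (.nil _)
  replace h := h.sameBut b₆
  rw [← b₆.temp (Nat.lt_succ_self d)] at v₅
  obtain ⟨s₇, r₇, b₇, v₇⟩ := yields_pairCode v₅ (y := t) (by simp [Config.setReg])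
  replace h := h.sameBut b₇
  refine ⟨_, r₁.append (r₂.append (r₃.append (r₄.append (r₅.append (r₆.append (r₇.append
    (.cons rfl rfl (.cons rfl rfl (.cons rfl rfl (.cons rfl rfl (.nil _))))))))))), ?_, ?_⟩
  · refine b₁.trans ((b₂.mono (by omega)).trans (b₃.trans ((b₄.mono (by omega)).trans
      (b₅.trans ((b₆.mono (by omega)).trans (b₇.trans ?_))))))
    exact (((SameBut.setReg d d le_rfl _ _).trans (SameBut.setReg d d le_rfl _ _)).trans
      (SameBut.setReg d (d + 1) (by omega) _ _)).trans (SameBut.setReg d d le_rfl _ _)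
  · have hb : s₇.reg 3 = w := h.base
    have h3 : (3 : ℕ) ≠ 4 * d + 2 := by omega
    simp only [Config.setReg, Function.update_self, ne_eq, h3, not_false_eq_true,
      Function.update_of_ne, v₇, hb, keyCode, Int.cast_natCast]
    rw [Function.update_of_ne (by omega), Function.update_self]
    push_cast
    ring

theorem exec_load {s : Config} {d a v : ℕ} (h : s.reg a = v) :
    exec s (.load d a) = some (s.setReg d (s.mem v)) := by
  simp [exec, h]

theorem exec_store {s : Config} {b a v : ℕ} (h : s.reg a = v) :
    exec s (.store a b) = some (s.setMem v (s.reg b)) := by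
  simp [exec, h]

theorem Yields.binop {L₁ L₂ : List Instr} {d : ℕ} {s : Config} {x y z : ℝ} {i : Instr}
    (h₁ : Yields L₁ d s x) (h₂ : ∀ s', SameBut d s s' → Yields L₂ (d + 1) s' y)
    (hi : ∀ s', s'.reg (4 * d + 2) = x → s'.reg (4 * (d + 1) + 2) = y →
      exec s' i = some (s'.setReg (4 * d + 2) z)) : Yields (L₁ ++ (L₂ ++ [i])) d s z := by
  obtain ⟨s₁, r₁, b₁, v₁⟩ := h₁
  obtain ⟨s₂, r₂, b₂, v₂⟩ := h₂ s₁ b₁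
  rw [← b₂.temp (Nat.lt_succ_self d)] at v₁
  exact ⟨_, r₁.append (r₂.append (.cons (hi s₂ v₁ v₂) rfl (.nil _))),
    (b₁.trans (b₂.mono (by omega))).trans (.setReg d d le_rfl _ _), by simp [Config.setReg]⟩

theorem NExp.yields_code {A : ℕ → ℕ} {w : ℕ} {S : Store} (e : NExp) (d : ℕ) (s : Config)
    (h : Rel A w S s) : Yields (e.code d) d s (e.eval S) := by
  induction e generalizing d s with
  | lit z => exact ⟨_, .cons rfl rfl (.nil _), .setReg d d le_rfl _ _, by
      simp [Config.setReg, NExp.eval]⟩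
  | var x => exact ⟨_, .cons rfl rfl (.nil _), .setReg d d le_rfl _ _, by
      simp [Config.setReg, NExp.eval, h.n]⟩
  | add a b iha ihb =>
    refine (iha d s h).binop (fun s' hs' => ihb _ s' (h.sameBut hs')) fun s' h1 h2 => ?_
    simp [exec, h1, h2, NExp.eval]
  | mul a b iha ihb =>
    refine (iha d s h).binop (fun s' hs' => ihb _ s' (h.sameBut hs')) fun s' h1 h2 => ?_
    simp [exec, h1, h2, NExp.eval]
  | get t i j l ihi ihj ihl =>
    obtain ⟨s₁, r₁, b₁, v₁⟩ := yields_addrCode (t := t) (z := 0) h (ihi d) (ihj (d + 1))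
      (ihl (d + 1))
    refine ⟨_, r₁.append (.cons (exec_load v₁) rfl (.nil _)),
      b₁.trans (.setReg d d le_rfl _ _), ?_⟩
    simp [Config.setReg, NExp.eval, (h.sameBut b₁).na]

theorem RExp.yields_code {A : ℕ → ℕ} {w : ℕ} {S : Store} (e : RExp) (d : ℕ) (s : Config)
    (h : Rel A w S s) : Yields (e.code d) d s (e.eval S) := by
  induction e generalizing d s with
  | var x => exact ⟨_, .cons rfl rfl (.nil _), .setReg d d le_rfl _ _, by
      simp [Config.setReg, RExp.eval, h.r]⟩
  | nat e => exact e.yields_code d s h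
  | add a b iha ihb =>
    refine (iha d s h).binop (fun s' hs' => ihb _ s' (h.sameBut hs')) fun s' h1 h2 => ?_
    simp [exec, h1, h2, RExp.eval]
  | mul a b iha ihb =>
    refine (iha d s h).binop (fun s' hs' => ihb _ s' (h.sameBut hs')) fun s' h1 h2 => ?_
    simp [exec, h1, h2, RExp.eval]
  | divSucc a e iha =>
    obtain ⟨s₁, r₁, b₁, v₁⟩ := iha d s h
    obtain ⟨s₂, r₂, b₂, v₂⟩ := e.yields_code (d + 1) s₁ (h.sameBut b₁)
    rw [← b₂.temp (Nat.lt_succ_self d)] at v₁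
    -- Divisors have the form `e + 1` with `e` natural, so a compiled division never gets stuck.
    have hne : (e.eval S : ℝ) + 1 ≠ 0 := by positivity
    refine ⟨(((s₂.setReg (4 * (d + 2) + 2) (1 : ℤ)).setReg (4 * (d + 1) + 2)
      (e.eval S + 1)).setReg (4 * d + 2) (a.eval S / (e.eval S + 1))),
      r₁.append (r₂.append (.cons rfl rfl (.cons ?_ rfl (.cons ?_ rfl (.nil _))))), ?_, ?_⟩
    · simp [exec, Config.setReg, v₂]
    · have : (4 * d + 2) ≠ 4 * (d + 2) + 2 := by omega
      simp [exec, Config.setReg, hne, v₁]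
    · exact (b₁.trans (b₂.mono (by omega))).trans (((SameBut.setReg d (d + 2) (by omega) _ _).trans
        (SameBut.setReg d (d + 1) (by omega) _ _)).trans (.setReg d d le_rfl _ _))
    · simp [Config.setReg, RExp.eval]
  | get t i j l =>
    obtain ⟨s₁, r₁, b₁, v₁⟩ := yields_addrCode (t := t) (z := 1) h (fun s => i.yields_code d s)
      (fun s => j.yields_code (d + 1) s) (fun s => l.yields_code (d + 1) s)
    refine ⟨_, r₁.append (.cons (exec_load v₁) rfl (.nil _)),
      b₁.trans (.setReg d d le_rfl _ _), ?_⟩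
    simp [Config.setReg, RExp.eval, (h.sameBut b₁).ra]

theorem Rel.setN {A : ℕ → ℕ} {w : ℕ} {S : Store} {s : Config} (h : Rel A w S s) (x v : ℕ) {y : ℝ}
    (hy : y = v) : Rel A w (S.setN x v) (s.setReg (4 * x) y) where
  n x' := by
    by_cases hx : x' = x
    · subst hx; simp [Config.setReg, Store.setN, hy]
    · have : 4 * x' ≠ 4 * x := by omega
      simp [Config.setReg, Store.setN, hx, h.n]
  r x' := by
    have : 4 * x' + 1 ≠ 4 * x := by omega
    simp [Config.setReg, Store.setN, this, h.r]
  base := by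
    have : 3 ≠ 4 * x := by omega
    simp [Config.setReg, this, h.base]
  inp := h.inp
  na := h.na
  ra := h.ra

theorem Rel.setR {A : ℕ → ℕ} {w : ℕ} {S : Store} {s : Config} (h : Rel A w S s) (x : ℕ) (v : ℝ) :
    Rel A w (S.setR x v) (s.setReg (4 * x + 1) v) where
  n x' := by
    have : 4 * x' ≠ 4 * x + 1 := by omega
    simp [Config.setReg, Store.setR, this, h.n]
  r x' := by
    by_cases hx : x' = x
    · subst hx; simp [Config.setReg, Store.setR]
    · simp [Config.setReg, Store.setR, hx, h.r]
  base := by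
    have : 3 ≠ 4 * x + 1 := by omega
    simp [Config.setReg, this, h.base]
  inp := h.inp
  na := h.na
  ra := h.ra

/-- The registers `4 * x + 7` are those of residue 3 beyond the base register 3: the hidden counters
and bounds of loops. -/
theorem Rel.hidden {A : ℕ → ℕ} {w : ℕ} {S : Store} {s : Config} (h : Rel A w S s) (x : ℕ) (v : ℝ) :
    Rel A w S (s.setReg (4 * x + 7) v) where
  n x' := by
    have : 4 * x' ≠ 4 * x + 7 := by omega
    rw [← h.n]; exact Function.update_of_ne this _ _
  r x' := by
    have : 4 * x' + 1 ≠ 4 * x + 7 := by omega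
    rw [← h.r]; exact Function.update_of_ne this _ _
  base := by
    have : 3 ≠ 4 * x + 7 := by omega
    exact (Function.update_of_ne this v s.reg).trans h.base
  inp := h.inp
  na := h.na
  ra := h.ra

theorem Rel.putN {A : ℕ → ℕ} {w : ℕ} {S : Store} {s : Config} (h : Rel A w S s)
    (q : ℕ × ℕ × ℕ × ℕ) (v : ℕ) {y : ℝ} (hy : y = v) :
    Rel A w (S.putN q v) (s.setMem (w + 2 * keyCode q) y) where
  n := h.n
  r := h.r
  base := h.base
  inp a ha := by
    have : a ≠ w + 2 * keyCode q := by omega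
    simp [Config.setMem, this, h.inp a ha]
  na q' := by
    by_cases hx : q' = q
    · subst hx; simp [Config.setMem, Store.putN, hy]
    · have : keyCode q' ≠ keyCode q := fun e => hx (keyCode_injective e)
      simp [Config.setMem, Store.putN, hx, this, h.na]
  ra q' := by
    have : w + 2 * keyCode q' + 1 ≠ w + 2 * keyCode q := by omega
    simp [Config.setMem, Store.putN, this, h.ra]

theorem Rel.putR {A : ℕ → ℕ} {w : ℕ} {S : Store} {s : Config} (h : Rel A w S s)
    (q : ℕ × ℕ × ℕ × ℕ) (v : ℝ) :
    Rel A w (S.putR q v) (s.setMem (w + 2 * keyCode q + 1) v) where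
  n := h.n
  r := h.r
  base := h.base
  inp a ha := by
    have : a ≠ w + 2 * keyCode q + 1 := by omega
    simp [Config.setMem, this, h.inp a ha]
  na q' := by
    have : w + 2 * keyCode q' ≠ w + 2 * keyCode q + 1 := by omega
    simp [Config.setMem, Store.putR, this, h.na]
  ra q' := by
    by_cases hx : q' = q
    · subst hx; simp [Config.setMem, Store.putR]
    · have : keyCode q' ≠ keyCode q := fun e => hx (keyCode_injective e)
      simp [Config.setMem, Store.putR, hx, this, h.ra]

theorem Rel.goto {A : ℕ → ℕ} {w : ℕ} {S : Store} {s : Config} (h : Rel A w S s) (l : ℕ) :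
    Rel A w S (s.goto l) := ⟨h.n, h.r, h.base, h.inp, h.na, h.ra⟩

/-- The loop registers used outside of `lv` nested loops are the same. -/
def SameLoops (lv : ℕ) (s s' : Config) : Prop :=
  ∀ m < 2 * lv + 2, s'.reg (4 * m + 3) = s.reg (4 * m + 3)

theorem SameLoops.trans {lv : ℕ} {s₁ s₂ s₃ : Config} (h₁ : SameLoops lv s₁ s₂)
    (h₂ : SameLoops lv s₂ s₃) : SameLoops lv s₁ s₃ := fun m hm => (h₂ m hm).trans (h₁ m hm)

theorem SameBut.sameLoops {d : ℕ} {s₁ s₂ : Config} (h : SameBut d s₁ s₂) (lv : ℕ) :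
    SameLoops lv s₁ s₂ := fun m _ => h.reg _ fun _ _ => by omega

theorem sameLoops_setReg {lv y : ℕ} {v : ℝ} {s : Config}
    (h : ∀ m < 2 * lv + 2, y ≠ 4 * m + 3) : SameLoops lv s (s.setReg y v) :=
  fun m hm => by simp [Config.setReg, Function.update_of_ne (h m hm).symm]

/-- `P` leads from `s` to line `off` and a configuration that represents `S`, in at most `T`
steps. -/
def Arrives (P : Program) (A : ℕ → ℕ) (w lv : ℕ) (s : Config) (T off : ℕ) (S : Store) : Prop :=
  ∃ t ≤ T, ∃ s', Reach P s t s' ∧ s'.pc = off ∧ Rel A w S s' ∧ SameLoops lv s s'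

theorem Arrives.of_reach {P : Program} {A : ℕ → ℕ} {w lv : ℕ} {s s₁ : Config} {t T T' off : ℕ}
    {S : Store} (h : Reach P s t s₁) (hl : SameLoops lv s s₁) (h' : Arrives P A w lv s₁ T' off S)
    (hT : t + T' ≤ T) : Arrives P A w lv s T off S := by
  obtain ⟨t', ht', s', r, hpc, hrel, hl'⟩ := h'
  exact ⟨t + t', by omega, s', h.trans r, hpc, hrel, hl.trans hl'⟩

theorem Arrives.here {P : Program} {A : ℕ → ℕ} {w lv : ℕ} {s : Config} {T off : ℕ}
    {S : Store} (h : Rel A w S s) (hpc : s.pc = off) : Arrives P A w lv s T off S :=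
  ⟨0, by omega, s, .refl _, hpc, h, fun _ _ => rfl⟩

/-- Serves both kinds of comparison: `p` may be an inequality of natural numbers, while the machine
compares reals. The else-branch `C₂` stands first, since the jump is taken when the inequality
holds. -/
theorem arrives_branch {P : Program} {A : ℕ → ℕ} {w lv off : ℕ} {s : Config} {La Lb : List Instr}
    {a b : ℝ} {S S₁ S₂ : Store} {C₁ : List Instr} {C₂ : List Instr} {T₁ T₂ : ℕ} {p : Prop}
    [Decidable p] (hp : p ↔ a < b)
    (hrel : Rel A w S s) (hpc : s.pc = off)
    (ha : ∀ s, Rel A w S s → Yields La 0 s a) (hb : ∀ s, Rel A w S s → Yields Lb 1 s b)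
    (h₁ : ∀ s, Rel A w S s → s.pc = off + (La.length + Lb.length) + 1 + C₂.length + 1 →
      Arrives P A w lv s T₁ (s.pc + C₁.length) S₁)
    (h₂ : ∀ s, Rel A w S s → s.pc = off + (La.length + Lb.length) + 1 →
      Arrives P A w lv s T₂ (s.pc + C₂.length) S₂)
    (hP : CodeAt P off (La ++ (Lb ++ ([.jlt 2 6 (off + (La.length + Lb.length) + 1 + C₂.length + 1)]
      ++ (C₂ ++ ([.jump (off + (La.length + Lb.length) + 1 + C₂.length + 1 + C₁.length)]
      ++ C₁)))))) :
    Arrives P A w lv s (La.length + Lb.length + 2 + (T₁ + T₂))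
      (off + (La.length + (Lb.length + (1 + (C₂.length + (1 + C₁.length))))))
      (if p then S₁ else S₂) := by
  obtain ⟨s₁, r₁, b₁, v₁⟩ := ha s hrel
  have hrel₁ := hrel.sameBut b₁
  obtain ⟨s₂, r₂, b₂, v₂⟩ := hb s₁ hrel₁
  have hrel₂ := hrel₁.sameBut b₂
  rw [← b₂.temp Nat.zero_lt_one] at v₁
  have r := r₁.append r₂
  simp only [codeAt_append, CodeAt, List.length_cons, List.length_nil] at hP
  obtain ⟨hPa, hPb, ⟨hj, -⟩, hP₂, ⟨hk, -⟩, hP₁⟩ := hP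
  have hab : CodeAt P s.pc (La ++ Lb) := by rw [codeAt_append, hpc]; exact ⟨hPa, hPb⟩
  have R := r.2 P hab
  have hpc₂ : s₂.pc = off + La.length + Lb.length := by
    rw [r.1, hpc, List.length_append]; omega
  rw [← hpc₂] at hj
  have R' := R.trans (Reach.one hj rfl)
  have L' : SameLoops lv s s₂ := (b₁.sameLoops lv).trans (b₂.sameLoops lv)
  have hcond : (s₂.reg 2 < s₂.reg 6) ↔ a < b := by
    simp only [Nat.mul_zero, Nat.zero_add] at v₁
    simp only [Nat.mul_one, Nat.reduceAdd] at v₂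
    rw [v₁, v₂]
  by_cases hc : p
  · rw [if_pos hc]
    rw [if_pos (hcond.2 (hp.1 hc))] at R'
    have := h₁ _ (hrel₂.goto _) (show (s₂.goto _).pc = _ from rfl)
    refine Arrives.of_reach R' L' (T' := T₁) ?_ ?_
    · convert this using 1
      simp [Config.goto]
      omega
    · simp; omega
  · rw [if_neg hc]
    rw [if_neg (mt hcond.1 (mt hp.2 hc))] at R'
    have := h₂ _ (hrel₂.goto (s₂.pc + 1)) (show (s₂.goto _).pc = _ by
      simp [Config.goto, hpc₂]; omega)
    obtain ⟨t, ht, s₃, r₃, hpc₃, hrel₃, hl₃⟩ := this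
    have hpc₃' : s₃.pc = off + La.length + Lb.length + (0 + 1) + C₂.length := by
      rw [hpc₃]; simp [Config.goto, hpc₂]
    rw [← hpc₃'] at hk
    refine ⟨_, ?_, _, R'.trans (r₃.trans (Reach.one hk rfl)), ?_, hrel₃.goto _, L'.trans hl₃⟩
    · simp; omega
    · simp [Config.goto]; omega

/-- Simulation by induction on the statement. Loops need that their body keeps the loop registers of
the enclosing levels, so `Arrives` also records `SameLoops`. -/
theorem Stmt.arrives {P : Program} {A : ℕ → ℕ} {w : ℕ} (hA : ∀ a, w ≤ a → A a = 0) (c : Stmt)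
    (off lv : ℕ) (S : Store) (s : Config) (hrel : Rel A w S s) (hpc : s.pc = off)
    (hP : CodeAt P off (c.code off lv)) :
    Arrives P A w lv s (c.cost A S) (off + c.lines) (c.run A S) := by
  induction c generalizing off lv S s with
  | setN x e =>
    subst hpc
    obtain ⟨s₁, r₁, b₁, v₁⟩ := e.yields_code 0 s hrel
    have R := r₁.append (.cons (i := .move (4 * x) 2) rfl rfl (.nil _))
    refine ⟨_, ?_, _, R.2 P hP, ?_, (hrel.sameBut b₁).setN x _ v₁, (b₁.sameLoops lv).trans
      (sameLoops_setReg fun _ _ => by omega)⟩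
    · simp [Stmt.cost, Stmt.lines]
    · rw [R.1]; simp [Stmt.lines]
  | setR x e =>
    subst hpc
    obtain ⟨s₁, r₁, b₁, v₁⟩ := e.yields_code 0 s hrel
    have R := r₁.append (.cons (i := .move (4 * x + 1) 2) rfl rfl (.nil _))
    have hr := (hrel.sameBut b₁).setR x (s₁.reg 2)
    rw [show s₁.reg 2 = _ from v₁] at hr
    refine ⟨_, ?_, _, R.2 P hP, ?_, by
      simpa [Stmt.run, show s₁.reg 2 = _ from v₁] using hr,
      (b₁.sameLoops lv).trans (sameLoops_setReg fun _ _ => by omega)⟩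
    · simp [Stmt.cost, Stmt.lines]
    · rw [R.1]; simp [Stmt.lines]
  | putN t i j l e =>
    subst hpc
    obtain ⟨s₁, r₁, b₁, v₁⟩ := yields_addrCode (t := t) (z := 0) hrel
      (fun s => i.yields_code 0 s) (fun s => j.yields_code 1 s) (fun s => l.yields_code 1 s)
    replace hrel := hrel.sameBut b₁
    obtain ⟨s₂, r₂, b₂, v₂⟩ := e.yields_code 1 s₁ hrel
    replace hrel := hrel.sameBut b₂
    rw [← b₂.temp Nat.zero_lt_one] at v₁
    have R := r₁.append (r₂.append (.cons (i := .store 2 6) (exec_store v₁) rfl (.nil _)))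
    refine ⟨_, ?_, _, R.2 P hP, ?_, hrel.putN _ _ v₂,
      (b₁.sameLoops lv).trans (b₂.sameLoops lv)⟩
    · simp [Stmt.cost, Stmt.lines]
    · rw [R.1]; simp [Stmt.lines]
  | putR t i j l e =>
    subst hpc
    obtain ⟨s₁, r₁, b₁, v₁⟩ := yields_addrCode (t := t) (z := 1) hrel
      (fun s => i.yields_code 0 s) (fun s => j.yields_code 1 s) (fun s => l.yields_code 1 s)
    replace hrel := hrel.sameBut b₁
    obtain ⟨s₂, r₂, b₂, v₂⟩ := e.yields_code 1 s₁ hrel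
    replace hrel := hrel.sameBut b₂
    rw [← b₂.temp Nat.zero_lt_one] at v₁
    have R := r₁.append (r₂.append (.cons (i := .store 2 6) (exec_store v₁) rfl (.nil _)))
    refine ⟨_, ?_, _, R.2 P hP, ?_, by
      simpa [Stmt.run, show s₂.reg 6 = _ from v₂] using hrel.putR _ (s₂.reg 6),
      (b₁.sameLoops lv).trans (b₂.sameLoops lv)⟩
    · simp [Stmt.cost, Stmt.lines]
    · rw [R.1]; simp [Stmt.lines]
  | inp x e =>
    obtain ⟨s₁, r₁, b₁, v₁⟩ := e.yields_code 0 s hrel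
    have hrel₁ := hrel.sameBut b₁
    simp only [Stmt.code, codeAt_append, CodeAt] at hP
    obtain ⟨hPe, hP1, hP2, hP3, hP4, -⟩ := hP
    have hpc₁ : s₁.pc = off + (e.code 0).length := by rw [r₁.1, hpc]
    rw [← hpc] at hPe
    have R := (r₁.2 P hPe).trans (Reach.one (by rw [hpc₁]; exact hP1) rfl)
    have hrel₂ := hrel₁.setN x 0 (y := (0 : ℤ)) (by simp)
    have L : SameLoops lv s (s₁.setReg (4 * x) (0 : ℤ)) :=
      (b₁.sameLoops lv).trans (sameLoops_setReg fun _ _ => by omega)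
    have hv : (s₁.setReg (4 * x) (0 : ℤ)).reg 2 = e.eval S := by
      have : 2 ≠ 4 * x := by omega
      simpa [Config.setReg, this] using v₁
    have R' := R.trans (Reach.one (by
      rw [show (s₁.setReg (4 * x) (0 : ℤ)).pc = s₁.pc + 1 from rfl, hpc₁]; exact hP2) rfl)
    have hb := hrel₂.base
    -- Cells from `w` on hold arrays, so they must not be read as input; the code skips the load
    -- there and leaves the value 0, in agreement with `hA`.
    by_cases hw : w ≤ e.eval S
    · rw [if_pos (by rw [hb, hv]; exact_mod_cast hw)] at R'
      refine ⟨_, ?_, _, R', ?_, ?_, L⟩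
      · simp [Stmt.cost, Stmt.lines]
      · simp [Config.goto, Stmt.lines]; omega
      · simpa [Stmt.run, hA _ hw] using hrel₂.goto _
    · rw [if_neg (by rw [hb, hv]; exact_mod_cast hw)] at R'
      have R'' := (R'.trans (Reach.one (by
        simpa [Config.goto, Config.setReg, hpc₁] using hP3) (exec_load
          (show ((s₁.setReg (4 * x) (0 : ℤ)).goto _).reg 2 = _ from hv)))).trans
          (Reach.one (by simpa [Config.goto, Config.setReg, hpc₁] using hP4) rfl)
      refine ⟨_, ?_, _, R'', ?_, ?_, ?_⟩
      · simp [Stmt.cost, Stmt.lines]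
      · simp [Config.goto, Config.setReg, Stmt.lines, hpc₁]; omega
      · have b₃ := SameBut.setReg 0 0 le_rfl ((s₁.setReg (4 * x) (0 : ℤ)).goto
          ((s₁.setReg (4 * x) (0 : ℤ)).pc + 1))
          (((s₁.setReg (4 * x) (0 : ℤ)).goto
          ((s₁.setReg (4 * x) (0 : ℤ)).pc + 1)).mem (e.eval S))
        have h3 := ((hrel₂.goto _).sameBut b₃).setN x (A (e.eval S)) (y := A (e.eval S)) rfl
        have hm : s₁.mem (e.eval S) = A (e.eval S) := hrel₁.inp _ (not_le.1 hw)
        convert h3 using 1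
        · simp [Stmt.run, Store.setN]
        · simp [Config.goto, Config.setReg, hm]
      · refine L.trans (fun m hm => ?_)
        have h1 : 4 * m + 3 ≠ 4 * x := by omega
        have h2 : 4 * m + 3 ≠ 2 := by omega
        simp [Config.goto, Config.setReg, h1, h2]
  | seq c₁ c₂ ih₁ ih₂ =>
    simp only [Stmt.code, codeAt_append, Stmt.length_code] at hP
    obtain ⟨t₁, ht₁, s₁, r₁, hpc₁, hrel₁, hl₁⟩ := ih₁ off lv S s hrel hpc hP.1
    refine .of_reach r₁ hl₁ (T' := c₂.cost A (c₁.run A S)) ?_ (by simp only [Stmt.cost]; omega)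
    have := ih₂ (off + c₁.lines) lv _ s₁ hrel₁ hpc₁ hP.2
    simpa only [Stmt.lines, Stmt.run, Nat.add_assoc] using this
  | iteN a b c₁ c₂ ih₁ ih₂ =>
    have := arrives_branch (P := P) (lv := lv) (a := a.eval S) (b := b.eval S)
      (p := a.eval S < b.eval S) (S₁ := c₁.run A S) (S₂ := c₂.run A S)
      (C₁ := c₁.code (off + ((a.code 0).length + (b.code 1).length) + 1 + c₂.lines + 1) lv)
      (C₂ := c₂.code (off + ((a.code 0).length + (b.code 1).length) + 1) lv)
      (T₁ := c₁.cost A S) (T₂ := c₂.cost A S)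
      (by exact_mod_cast Iff.rfl) hrel hpc (fun s => a.yields_code 0 s)
      (fun s => b.yields_code 1 s)
    simp only [Stmt.code] at hP
    simp only [Stmt.length_code] at this
    simp only [Stmt.run, Stmt.lines, Stmt.cost]
    simp only [codeAt_append, Stmt.length_code, List.length_cons, List.length_nil] at hP this
    refine this ?_ ?_ hP
    · intro s' hs' hpc'
      rw [hpc']
      refine ih₁ _ lv S s' hs' hpc' ?_
      convert hP.2.2.2.2.2 using 1
      omega
    · intro s' hs' hpc'
      rw [hpc']
      refine ih₂ _ lv S s' hs' hpc' ?_
      convert hP.2.2.2.1 using 1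
      omega
  | iteR a b c₁ c₂ ih₁ ih₂ =>
    classical
    have := arrives_branch (P := P) (lv := lv) (a := a.eval S) (b := b.eval S)
      (p := a.eval S < b.eval S) (S₁ := c₁.run A S) (S₂ := c₂.run A S)
      (C₁ := c₁.code (off + ((a.code 0).length + (b.code 1).length) + 1 + c₂.lines + 1) lv)
      (C₂ := c₂.code (off + ((a.code 0).length + (b.code 1).length) + 1) lv)
      (T₁ := c₁.cost A S) (T₂ := c₂.cost A S)
      Iff.rfl hrel hpc (fun s => a.yields_code 0 s)
      (fun s => b.yields_code 1 s)
    simp only [Stmt.code] at hP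
    simp only [Stmt.length_code] at this
    simp only [Stmt.run, Stmt.lines, Stmt.cost]
    simp only [codeAt_append, Stmt.length_code, List.length_cons, List.length_nil] at hP this
    convert this ?_ ?_ hP
    · intro s' hs' hpc'
      rw [hpc']
      refine ih₁ _ lv S s' hs' hpc' ?_
      convert hP.2.2.2.2.2 using 1
      omega
    · intro s' hs' hpc'
      rw [hpc']
      refine ih₂ _ lv S s' hs' hpc' ?_
      convert hP.2.2.2.1 using 1
      omega
  | skip => exact .here hrel hpc
  | loop x b c ih =>
    simp only [Stmt.code, codeAt_append, CodeAt, List.length_cons, List.length_nil,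
      Stmt.length_code] at hP
    obtain ⟨⟨hP0, hP1, hP2, hP3, -⟩, hPc, hP4, hP5, hP6, -⟩ := hP
    -- Invariant at the loop test. Two instructions initialize the counter and the bound; a round
    -- costs its body and five more (test, copying the counter, loading 1, increment, jump back).
    -- The last test makes up the 3 in `Stmt.cost`.
    have key : ∀ m ≤ S.n b, ∃ t ≤ 2 + ∑ m ∈ Finset.range m,
        (c.cost A ((iter x (c.run A) S m).setN x m) + 5), ∃ s', Reach P s t s' ∧
        s'.pc = off + 2 ∧ Rel A w (iter x (c.run A) S m) s' ∧ SameLoops lv s s' ∧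
        s'.reg (8 * lv + 11) = m ∧ s'.reg (8 * lv + 15) = S.n b := by
      intro m hm
      induction m with
      | zero =>
        refine ⟨_, ?_, _, (Reach.one (by rw [hpc]; exact hP0) rfl).trans (Reach.one (by
          simpa [Config.setReg, hpc] using hP1) rfl), ?_, ?_, ?_, ?_, ?_⟩
        · simp
        · simp [Config.setReg, hpc]
        · have := (hrel.hidden (2 * lv + 1) 0).hidden (2 * lv + 2) (S.n b)
          have h1 : 4 * (2 * lv + 1) + 7 = 8 * lv + 11 := by omega
          have h2 : 4 * (2 * lv + 2) + 7 = 8 * lv + 15 := by omega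
          have h3 : 4 * b ≠ 8 * lv + 11 := by omega
          rw [h1, h2] at this
          simpa [iter, Config.setReg, h3, hrel.n] using this
        · exact (sameLoops_setReg fun _ _ => by omega).trans
            (sameLoops_setReg fun _ _ => by omega)
        · simp [Config.setReg]
        · have h3 : 4 * b ≠ 8 * lv + 11 := by omega
          simp [Config.setReg, h3, hrel.n]
      | succ m ihm =>
        obtain ⟨t, ht, s₁, r₁, hpc₁, hrel₁, hl₁, hc, hb⟩ := ihm (by omega)
        have r₂ := r₁.trans (Reach.one (by rw [hpc₁]; exact hP2) rfl)
        rw [if_neg (by rw [hc, hb]; simp; omega), hpc₁] at r₂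
        have r₃ := r₂.trans (Reach.one hP3 rfl)
        have hrel₂ := (hrel₁.goto (off + 2 + 1)).setN x m (y := s₁.reg (8 * lv + 11)) hc
        obtain ⟨t', ht', s₄, r₄, hpc₄, hrel₄, hl₄⟩ := ih (off + 4) (lv + 1) _ _ hrel₂ rfl hPc
        have h₁ : s₄.reg (8 * lv + 11) = m := by
          have := hl₄ (2 * lv + 2) (by omega)
          rw [show 4 * (2 * lv + 2) + 3 = 8 * lv + 11 by omega] at this
          have h3 : 8 * lv + 11 ≠ 4 * x := by omega
          rw [this]
          simp [Config.setReg, Config.goto, h3, hc]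
        have h₂ : s₄.reg (8 * lv + 15) = S.n b := by
          have := hl₄ (2 * lv + 3) (by omega)
          rw [show 4 * (2 * lv + 3) + 3 = 8 * lv + 15 by omega] at this
          have h3 : 8 * lv + 15 ≠ 4 * x := by omega
          rw [this]
          simp [Config.setReg, Config.goto, h3, hb]
        have r₅ := ((r₃.trans r₄).trans (Reach.one (by rw [hpc₄]; exact hP4) rfl)).trans
          ((Reach.one (by simpa [Config.setReg, hpc₄] using hP5) rfl).trans
            (Reach.one (by simpa [Config.setReg, hpc₄] using hP6) rfl))
        have b₅ := SameBut.setReg 0 0 le_rfl s₄ (1 : ℤ)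
        refine ⟨_, ?_, _, r₅, rfl, ?_, ?_, ?_, ?_⟩
        · rw [Finset.sum_range_succ]; omega
        · have := (hrel₄.sameBut b₅).hidden (2 * lv + 1) (m + 1)
          rw [show 4 * (2 * lv + 1) + 7 = 8 * lv + 11 by omega] at this
          have h3 : 8 * lv + 11 ≠ 2 := by omega
          simpa [iter, Config.setReg, h3, h₁] using this.goto (off + 2)
        · refine hl₁.trans fun i hi => ?_
          have e1 : 4 * i + 3 ≠ 8 * lv + 11 := by omega
          have e2 : 4 * i + 3 ≠ 2 := by omega
          have e3 : 4 * i + 3 ≠ 4 * x := by omega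
          have := hl₄ i (by omega)
          simp only [Config.setReg, Config.goto] at this ⊢
          rw [Function.update_of_ne e1, Function.update_of_ne e2, this, Function.update_of_ne e3]
        · have h3 : 8 * lv + 11 ≠ 2 := by omega
          simp [Config.setReg, Config.goto, h3, h₁]
        · have h3 : 8 * lv + 15 ≠ 2 := by omega
          simp [Config.setReg, Config.goto, h3, h₂]
    obtain ⟨t, ht, s₁, r₁, hpc₁, hrel₁, hl₁, hc, hb⟩ := key _ le_rfl
    have r₂ := r₁.trans (Reach.one (by rw [hpc₁]; exact hP2) rfl)
    rw [if_pos (by rw [hc, hb])] at r₂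
    refine ⟨_, ?_, _, r₂, rfl, hrel₁.goto _, hl₁⟩
    simp only [Stmt.cost]
    omega

/-! ### Reasoning about loop programs -/

/-- Whether the statement may write the natural variable `y`. -/
def Stmt.writesN : Stmt → ℕ → Bool
  | setN x _, y => x == y
  | inp x _, y => x == y
  | seq c₁ c₂, y => c₁.writesN y || c₂.writesN y
  | iteN _ _ c₁ c₂, y => c₁.writesN y || c₂.writesN y
  | iteR _ _ c₁ c₂, y => c₁.writesN y || c₂.writesN y
  | loop x _ c, y => x == y || c.writesN y
  | _, _ => false

/-- Whether the statement may write the real variable `y`. -/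
def Stmt.writesR : Stmt → ℕ → Bool
  | setR x _, y => x == y
  | seq c₁ c₂, y => c₁.writesR y || c₂.writesR y
  | iteN _ _ c₁ c₂, y => c₁.writesR y || c₂.writesR y
  | iteR _ _ c₁ c₂, y => c₁.writesR y || c₂.writesR y
  | loop _ _ c, y => c.writesR y
  | _, _ => false

/-- Whether the statement may write the natural array `y`. -/
def Stmt.writesNA : Stmt → ℕ → Bool
  | putN t _ _ _ _, y => t == y
  | seq c₁ c₂, y => c₁.writesNA y || c₂.writesNA y
  | iteN _ _ c₁ c₂, y => c₁.writesNA y || c₂.writesNA y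
  | iteR _ _ c₁ c₂, y => c₁.writesNA y || c₂.writesNA y
  | loop _ _ c, y => c.writesNA y
  | _, _ => false

/-- Whether the statement may write the real array `y`. -/
def Stmt.writesRA : Stmt → ℕ → Bool
  | putR t _ _ _ _, y => t == y
  | seq c₁ c₂, y => c₁.writesRA y || c₂.writesRA y
  | iteN _ _ c₁ c₂, y => c₁.writesRA y || c₂.writesRA y
  | iteR _ _ c₁ c₂, y => c₁.writesRA y || c₂.writesRA y
  | loop _ _ c, y => c.writesRA y
  | _, _ => false

/-- `S'` differs from `S` only where `c` may write. -/
structure Agree (c : Stmt) (S S' : Store) : Prop where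
  n : ∀ x, c.writesN x = false → S'.n x = S.n x
  r : ∀ x, c.writesR x = false → S'.r x = S.r x
  na : ∀ t i, c.writesNA t = false → S'.na (t, i) = S.na (t, i)
  ra : ∀ t i, c.writesRA t = false → S'.ra (t, i) = S.ra (t, i)

theorem Agree.refl (c : Stmt) (S : Store) : Agree c S S :=
  ⟨fun _ _ => rfl, fun _ _ => rfl, fun _ _ _ => rfl, fun _ _ _ => rfl⟩

theorem Agree.trans {c : Stmt} {S₁ S₂ S₃ : Store} (h₁ : Agree c S₁ S₂) (h₂ : Agree c S₂ S₃) :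
    Agree c S₁ S₃ :=
  ⟨fun x h => (h₂.n x h).trans (h₁.n x h), fun x h => (h₂.r x h).trans (h₁.r x h),
    fun t i h => (h₂.na t i h).trans (h₁.na t i h), fun t i h => (h₂.ra t i h).trans (h₁.ra t i h)⟩

theorem Agree.mono {c c' : Stmt} {S S' : Store} (h : Agree c S S')
    (hn : ∀ x, c'.writesN x = false → c.writesN x = false)
    (hr : ∀ x, c'.writesR x = false → c.writesR x = false)
    (hna : ∀ x, c'.writesNA x = false → c.writesNA x = false)
    (hra : ∀ x, c'.writesRA x = false → c.writesRA x = false) : Agree c' S S' :=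
  ⟨fun x hx => h.n x (hn x hx), fun x hx => h.r x (hr x hx),
    fun t i ht => h.na t i (hna t ht), fun t i ht => h.ra t i (hra t ht)⟩

theorem Agree.setN_loop (x b : ℕ) (c : Stmt) (S : Store) (v : ℕ) :
    Agree (.loop x b c) S (S.setN x v) := by
  refine ⟨fun y h => ?_, fun _ _ => rfl, fun _ _ _ => rfl, fun _ _ _ => rfl⟩
  have : y ≠ x := by rintro rfl; simp [Stmt.writesN] at h
  simp [Store.setN, this]

theorem Agree.loop {x b : ℕ} {c : Stmt} {S S' : Store} (h : Agree c S S') :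
    Agree (.loop x b c) S S' :=
  h.mono (by simp [Stmt.writesN]) (by simp [Stmt.writesR]) (by simp [Stmt.writesNA])
    (by simp [Stmt.writesRA])

theorem agree_iter {A : ℕ → ℕ} {x b : ℕ} {c : Stmt} (hc : ∀ S, Agree c S (c.run A S)) (S : Store)
    (m : ℕ) : Agree (.loop x b c) S (iter x (c.run A) S m) := by
  induction m with
  | zero => exact .refl _ _
  | succ m ih => exact (ih.trans (.setN_loop x b c _ m)).trans (hc _).loop

/-- The frame rule. Since the write sets are computed from the syntax, the preservation of a
concrete variable or array becomes a proof by `rfl`. -/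
theorem Stmt.agree_run (A : ℕ → ℕ) (c : Stmt) (S : Store) : Agree c S (c.run A S) := by
  induction c generalizing S with
  | setN x e =>
    refine ⟨fun y h => ?_, fun _ _ => rfl, fun _ _ _ => rfl, fun _ _ _ => rfl⟩
    have : y ≠ x := by rintro rfl; simp [Stmt.writesN] at h
    simp [Stmt.run, Store.setN, this]
  | setR x e =>
    refine ⟨fun _ _ => rfl, fun y h => ?_, fun _ _ _ => rfl, fun _ _ _ => rfl⟩
    have : y ≠ x := by rintro rfl; simp [Stmt.writesR] at h
    simp [Stmt.run, Store.setR, this]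
  | putN t i j l e =>
    refine ⟨fun _ _ => rfl, fun _ _ => rfl, fun y q h => ?_, fun _ _ _ => rfl⟩
    have : y ≠ t := by rintro rfl; simp [Stmt.writesNA] at h
    simp [Stmt.run, Store.putN, this]
  | putR t i j l e =>
    refine ⟨fun _ _ => rfl, fun _ _ => rfl, fun _ _ _ => rfl, fun y q h => ?_⟩
    have : y ≠ t := by rintro rfl; simp [Stmt.writesRA] at h
    simp [Stmt.run, Store.putR, this]
  | inp x e =>
    refine ⟨fun y h => ?_, fun _ _ => rfl, fun _ _ _ => rfl, fun _ _ _ => rfl⟩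
    have : y ≠ x := by rintro rfl; simp [Stmt.writesN] at h
    simp [Stmt.run, Store.setN, this]
  | seq c₁ c₂ ih₁ ih₂ =>
    refine Agree.trans (S₂ := c₁.run A S) ((ih₁ S).mono ?_ ?_ ?_ ?_) ((ih₂ _).mono ?_ ?_ ?_ ?_) <;>
      simp +contextual [Stmt.writesN, Stmt.writesR, Stmt.writesNA, Stmt.writesRA]
  | iteN a b c₁ c₂ ih₁ ih₂ =>
    simp only [Stmt.run]
    split
    · refine (ih₁ S).mono ?_ ?_ ?_ ?_ <;>
        simp +contextual [Stmt.writesN, Stmt.writesR, Stmt.writesNA, Stmt.writesRA]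
    · refine (ih₂ S).mono ?_ ?_ ?_ ?_ <;>
        simp +contextual [Stmt.writesN, Stmt.writesR, Stmt.writesNA, Stmt.writesRA]
  | iteR a b c₁ c₂ ih₁ ih₂ =>
    simp only [Stmt.run]
    split
    · refine (ih₁ S).mono ?_ ?_ ?_ ?_ <;>
        simp +contextual [Stmt.writesN, Stmt.writesR, Stmt.writesNA, Stmt.writesRA]
    · refine (ih₂ S).mono ?_ ?_ ?_ ?_ <;>
        simp +contextual [Stmt.writesN, Stmt.writesR, Stmt.writesNA, Stmt.writesRA]
  | skip => exact .refl _ _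
  | loop x b c ih => exact agree_iter ih S _

/-- The invariant rule for loops. -/
theorem loop_induct {A : ℕ → ℕ} {x b : ℕ} {c : Stmt} {S : Store} (I : ℕ → Store → Prop)
    (h0 : I 0 S) (hs : ∀ m < S.n b, ∀ S', Agree (.loop x b c) S S' → I m S' →
      I (m + 1) (c.run A (S'.setN x m))) :
    I (S.n b) ((Stmt.loop x b c).run A S) := by
  have key : ∀ m ≤ S.n b, I m (iter x (c.run A) S m) := by
    intro m
    induction m with
    | zero => exact fun _ => h0
    | succ m ih => exact fun hm => hs m hm _ (agree_iter (c.agree_run A) S m) (ih (by omega))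
  exact key _ le_rfl

/-- A property that the body preserves is preserved by the loop. -/
theorem loop_preserve {A : ℕ → ℕ} {x b : ℕ} {c : Stmt} {S : Store} (J : Store → Prop)
    (h0 : J S) (hs : ∀ m < S.n b, ∀ S', Agree (.loop x b c) S S' → J S' →
      J (c.run A (S'.setN x m))) : J ((Stmt.loop x b c).run A S) :=
  loop_induct (fun _ => J) h0 hs

/-- A property that the body preserves holds after the loop, if it is established in round `m₀`. -/
theorem loop_establish {A : ℕ → ℕ} {x b m₀ : ℕ} {c : Stmt} {S : Store} (Q : Store → Prop)
    (hm₀ : m₀ < S.n b)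
    (he : ∀ S', Agree (.loop x b c) S S' → Q (c.run A (S'.setN x m₀)))
    (hs : ∀ m < S.n b, ∀ S', Agree (.loop x b c) S S' → Q S' → Q (c.run A (S'.setN x m))) :
    Q ((Stmt.loop x b c).run A S) := by
  refine loop_induct (fun m S' => m₀ < m → Q S') (fun h => absurd h (by omega))
    (fun m hm S' ha ih h => ?_) hm₀
  rcases Nat.lt_succ_iff_lt_or_eq.1 h with h | rfl
  · exact hs m hm S' ha (ih h)
  · exact he S' ha

/-! ### Running time of loop programs -/

/-- The variables that bound the loops. -/
def Stmt.loopVars : Stmt → List ℕ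
  | seq c₁ c₂ => c₁.loopVars ++ c₂.loopVars
  | iteN _ _ c₁ c₂ => c₁.loopVars ++ c₂.loopVars
  | iteR _ _ c₁ c₂ => c₁.loopVars ++ c₂.loopVars
  | loop _ b c => b :: c.loopVars
  | _ => []

/-- An upper bound for the running time when no loop has more than `N` rounds. -/
def Stmt.maxCost (N : ℕ) : Stmt → ℕ
  | seq c₁ c₂ => c₁.maxCost N + c₂.maxCost N
  | iteN a b c₁ c₂ => (a.code 0).length + (b.code 1).length + 2 + (c₁.maxCost N + c₂.maxCost N)
  | iteR a b c₁ c₂ => (a.code 0).length + (b.code 1).length + 2 + (c₁.maxCost N + c₂.maxCost N)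
  | loop _ _ c => 3 + N * (c.maxCost N + 5)
  | c => c.lines

/-- The greatest number of nested loops. -/
def Stmt.depth : Stmt → ℕ
  | seq c₁ c₂ => max c₁.depth c₂.depth
  | iteN _ _ c₁ c₂ => max c₁.depth c₂.depth
  | iteR _ _ c₁ c₂ => max c₁.depth c₂.depth
  | loop _ _ c => c.depth + 1
  | _ => 0

/-- As the statement never writes a variable that bounds a loop, the initial values of these
variables limit the loops at every later time too. -/
theorem Stmt.cost_le_maxCost {A : ℕ → ℕ} {N : ℕ} (c : Stmt) (S : Store)
    (hN : ∀ b ∈ c.loopVars, S.n b ≤ N) (hw : ∀ b ∈ c.loopVars, c.writesN b = false) :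
    c.cost A S ≤ c.maxCost N := by
  induction c generalizing S with
  | seq c₁ c₂ ih₁ ih₂ =>
    simp only [loopVars, List.mem_append, writesN, Bool.or_eq_false_iff] at hN hw
    refine Nat.add_le_add (ih₁ S (fun b hb => hN b (.inl hb)) fun b hb => (hw b (.inl hb)).1)
      (ih₂ _ (fun b hb => ?_) fun b hb => (hw b (.inr hb)).2)
    rw [(c₁.agree_run A S).n b (hw b (.inr hb)).1]
    exact hN b (.inr hb)
  | iteN a b c₁ c₂ ih₁ ih₂ =>
    simp only [loopVars, List.mem_append, writesN, Bool.or_eq_false_iff] at hN hw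
    exact Nat.add_le_add_left (Nat.add_le_add
      (ih₁ S (fun b hb => hN b (.inl hb)) fun b hb => (hw b (.inl hb)).1)
      (ih₂ _ (fun b hb => hN b (.inr hb)) fun b hb => (hw b (.inr hb)).2)) _
  | iteR a b c₁ c₂ ih₁ ih₂ =>
    simp only [loopVars, List.mem_append, writesN, Bool.or_eq_false_iff] at hN hw
    exact Nat.add_le_add_left (Nat.add_le_add
      (ih₁ S (fun b hb => hN b (.inl hb)) fun b hb => (hw b (.inl hb)).1)
      (ih₂ _ (fun b hb => hN b (.inr hb)) fun b hb => (hw b (.inr hb)).2)) _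
  | loop x b c ih =>
    have hw' : ∀ b' ∈ c.loopVars, (Stmt.loop x b c).writesN b' = false :=
      fun b' hb' => hw b' (by simp [loopVars, hb'])
    refine Nat.add_le_add_left ?_ 3
    calc _ ≤ ∑ _m ∈ Finset.range (S.n b), (c.maxCost N + 5) := by
          refine Finset.sum_le_sum fun m _ => Nat.add_le_add_right (ih _ (fun b' hb' => ?_)
            fun b' hb' => ?_) 5
          · rw [((agree_iter (x := x) (b := b) (c.agree_run A) S m).trans
              (.setN_loop x b c _ m)).n b' (hw' b' hb')]
            exact hN b' (by simp [loopVars, hb'])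
          · have := hw' b' hb'
            simp only [writesN, Bool.or_eq_false_iff] at this
            exact this.2
      _ ≤ N * (c.maxCost N + 5) := by
          rw [Finset.sum_const, Finset.card_range, smul_eq_mul]
          exact Nat.mul_le_mul_right _ (hN b (by simp [loopVars]))
  | skip => exact Nat.zero_le _
  | _ => exact le_rfl

/-- The cost is a polynomial in `N` with natural coefficients whose degree is at most the nesting
depth; its value at 1 is the sum of the coefficients. -/
theorem Stmt.maxCost_le (N : ℕ) (c : Stmt) : c.maxCost N ≤ c.maxCost 1 * (N + 1) ^ c.depth := by
  have hp : ∀ {d d' : ℕ}, d ≤ d' → (N + 1) ^ d ≤ (N + 1) ^ d' := fun h =>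
    Nat.pow_le_pow_right (by omega) h
  have h1 : ∀ d, 1 ≤ (N + 1) ^ d := fun d => Nat.one_le_pow _ _ (by omega)
  have two : ∀ {a b a' b' d d' : ℕ}, a' ≤ a * (N + 1) ^ d → b' ≤ b * (N + 1) ^ d' →
      a' + b' ≤ (a + b) * (N + 1) ^ max d d' := by
    intro a b a' b' d d' h h'
    rw [Nat.add_mul]
    exact Nat.add_le_add (h.trans (Nat.mul_le_mul_left _ (hp (le_max_left _ _))))
      (h'.trans (Nat.mul_le_mul_left _ (hp (le_max_right _ _))))
  induction c with
  | seq c₁ c₂ ih₁ ih₂ => exact two ih₁ ih₂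
  | iteN a b c₁ c₂ ih₁ ih₂ =>
    simp only [maxCost, depth]
    rw [Nat.add_mul]
    exact Nat.add_le_add (Nat.le_mul_of_pos_right _ (h1 _)) (two ih₁ ih₂)
  | iteR a b c₁ c₂ ih₁ ih₂ =>
    simp only [maxCost, depth]
    rw [Nat.add_mul]
    exact Nat.add_le_add (Nat.le_mul_of_pos_right _ (h1 _)) (two ih₁ ih₂)
  | loop x b c ih =>
    simp only [maxCost, depth, one_mul]
    have := h1 c.depth
    have h5 := h1 (c.depth + 1)
    calc 3 + N * (c.maxCost N + 5)
        ≤ 3 * (N + 1) ^ (c.depth + 1) +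
          (N + 1) * (c.maxCost 1 * (N + 1) ^ c.depth + 5 * (N + 1) ^ c.depth) := by
          gcongr <;> omega
      _ = _ := by ring
  | skip => exact Nat.zero_le _
  | _ => exact Nat.le_mul_of_pos_right _ (h1 _)

end RealRAM

/-! ### Inverse distances -/

section InvDist

variable {V W : Type*} {G G' : SimpleGraph V}

theorem invDist_self (G : SimpleGraph V) (a : V) : invDist G a a = 0 := by simp [invDist]

theorem invDist_nonneg (G : SimpleGraph V) (a b : V) : 0 ≤ invDist G a b := by
  unfold invDist; split <;> positivity

theorem invDist_le_one (G : SimpleGraph V) (a b : V) : invDist G a b ≤ 1 := by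
  unfold invDist
  split
  · rcases Nat.eq_zero_or_pos (G.dist a b) with h | h
    · simp [h]
    · rw [div_le_one (by exact_mod_cast h)]; exact_mod_cast h
  · exact zero_le_one

theorem invDist_comm (G : SimpleGraph V) (a b : V) : invDist G a b = invDist G b a := by
  unfold invDist
  rw [SimpleGraph.dist_comm, SimpleGraph.reachable_comm]

theorem invDist_of_not_reachable {a b : V} (h : ¬G.Reachable a b) : invDist G a b = 0 := by
  simp [invDist, h]

theorem invDist_of_reachable {a b : V} (h : G.Reachable a b) :
    invDist G a b = 1 / (G.dist a b : ℝ) := by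
  simp [invDist, h]

/-- Shorter walks give larger inverse distances, provided that distinct endpoints are not
identified: a vertex has inverse distance 0 from itself. -/
theorem invDist_le_of_walks {H : SimpleGraph W} {a b : V} {a' b' : W} (hne : a ≠ b → a' ≠ b')
    (h : ∀ p : G.Walk a b, ∃ q : H.Walk a' b', q.length ≤ p.length) :
    invDist G a b ≤ invDist H a' b' := by
  by_cases hr : G.Reachable a b
  · by_cases hab : a = b
    · subst hab; rw [invDist_self]; exact invDist_nonneg _ _ _
    obtain ⟨p, hp⟩ := hr.exists_walk_length_eq_dist
    obtain ⟨q, hq⟩ := h p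
    rw [invDist_of_reachable hr, invDist_of_reachable ⟨q⟩]
    have h1 : 0 < H.dist a' b' := SimpleGraph.Reachable.pos_dist_of_ne ⟨q⟩ (hne hab)
    refine one_div_le_one_div_of_le (by exact_mod_cast h1) ?_
    exact_mod_cast (SimpleGraph.dist_le q).trans (hq.trans hp.le)
  · rw [invDist_of_not_reachable hr]; exact invDist_nonneg _ _ _

/-- If every edge of `G` at a vertex of `X` is an edge of `G'` and stays in `X`, then walks of `G`
that start in `X` are walks of `G'` in `X`. -/
theorem exists_walk_of_closed {X : Set V}
    (h : ∀ a ∈ X, ∀ b, G.Adj a b → G'.Adj a b ∧ b ∈ X) {a b : V} (p : G.Walk a b) (ha : a ∈ X) :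
    b ∈ X ∧ ∃ q : G'.Walk a b, q.length = p.length := by
  induction p with
  | nil => exact ⟨ha, .nil, rfl⟩
  | cons hadj p ih =>
    obtain ⟨h1, h2⟩ := h _ ha _ hadj
    obtain ⟨hb, q, hq⟩ := ih h2
    exact ⟨hb, .cons h1 q, by simp [hq]⟩

theorem reachable_of_closed {X : Set V}
    (h : ∀ a ∈ X, ∀ b, G.Adj a b → G'.Adj a b ∧ b ∈ X) {a b : V} (hr : G.Reachable a b)
    (ha : a ∈ X) : b ∈ X ∧ G'.Reachable a b := by
  obtain ⟨p⟩ := hr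
  obtain ⟨h1, q, -⟩ := exists_walk_of_closed h p ha
  exact ⟨h1, ⟨q⟩⟩

theorem invDist_le_of_closed {X : Set V}
    (h : ∀ a ∈ X, ∀ b, G.Adj a b → G'.Adj a b ∧ b ∈ X) {a b : V} (ha : a ∈ X) :
    invDist G a b ≤ invDist G' a b :=
  invDist_le_of_walks id fun p => by
    obtain ⟨-, q, hq⟩ := exists_walk_of_closed h p ha
    exact ⟨q, hq.le⟩

end InvDist

/-! ### Vertex deletion -/

namespace SimpleGraph

variable {V : Type*}

/-- The graph `G` without the edges that meet `S`. -/
def avoid (G : SimpleGraph V) (S : Finset V) : SimpleGraph V where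
  Adj a b := G.Adj a b ∧ a ∉ S ∧ b ∉ S
  symm := ⟨fun _ _ h => ⟨h.1.symm, h.2.2, h.2.1⟩⟩
  loopless := ⟨fun _ h => h.1.ne rfl⟩

theorem avoid_adj {G : SimpleGraph V} {S : Finset V} {a b : V} :
    (G.avoid S).Adj a b ↔ G.Adj a b ∧ a ∉ S ∧ b ∉ S := Iff.rfl

theorem avoid_le (G : SimpleGraph V) (S : Finset V) : G.avoid S ≤ G := fun _ _ h => h.1

theorem eq_of_avoid_reachable {G : SimpleGraph V} {S : Finset V} {a b : V} (ha : a ∈ S)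
    (h : (G.avoid S).Reachable a b) : a = b := by
  obtain ⟨p⟩ := h
  cases p with
  | nil => rfl
  | cons hadj _ => exact absurd ha hadj.2.1

theorem invDist_avoid_of_mem {G : SimpleGraph V} {S : Finset V} {a : V} (ha : a ∈ S) (b : V) :
    invDist (G.avoid S) a b = 0 := by
  by_cases h : (G.avoid S).Reachable a b
  · rw [eq_of_avoid_reachable ha h, invDist_self]
  · exact invDist_of_not_reachable h

/-- Replaces the induced subgraph by a graph on the full vertex set, so that different deletion sets
can be compared without changing the type. -/
theorem invDist_induce {G : SimpleGraph V} {S : Finset V} (a b : {v : V | v ∉ S}) :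
    invDist (G.induce {v : V | v ∉ S}) a b = invDist (G.avoid S) a b := by
  refine le_antisymm (invDist_le_of_walks (fun h h' => h (Subtype.ext h')) fun p => ?_)
    (invDist_le_of_walks (fun h h' => h (congrArg _ h')) fun p => ?_)
  · induction p with
    | nil => exact ⟨.nil, le_rfl⟩
    | @cons x y z hadj p ih =>
      obtain ⟨q, hq⟩ := ih
      have : (G.avoid S).Adj x y := ⟨hadj, x.2, y.2⟩
      exact ⟨.cons this q, by simpa using hq⟩
  · obtain ⟨a, ha⟩ := a
    obtain ⟨b, hb⟩ := b
    change (G.avoid S).Walk a b at p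
    change ∃ q : (G.induce {v : V | v ∉ S}).Walk ⟨a, ha⟩ ⟨b, hb⟩, q.length ≤ p.length
    induction p with
    | nil => exact ⟨.nil, le_rfl⟩
    | @cons x y z hadj p ih =>
      obtain ⟨q, hq⟩ := ih hadj.2.2 hb
      have : (G.induce {v : V | v ∉ S}).Adj ⟨x, ha⟩ ⟨y, hadj.2.2⟩ := hadj.1
      exact ⟨.cons this q, by simpa using hq⟩

end SimpleGraph

open SimpleGraph

/-! ### Sums over ordered pairs -/

section Total

variable {V : Type*} [Fintype V]

/-- The sum of the inverse distances over all ordered pairs. -/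
noncomputable def totalInvDist (G : SimpleGraph V) : ℝ := ∑ a, ∑ b, invDist G a b

theorem IGL_eq (G : SimpleGraph V) : IGL G = totalInvDist G / 2 := by
  classical
  unfold IGL totalInvDist
  congr 1
  rw [← Finset.sum_product', ← Finset.diag_union_offDiag,
    Finset.sum_union (Finset.disjoint_diag_offDiag _)]
  simp [invDist_self]

/-- Deleted vertices are isolated in `G.avoid S`, so their rows and columns vanish. -/
theorem IGL_induce [DecidableEq V] (G : SimpleGraph V) (S : Finset V) :
    IGL (G.induce {v : V | v ∉ S}) = totalInvDist (G.avoid S) / 2 := by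
  have h0 : ∀ a, a ∉ Sᶜ → ∀ b, invDist (G.avoid S) a b = 0 := fun a ha b =>
    invDist_avoid_of_mem (by simpa using ha) b
  have hs : ∀ f : V → ℝ, ∑ a : {v : V | v ∉ S}, f a = ∑ a ∈ Sᶜ, f a := fun f => by
    rw [← Finset.sum_subtype (Sᶜ) (p := fun v => v ∈ {v : V | v ∉ S}) (by simp) f]
  rw [IGL_eq]
  unfold totalInvDist
  simp_rw [invDist_induce]
  rw [hs fun a => ∑ b : {v : V | v ∉ S}, invDist (G.avoid S) a b]
  simp_rw [hs]
  rw [← Finset.sum_subset (Finset.subset_univ Sᶜ) fun a _ ha =>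
    Finset.sum_eq_zero fun b _ => h0 a ha b]
  congr 1
  refine Finset.sum_congr rfl fun a _ => Finset.sum_subset (Finset.subset_univ _) fun b _ hb => ?_
  rw [invDist_comm]
  exact h0 b hb a

end Total

/-! ### Joining two components by an edge -/

section Join

variable {V : Type*} {G G' : SimpleGraph V} {p u : V}

/-- `G'` arises from `G` by the edge `p u`, which joins two components. -/
structure IsJoin (G G' : SimpleGraph V) (p u : V) : Prop where
  adj : ∀ a b, G'.Adj a b ↔ G.Adj a b ∨ (a = p ∧ b = u) ∨ (a = u ∧ b = p)
  not_reachable : ¬G.Reachable p u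

theorem IsJoin.le (h : IsJoin G G' p u) : G ≤ G' := fun a b hab => (h.adj a b).2 (.inl hab)

/-- The new edge is a bridge: cutting out detours that cross it and return, every walk can be
shortened to one that crosses it at most once. -/
theorem IsJoin.walk (h : IsJoin G G' p u) {a b : V} (w : G'.Walk a b) :
    (G.Reachable a b ∧ G.dist a b ≤ w.length) ∨
    (G.Reachable a p ∧ G.Reachable u b ∧ G.dist a p + 1 + G.dist u b ≤ w.length) ∨
    (G.Reachable a u ∧ G.Reachable p b ∧ G.dist a u + 1 + G.dist p b ≤ w.length) := by
  induction w with
  | nil => exact .inl ⟨.refl _, by simp⟩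
  | @cons a c b hadj w ih =>
    rcases (h.adj a c).1 hadj with hac | ⟨rfl, rfl⟩ | ⟨rfl, rfl⟩
    · have htri : ∀ x, G.dist a x ≤ 1 + G.dist c x := fun x => by
        have := hac.reachable.dist_triangle_left (w := x)
        rwa [SimpleGraph.dist_eq_one_iff_adj.2 hac] at this
      rcases ih with ⟨h1, h2⟩ | ⟨h1, h2, h3⟩ | ⟨h1, h2, h3⟩
      · refine .inl ⟨hac.reachable.trans h1, ?_⟩
        have := htri b
        simp only [Walk.length_cons]; omega
      · refine .inr (.inl ⟨hac.reachable.trans h1, h2, ?_⟩)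
        have := htri p
        simp only [Walk.length_cons]; omega
      · refine .inr (.inr ⟨hac.reachable.trans h1, h2, ?_⟩)
        have := htri u
        simp only [Walk.length_cons]; omega
    · rcases ih with ⟨h1, h2⟩ | ⟨h1, h2, h3⟩ | ⟨h1, h2, h3⟩
      · exact .inr (.inl ⟨.refl _, h1, by simp; omega⟩)
      · exact absurd h1.symm h.not_reachable
      -- The walk goes from `p` to `u` and comes back to `p`; this detour is dropped.
      · exact .inl ⟨h2, by simp only [Walk.length_cons]; omega⟩
    · rcases ih with ⟨h1, h2⟩ | ⟨h1, h2, h3⟩ | ⟨h1, h2, h3⟩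
      · exact .inr (.inr ⟨.refl _, h1, by simp; omega⟩)
      · exact .inl ⟨h2, by simp only [Walk.length_cons]; omega⟩
      · exact absurd h1 h.not_reachable

theorem IsJoin.reachable_iff (h : IsJoin G G' p u) {a b : V} :
    G'.Reachable a b ↔ G.Reachable a b ∨ (G.Reachable a p ∧ G.Reachable u b) ∨
      (G.Reachable a u ∧ G.Reachable p b) := by
  have hpu : G'.Adj p u := (h.adj p u).2 (by simp)
  constructor
  · rintro ⟨w⟩
    rcases h.walk w with h | h | h
    · exact .inl h.1
    · exact .inr (.inl ⟨h.1, h.2.1⟩)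
    · exact .inr (.inr ⟨h.1, h.2.1⟩)
  · rintro (h1 | ⟨h1, h2⟩ | ⟨h1, h2⟩)
    · exact h1.mono h.le
    · exact (h1.mono h.le).trans (hpu.reachable.trans (h2.mono h.le))
    · exact (h1.mono h.le).trans (hpu.symm.reachable.trans (h2.mono h.le))

theorem IsJoin.dist_of_reachable (h : IsJoin G G' p u) {a b : V} (hab : G.Reachable a b) :
    G'.dist a b = G.dist a b := by
  refine le_antisymm (hab.dist_anti h.le) ?_
  obtain ⟨w, hw⟩ := (hab.mono h.le).exists_walk_length_eq_dist
  rw [← hw]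
  rcases h.walk w with h1 | ⟨h1, h2, -⟩ | ⟨h1, h2, -⟩
  · exact h1.2
  · exact absurd (h1.symm.trans (hab.trans h2.symm)) h.not_reachable
  · exact absurd (h2.trans (hab.symm.trans h1)) h.not_reachable

theorem IsJoin.dist_across (h : IsJoin G G' p u) {a b : V} (ha : G.Reachable a p)
    (hb : G.Reachable u b) : G'.dist a b = G.dist a p + 1 + G.dist u b := by
  have hpu : G'.Adj p u := (h.adj p u).2 (by simp)
  have hr : G'.Reachable a b := h.reachable_iff.2 (.inr (.inl ⟨ha, hb⟩))
  apply le_antisymm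
  · obtain ⟨w₁, hw₁⟩ := ha.exists_walk_length_eq_dist
    obtain ⟨w₂, hw₂⟩ := hb.exists_walk_length_eq_dist
    have := SimpleGraph.dist_le ((w₁.mapLe h.le).append (.cons hpu (w₂.mapLe h.le)))
    simp [Walk.length_append] at this
    omega
  · obtain ⟨w, hw⟩ := hr.exists_walk_length_eq_dist
    rw [← hw]
    rcases h.walk w with h1 | ⟨h1, h2, h3⟩ | ⟨h1, h2, -⟩
    · exact absurd (ha.symm.trans (h1.1.trans hb.symm)) h.not_reachable
    · exact h3
    · exact absurd (ha.symm.trans h1) h.not_reachable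

theorem IsJoin.invDist_of_reachable (h : IsJoin G G' p u) {a b : V} (hab : G.Reachable a b) :
    invDist G' a b = invDist G a b := by
  rw [_root_.invDist_of_reachable hab, _root_.invDist_of_reachable (hab.mono h.le),
    h.dist_of_reachable hab]

theorem IsJoin.avoid {H H' : SimpleGraph V} (h : IsJoin H H' p u) {S : Finset V} (hp : p ∉ S)
    (hu : u ∉ S) : IsJoin (H.avoid S) (H'.avoid S) p u where
  adj a b := by
    simp only [avoid_adj, h.adj]
    constructor
    · tauto
    · rintro (h | ⟨rfl, rfl⟩ | ⟨rfl, rfl⟩) <;> tauto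
  not_reachable hr := h.not_reachable (hr.mono (avoid_le _ _))

theorem IsJoin.avoid_eq {H H' : SimpleGraph V} (h : IsJoin H H' p u) {S : Finset V}
    (hS : p ∈ S ∨ u ∈ S) : H'.avoid S = H.avoid S := by
  ext a b
  simp only [avoid_adj, h.adj]
  constructor
  · rintro ⟨h1 | ⟨rfl, rfl⟩ | ⟨rfl, rfl⟩, h2⟩ <;> tauto
  · tauto

end Join

/-! ### Components of optimal solutions are small -/

/-- A connected graph with a vertex of harmonic centrality at most `m` has at most so many
vertices. -/
def sizeBound (m : ℕ) : ℕ := m * 3 ^ m + 1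

/-- A bound for the component size of optimal solutions, if `n ≤ r * k`. -/
def compBound (r : ℕ) : ℕ := sizeBound ((r + sizeBound (r * r)) * (r + sizeBound (r * r)))

/-- Harmonic numbers exceed logarithms, and `3 > e`; the base 3 keeps the bound a natural number. -/
theorem lt_harmonic_three_pow (m : ℕ) : (m : ℝ) < harmonic (3 ^ m) := by
  refine lt_of_lt_of_le ?_ (log_add_one_le_harmonic _)
  rw [Real.lt_log_iff_exp_lt (by positivity)]
  calc Real.exp m = Real.exp 1 ^ m := by rw [← Real.exp_nat_mul, mul_one]
    _ ≤ 3 ^ m := by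
      gcongr
      exact Real.exp_one_lt_d9.le.trans (by norm_num)
    _ < ((3 ^ m + 1 : ℕ) : ℝ) := by push_cast; linarith

/-! ### Harmonic centrality and the size of a component -/

section

variable {V : Type*} [Fintype V]

/-- A shortest path from `y` to `b` passes through a vertex at each of the distances `1, …, D`. -/
theorem harmonic_le_sum_invDist (G : SimpleGraph V) {y b : V} {D : ℕ} (hr : G.Reachable y b)
    (hD : D ≤ G.dist y b) : (harmonic D : ℝ) ≤ ∑ b, invDist G y b := by
  classical
  obtain ⟨w, hw⟩ := hr.exists_walk_length_eq_dist
  have hdist : ∀ i ≤ D, G.dist y (w.getVert i) = i := by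
    intro i hi
    have := length_eq_dist_of_subwalk hw (w.isSubwalk_take i)
    rw [Walk.take_length] at this
    omega
  have hinj : Set.InjOn w.getVert (Finset.Icc 1 D : Finset ℕ) := by
    intro i hi j hj h
    rw [Finset.mem_coe, Finset.mem_Icc] at hi hj
    rw [← hdist i hi.2, ← hdist j hj.2, h]
  rw [harmonic_eq_sum_Icc]
  push_cast
  calc ∑ i ∈ Finset.Icc 1 D, ((i : ℝ))⁻¹
      = ∑ i ∈ Finset.Icc 1 D, invDist G y (w.getVert i) := by
        refine Finset.sum_congr rfl fun i hi => ?_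
        rw [Finset.mem_Icc] at hi
        rw [invDist_of_reachable ⟨w.take i⟩, hdist i hi.2, one_div]
    _ = ∑ b ∈ (Finset.Icc 1 D).image w.getVert, invDist G y b := (Finset.sum_image hinj).symm
    _ ≤ _ := Finset.sum_le_sum_of_subset_of_nonneg (Finset.subset_univ _)
        fun _ _ _ => invDist_nonneg _ _ _

-- The harmonic bound keeps all distances from `y` below `3 ^ m`, so every other reachable vertex
-- adds at least `1 / 3 ^ m` to a sum of at most `m`. The final `+ 1` in `sizeBound` counts `y`
-- itself.
open Classical in
theorem card_reachable_le_sizeBound (G : SimpleGraph V) {y : V} {m : ℕ}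
    (h : ∑ b, invDist G y b ≤ m) :
    (Finset.univ.filter fun b => G.Reachable y b).card ≤ sizeBound m := by
  have hD : ∀ b, G.Reachable y b → G.dist y b < 3 ^ m := by
    intro b hb
    by_contra! hlt
    exact absurd ((lt_harmonic_three_pow m).trans_le ((harmonic_le_sum_invDist G hb hlt).trans h))
      (lt_irrefl _)
  have key : (((Finset.univ.filter fun b => G.Reachable y b).erase y).card : ℝ) * (1 / 3 ^ m) ≤ m
      := by
    refine le_trans ?_ h
    rw [← nsmul_eq_mul, ← Finset.sum_const]
    refine le_trans (Finset.sum_le_sum fun b hb => ?_) (Finset.sum_le_sum_of_subset_of_nonneg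
      (Finset.subset_univ ((Finset.univ.filter fun b => G.Reachable y b).erase y))
        fun _ _ _ => invDist_nonneg _ _ _)
    simp only [Finset.mem_erase, Finset.mem_filter, Finset.mem_univ, true_and] at hb
    rw [invDist_of_reachable hb.2]
    refine one_div_le_one_div_of_le (by exact_mod_cast hb.2.pos_dist_of_ne hb.1.symm) ?_
    exact_mod_cast (hD b hb.2).le
  rw [mul_one_div, div_le_iff₀ (by positivity)] at key
  have key' : ((Finset.univ.filter fun b => G.Reachable y b).erase y).card ≤ m * 3 ^ m := by
    exact_mod_cast key
  have := Finset.pred_card_le_card_erase (s := Finset.univ.filter fun b => G.Reachable y b)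
    (a := y)
  unfold sizeBound
  omega

/-- Deleting `y` and undeleting inside of `A`. -/
theorem totalInvDist_swap {G G' : SimpleGraph V} {A : Finset V} {y : V} (hyA : y ∉ A)
    (hA : ∀ a ∉ A, ∀ b, G'.Adj a b → G.Adj a b ∧ b ∉ A) (hy : ∀ b, ¬G'.Adj y b) :
    totalInvDist G' + ∑ b, invDist G y b ≤ totalInvDist G + (A.card : ℝ) ^ 2 := by
  classical
  -- Row by row: a row in `A` has at most `|A|` nonzero entries, each at most 1, since no walk of
  -- `G'` leaves `A`; the row of `y` becomes zero; all other rows do not grow. The gain in the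
  -- column of `y` is not needed.
  have hrow : ∀ a, (∑ b, invDist G' a b) + (if a = y then ∑ b, invDist G y b else 0) ≤
      (∑ b, invDist G a b) + if a ∈ A then (A.card : ℝ) else 0 := by
    intro a
    have h0 : 0 ≤ ∑ b, invDist G a b := Finset.sum_nonneg fun _ _ => invDist_nonneg _ _ _
    by_cases haA : a ∈ A
    · have hay : a ≠ y := fun h => hyA (h ▸ haA)
      rw [if_pos haA, if_neg hay, add_zero]
      have : ∑ b, invDist G' a b ≤ ∑ b, if b ∈ A then (1 : ℝ) else 0 := by
        refine Finset.sum_le_sum fun b _ => ?_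
        split_ifs with hb
        · exact invDist_le_one _ _ _
        · rw [invDist_of_not_reachable]
          intro hr
          exact (reachable_of_closed (X := {a | a ∉ A}) (G := G') (G' := G) hA hr.symm hb).1 haA
      simp only [Finset.sum_ite_mem, Finset.univ_inter, Finset.sum_const, nsmul_eq_mul,
        mul_one] at this
      linarith
    · rw [if_neg haA, add_zero]
      by_cases hay : a = y
      · subst hay
        rw [if_pos rfl]
        have : ∑ b, invDist G' a b = 0 := by
          refine Finset.sum_eq_zero fun b _ => ?_
          by_cases hr : G'.Reachable a b
          · obtain ⟨p⟩ := hr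
            cases p with
            | nil => exact invDist_self _ _
            | cons hadj _ => exact absurd hadj (hy _)
          · exact invDist_of_not_reachable hr
        rw [this, zero_add]
      · rw [if_neg hay, add_zero]
        exact Finset.sum_le_sum fun b _ =>
          invDist_le_of_closed (X := {a | a ∉ A}) (G := G') (G' := G) hA haA
  have := Finset.sum_le_sum fun a (_ : a ∈ Finset.univ) => hrow a
  simp only [Finset.sum_add_distrib, Finset.sum_ite_eq', Finset.mem_univ, if_true,
    Finset.sum_ite_mem, Finset.univ_inter, Finset.sum_const, nsmul_eq_mul] at this
  unfold totalInvDist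
  rw [sq]
  exact this

end

/-- Depth is the distance from a chosen root, and the parent is the neighbour nearer to the root.
The root is its own parent, hence the weak inequality. -/
theorem SimpleGraph.IsTree.exists_parent {V : Type*} {T : SimpleGraph V} (hT : T.IsTree) :
    ∃ (par : V → V) (depth : V → ℕ), (∀ a, depth (par a) ≤ depth a) ∧
      ∀ a b, T.Adj a b → (par a = b ∧ depth b < depth a) ∨ (par b = a ∧ depth a < depth b) := by
  classical
  obtain ⟨ρ⟩ := hT.connected.nonempty
  -- Two neighbours nearer to the root would extend to two shortest walks to `a`; these are paths,
  -- hence equal, and so are their penultimate vertices.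
  have huniq : ∀ a b b', T.Adj a b → T.Adj a b' → T.dist ρ a = T.dist ρ b + 1 →
      T.dist ρ a = T.dist ρ b' + 1 → b = b' := by
    intro a b b' h h' hd hd'
    obtain ⟨p, hp⟩ := hT.connected.exists_walk_length_eq_dist ρ b
    obtain ⟨p', hp'⟩ := hT.connected.exists_walk_length_eq_dist ρ b'
    have h1 := (p.concat h.symm).isPath_of_length_eq_dist (by rw [Walk.length_concat, hp, hd])
    have h2 := (p'.concat h'.symm).isPath_of_length_eq_dist (by rw [Walk.length_concat, hp', hd'])
    have := (hT.existsUnique_path ρ a).unique h1 h2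
    simpa using congrArg Walk.penultimate this
  let par : V → V := fun a =>
    if h : ∃ b, T.Adj a b ∧ T.dist ρ a = T.dist ρ b + 1 then h.choose else a
  have hpar : ∀ a b, T.Adj a b → T.dist ρ a = T.dist ρ b + 1 → par a = b := by
    intro a b h hd
    have hex : ∃ b, T.Adj a b ∧ T.dist ρ a = T.dist ρ b + 1 := ⟨b, h, hd⟩
    simp only [par, dif_pos hex]
    exact huniq a _ b hex.choose_spec.1 h hex.choose_spec.2 hd
  refine ⟨par, T.dist ρ, fun a => ?_, fun a b h => ?_⟩
  · by_cases hex : ∃ b, T.Adj a b ∧ T.dist ρ a = T.dist ρ b + 1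
    · simp only [par, dif_pos hex]
      have := hex.choose_spec.2
      omega
    · simp only [par, dif_neg hex]
      exact le_rfl
  · rcases hT.dist_eq_dist_add_one_of_adj ρ h with h' | h'
    · exact .inl ⟨hpar a b h h', by omega⟩
    · exact .inr ⟨hpar b a h.symm h', by omega⟩

/-! ### The exchange argument -/

section

variable {V : Type*} [Fintype V]

open Classical in
/-- The vertices that reach `x` before any other vertex of `S`, when they go along `par`. -/
noncomputable def ownedBy (par : V → V) (S : Finset V) (x : V) : Finset V :=
  Finset.univ.filter fun w => ∃ i, par^[i] w = x ∧ ∀ j < i, par^[j] w ∉ S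

theorem mem_ownedBy {par : V → V} {S : Finset V} {x w : V} :
    w ∈ ownedBy par S x ↔ ∃ i, par^[i] w = x ∧ ∀ j < i, par^[j] w ∉ S := by
  simp [ownedBy]

theorem self_mem_ownedBy (par : V → V) (S : Finset V) (x : V) : x ∈ ownedBy par S x :=
  mem_ownedBy.2 ⟨0, rfl, by simp⟩

/-- The ways of an undeleted vertex and of its parent reach `S` at the same place. Hence ownership
is constant on the components of `T - S`. -/
theorem mem_ownedBy_par {par : V → V} {S : Finset V} {x w : V} (hx : x ∈ S) (hw : w ∉ S) :
    par w ∈ ownedBy par S x ↔ w ∈ ownedBy par S x := by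
  simp only [mem_ownedBy]
  constructor
  · rintro ⟨i, hi, hj⟩
    refine ⟨i + 1, hi, fun j hji => ?_⟩
    cases j with
    | zero => exact hw
    | succ j => exact hj j (by omega)
  · rintro ⟨i, hi, hj⟩
    cases i with
    | zero =>
      obtain rfl : w = x := hi
      exact absurd hx hw
    | succ i => exact ⟨i, hi, fun j hji => hj (j + 1) (by omega)⟩

theorem depth_le_of_mem_ownedBy {par : V → V} {depth : V → ℕ}
    (hd : ∀ a, depth (par a) ≤ depth a) {S : Finset V} {x w : V} (hw : w ∈ ownedBy par S x) :
    depth x ≤ depth w := by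
  obtain ⟨i, rfl, -⟩ := mem_ownedBy.1 hw
  clear hw
  induction i with
  | zero => exact le_rfl
  | succ i ih =>
    rw [Function.iterate_succ_apply']
    exact (hd _).trans ih

/-- The first vertex of `S` on a way is unique, so the owned sets are disjoint. -/
theorem sum_card_ownedBy_le (par : V → V) (S : Finset V) :
    ∑ x ∈ S, (ownedBy par S x).card ≤ Fintype.card V := by
  classical
  rw [← Finset.card_biUnion]
  · exact Finset.card_le_univ _
  · intro x hx x' hx' hne
    refine Finset.disjoint_left.2 fun w hw hw' => hne ?_
    obtain ⟨i, hi, hj⟩ := mem_ownedBy.1 hw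
    obtain ⟨i', hi', hj'⟩ := mem_ownedBy.1 hw'
    rcases lt_trichotomy i i' with h | rfl | h
    · exact absurd (hi ▸ hx) (hj' i h)
    · exact hi.symm.trans hi'
    · exact absurd (hi' ▸ hx') (hj i' h)

open Classical in
/-- If `S` minimizes the inverse geodesic length that remains among the sets of its size, then the
components that remain are small. -/
theorem card_reachable_le_compBound {T : SimpleGraph V} (hT : T.IsTree) {S : Finset V} {r : ℕ}
    (hS : 0 < S.card) (hr : Fintype.card V ≤ r * S.card)
    (hopt : ∀ S' : Finset V, S'.card = S.card →
      totalInvDist (T.avoid S) ≤ totalInvDist (T.avoid S')) (y : V) :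
    (Finset.univ.filter fun b => (T.avoid S).Reachable y b).card ≤ compBound r := by
  obtain ⟨par, depth, hd, hpar⟩ := hT.exists_parent
  -- Otherwise the owned sets together would have at least `(r + 1) * |S|` vertices, more than there
  -- are.
  obtain ⟨x, hx, hxr⟩ : ∃ x ∈ S, (ownedBy par S x).card ≤ r := by
    by_contra! hlt
    have h1 := Finset.sum_le_sum fun x hx => Nat.succ_le_of_lt (hlt x hx)
    have h2 := sum_card_ownedBy_le par S
    simp only [Finset.sum_const, smul_eq_mul, Nat.succ_eq_add_one] at h1
    rw [Nat.mul_comm r] at hr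
    nlinarith
  set A := ownedBy par S x with hAdef
  have hxA : x ∈ A := self_mem_ownedBy par S x
  have hAedge : ∀ a b, (T.avoid S).Adj a b → (a ∈ A ↔ b ∈ A) := by
    rintro a b ⟨hab, ha, hb⟩
    rcases hpar a b hab with ⟨rfl, -⟩ | ⟨rfl, -⟩
    · exact (mem_ownedBy_par hx ha).symm
    · exact mem_ownedBy_par hx hb
  have hcard : ∀ z, z ∉ S → (insert z (S.erase x)).card = S.card := by
    intro z hz
    rw [Finset.card_insert_of_notMem (by simp [hz]), Finset.card_erase_of_mem hx]
    omega
  -- Deleting `z` in place of `x` cannot beat `S`. If the effect of undeleting `x` is confined to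
  -- `B`, the centrality of `z` is therefore at most `|B|²`.
  have hswap : ∀ (B : Finset V) (z : V), z ∉ S → z ∉ B →
      (∀ a ∉ B, ∀ b, (T.avoid (insert z (S.erase x))).Adj a b → (T.avoid S).Adj a b ∧ b ∉ B) →
      (Finset.univ.filter fun b => (T.avoid S).Reachable z b).card ≤
        sizeBound (B.card * B.card) := by
    intro B z hz hzB hB
    have h1 := totalInvDist_swap hzB hB (fun b hb => hb.2.1 (by simp))
    have h2 := hopt _ (hcard z hz)
    refine card_reachable_le_sizeBound _ ?_
    push_cast
    linarith [sq (B.card : ℝ)]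
  have hmono : ∀ {m m' : ℕ}, m ≤ m' → sizeBound m ≤ sizeBound m' := fun h => by
    unfold sizeBound; gcongr; norm_num
  have hmem : ∀ {z a : V}, a ∉ insert z (S.erase x) → a ≠ x → a ∉ S := by
    intro z a ha hax haS
    simp [hax, haS] at ha
  set p := par x with hp
  -- The component that undeleting `x` would attach to `A` from above. The depth condition
  -- guarantees `p ∉ A`, since owned vertices are at least as deep as `x`.
  set C : Finset V := if p ∉ S ∧ depth p < depth x then
    Finset.univ.filter fun b => (T.avoid S).Reachable p b else ∅ with hC
  have hCcard : C.card ≤ sizeBound (r * r) := by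
    rw [hC]
    split_ifs with h
    -- Once `p` is deleted, the undeleted `x` has surviving neighbours only among its children, and
    -- these are owned by `x`.
    · refine (hswap A p h.1 (fun hpA => ?_) fun a ha b hab => ?_).trans (hmono (by gcongr))
      · have := depth_le_of_mem_ownedBy hd hpA
        omega
      · have hax : a ≠ x := fun h => ha (h ▸ hxA)
        have haS := hmem hab.2.1 hax
        have hbx : b ≠ x := by
          rintro rfl
          rcases hpar a b hab.1 with ⟨h', -⟩ | ⟨h', -⟩
          · exact ha ((mem_ownedBy_par hx haS).1 (by rw [h']; exact hxA))
          · exact hab.2.1 (by simp [← h', hp])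
        have hadj : (T.avoid S).Adj a b := ⟨hab.1, haS, hmem hab.2.2 hbx⟩
        exact ⟨hadj, fun hb => ha ((hAedge a b hadj).2 hb)⟩
    · simp
  have hCedge : ∀ a b, (T.avoid S).Adj a b → b ∈ C → a ∈ C := by
    intro a b hab hb
    rw [hC] at hb ⊢
    split_ifs at hb ⊢ with h
    · simp only [Finset.mem_filter, Finset.mem_univ, true_and] at hb ⊢
      exact hb.trans hab.symm.reachable
    · simp at hb
  have hpos : ∀ m, 1 ≤ sizeBound m := fun m => by unfold sizeBound; omega
  have hle : ∀ m, m ≤ sizeBound m := fun m => by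
    unfold sizeBound
    exact (Nat.le_mul_of_pos_right _ (by positivity)).trans (Nat.le_succ _)
  have hsum : r + sizeBound (r * r) ≤ compBound r :=
    (Nat.le_mul_self _).trans (hle _)
  by_cases hyS : y ∈ S
  · have : (Finset.univ.filter fun b => (T.avoid S).Reachable y b) ⊆ {y} := by
      intro b hb
      simp only [Finset.mem_filter, Finset.mem_univ, true_and] at hb
      simp [eq_of_avoid_reachable hyS hb]
    exact (Finset.card_le_card this).trans (hpos _)
  by_cases hyA : y ∈ A
  · have : (Finset.univ.filter fun b => (T.avoid S).Reachable y b) ⊆ A := by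
      intro b hb
      simp only [Finset.mem_filter, Finset.mem_univ, true_and] at hb
      exact (reachable_of_closed (X := {a | a ∈ A}) (G' := T.avoid S)
        (fun a ha b hab => ⟨hab, (hAedge a b hab).1 ha⟩) hb hyA).1
    exact (Finset.card_le_card this).trans (by omega)
  by_cases hyC : y ∈ C
  · have : (Finset.univ.filter fun b => (T.avoid S).Reachable y b) ⊆ C := by
      intro b hb
      simp only [Finset.mem_filter, Finset.mem_univ, true_and] at hb
      exact (reachable_of_closed (X := {a | a ∈ C}) (G' := T.avoid S)
        (fun a ha b hab => ⟨hab, hCedge b a hab.symm ha⟩) hb hyC).1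
    exact (Finset.card_le_card this).trans (by omega)
  -- The remaining `y` lies outside of `A ∪ C`, a set of bounded size to which undeleting `x` is
  -- confined; so `x` can be exchanged for `y`.
  have hAC : (A ∪ C).card ≤ r + sizeBound (r * r) :=
    (Finset.card_union_le _ _).trans (by omega)
  refine (hswap (A ∪ C) y hyS (by simp [hyA, hyC]) fun a ha b hab => ?_).trans
    (hmono (Nat.mul_le_mul hAC hAC))
  rw [Finset.mem_union, not_or] at ha ⊢
  have hax : a ≠ x := fun h => ha.1 (h ▸ hxA)
  have haS := hmem hab.2.1 hax
  have hbx : b ≠ x := by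
    rintro rfl
    rcases hpar a b hab.1 with ⟨h', -⟩ | ⟨h', h''⟩
    · exact ha.1 ((mem_ownedBy_par hx haS).1 (by rw [h']; exact hxA))
    · refine ha.2 ?_
      rw [hC, hp, h', if_pos ⟨haS, h''⟩]
      simp
  have hadj : (T.avoid S).Adj a b := ⟨hab.1, haS, hmem hab.2.2 hbx⟩
  exact ⟨hadj, fun hb => ha.1 ((hAedge a b hadj).2 hb), fun hb => ha.2 (hCedge a b hadj hb)⟩

end

/-! ### Partial solutions -/

theorem SimpleGraph.avoid_mono {V : Type*} {G G' : SimpleGraph V} (h : G ≤ G') (S : Finset V) :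
    G.avoid S ≤ G'.avoid S := fun _ _ hab => ⟨h hab.1, hab.2⟩

theorem IsJoin.symm {V : Type*} {H H' : SimpleGraph V} {p u : V}
    (h : IsJoin H H' p u) : IsJoin H H' u p where
  adj a b := by rw [h.adj]; tauto
  not_reachable h' := h.not_reachable h'.symm

section Partial

variable {V : Type*} [Fintype V]

open Classical in
/-- The component of `v`. -/
noncomputable def comp (H : SimpleGraph V) (v : V) : Finset V :=
  Finset.univ.filter fun b => H.Reachable v b

open Classical in
/-- How many deleted vertices are in the component of `v`. -/
noncomputable def numDeleted (H : SimpleGraph V) (S : Finset V) (v : V) : ℕ :=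
  (S.filter fun b => H.Reachable v b).card

open Classical in
/-- How many vertices have distance `i` from `v` after the deletion of `S`; none if `v` is deleted
itself. -/
noncomputable def profile (H : SimpleGraph V) (S : Finset V) (v : V) (i : ℕ) : ℕ :=
  (Finset.univ.filter fun b =>
    v ∉ S ∧ (H.avoid S).Reachable v b ∧ (H.avoid S).dist v b = i).card

/-- The inverse geodesic length in the component of `v` after the deletion of `S`. -/
noncomputable def compIGL (H : SimpleGraph V) (S : Finset V) (v : V) : ℝ :=
  (∑ a ∈ comp H v, ∑ b ∈ comp H v, invDist (H.avoid S) a b) / 2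

theorem mem_comp {H : SimpleGraph V} {v b : V} : b ∈ comp H v ↔ H.Reachable v b := by simp [comp]

theorem compIGL_nonneg (H : SimpleGraph V) (S : Finset V) (v : V) : 0 ≤ compIGL H S v :=
  div_nonneg (Finset.sum_nonneg fun _ _ => Finset.sum_nonneg fun _ _ => invDist_nonneg _ _ _)
    zero_le_two

/-- The vertices of a shortest path are distinct and lie in the component. So a profile vanishes
from the component size on. -/
theorem dist_lt_card_comp {G : SimpleGraph V} {v b : V} (h : G.Reachable v b) :
    G.dist v b < (comp G v).card := by
  classical
  obtain ⟨p, hp, hl⟩ := h.exists_path_of_dist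
  have hsub : p.support.toFinset ⊆ comp G v := fun x hx => by
    rw [List.mem_toFinset] at hx
    exact mem_comp.2 ⟨p.takeUntil x hx⟩
  have := Finset.card_le_card hsub
  rw [List.toFinset_card_of_nodup hp.support_nodup, Walk.length_support] at this
  omega

theorem profile_of_mem {H : SimpleGraph V} {S : Finset V} {v : V} (h : v ∈ S) (i : ℕ) :
    profile H S v i = 0 := by simp [profile, h]

theorem profile_zero {H : SimpleGraph V} {S : Finset V} {v : V} (h : v ∉ S) :
    profile H S v 0 = 1 := by
  classical
  rw [profile, Finset.card_eq_one]
  refine ⟨v, ?_⟩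
  ext b
  simp only [h, not_false_eq_true, true_and, Finset.mem_filter, Finset.mem_univ,
    Finset.mem_singleton]
  constructor
  · rintro ⟨h1, h2⟩
    exact (h1.dist_eq_zero_iff.1 h2).symm
  · rintro rfl
    exact ⟨.refl _, by simp⟩

theorem profile_le {H T : SimpleGraph V} (hHT : H ≤ T) (S : Finset V) (v : V) (i : ℕ) :
    profile H S v i ≤ (comp (T.avoid S) v).card := by
  classical
  refine Finset.card_le_card fun b hb => ?_
  simp only [Finset.mem_filter, Finset.mem_univ, true_and] at hb
  exact mem_comp.2 (hb.2.1.mono (avoid_mono hHT S))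

theorem profile_eq_zero {H T : SimpleGraph V} (hHT : H ≤ T) {S : Finset V} {v : V} {i : ℕ}
    (hi : (comp (T.avoid S) v).card ≤ i) : profile H S v i = 0 := by
  classical
  rw [profile, Finset.card_eq_zero, Finset.filter_eq_empty_iff]
  rintro b - ⟨-, h1, h2⟩
  have h3 := dist_lt_card_comp h1
  have : (comp (H.avoid S) v).card ≤ (comp (T.avoid S) v).card :=
    Finset.card_le_card fun b hb => mem_comp.2 ((mem_comp.1 hb).mono (avoid_mono hHT S))
  omega

/-- A graph that has the same edges in the component of `v` and there the same deletions. -/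
theorem partial_congr {H H' : SimpleGraph V} {S S' : Finset V} {v : V}
    (hH : ∀ a, H.Reachable v a → ∀ b, H.Adj a b ↔ H'.Adj a b)
    (hS : ∀ a, H.Reachable v a → (a ∈ S ↔ a ∈ S')) :
    comp H' v = comp H v ∧ numDeleted H' S' v = numDeleted H S v ∧
      profile H' S' v = profile H S v ∧ compIGL H' S' v = compIGL H S v := by
  classical
  have hX : ∀ a ∈ {a | H.Reachable v a}, ∀ b, H.Adj a b → H'.Adj a b ∧ b ∈ {a | H.Reachable v a} :=
    fun a ha b hab => ⟨(hH a ha b).1 hab, ha.trans hab.reachable⟩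
  have hX' : ∀ a ∈ {a | H.Reachable v a}, ∀ b, H'.Adj a b → H.Adj a b ∧ b ∈ {a | H.Reachable v a} :=
    fun a ha b hab => ⟨(hH a ha b).2 hab, ha.trans ((hH a ha b).2 hab).reachable⟩
  have hv : v ∈ {a | H.Reachable v a} := Reachable.refl v
  have hR : ∀ b, H'.Reachable v b ↔ H.Reachable v b := fun b =>
    ⟨fun h => (reachable_of_closed hX' h hv).2, fun h => (reachable_of_closed hX h hv).2⟩
  have hY : ∀ a ∈ {a | H.Reachable v a}, ∀ b, (H.avoid S).Adj a b →
      (H'.avoid S').Adj a b ∧ b ∈ {a | H.Reachable v a} := fun a ha b hab => by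
    have hb := ha.trans hab.1.reachable
    exact ⟨⟨(hH a ha b).1 hab.1, (hS a ha).not.1 hab.2.1, (hS b hb).not.1 hab.2.2⟩, hb⟩
  have hY' : ∀ a ∈ {a | H.Reachable v a}, ∀ b, (H'.avoid S').Adj a b →
      (H.avoid S).Adj a b ∧ b ∈ {a | H.Reachable v a} := fun a ha b hab => by
    have hab' := (hH a ha b).2 hab.1
    have hb := ha.trans hab'.reachable
    exact ⟨⟨hab', (hS a ha).not.2 hab.2.1, (hS b hb).not.2 hab.2.2⟩, hb⟩
  have hD : ∀ b, (H.avoid S).Reachable v b → (H'.avoid S').dist v b = (H.avoid S).dist v b := by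
    intro b hb
    apply le_antisymm
    · obtain ⟨p, hp⟩ := hb.exists_walk_length_eq_dist
      obtain ⟨-, q, hq⟩ := exists_walk_of_closed hY p hv
      rw [← hp, ← hq]; exact dist_le q
    · obtain ⟨p, hp⟩ := (reachable_of_closed hY hb hv).2.exists_walk_length_eq_dist
      obtain ⟨-, q, hq⟩ := exists_walk_of_closed hY' p hv
      rw [← hp, ← hq]; exact dist_le q
  have hcomp : comp H' v = comp H v := by ext b; rw [mem_comp, mem_comp, hR]
  refine ⟨hcomp, ?_, ?_, ?_⟩
  · unfold numDeleted
    congr 1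
    ext b
    simp only [Finset.mem_filter, hR]
    constructor
    · rintro ⟨h1, h2⟩; exact ⟨(hS b h2).2 h1, h2⟩
    · rintro ⟨h1, h2⟩; exact ⟨(hS b h2).1 h1, h2⟩
  · ext i
    unfold profile
    congr 1
    ext b
    simp only [Finset.mem_filter, Finset.mem_univ, true_and]
    rw [← hS v hv]
    constructor
    · rintro ⟨h1, h2, h3⟩
      have h2' := (reachable_of_closed hY' h2 hv).2
      exact ⟨h1, h2', by rw [← hD b h2', h3]⟩
    · rintro ⟨h1, h2, h3⟩
      exact ⟨h1, (reachable_of_closed hY h2 hv).2, by rw [hD b h2, h3]⟩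
  · unfold compIGL
    rw [hcomp]
    congr 1
    refine Finset.sum_congr rfl fun a ha => Finset.sum_congr rfl fun b _ => ?_
    exact le_antisymm (invDist_le_of_closed hY' (mem_comp.1 ha))
      (invDist_le_of_closed hY (mem_comp.1 ha))

/-! ### Partial solutions under the joining of two components -/

variable {H H' : SimpleGraph V} {p u : V}

/-- Joining `p` and `u` does not change other components. -/
theorem IsJoin.partial_other (h : IsJoin H H' p u) {v : V} (hp : ¬H.Reachable v p)
    (hu : ¬H.Reachable v u) (S : Finset V) :
    comp H' v = comp H v ∧ numDeleted H' S v = numDeleted H S v ∧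
      profile H' S v = profile H S v ∧ compIGL H' S v = compIGL H S v := by
  refine partial_congr (fun a ha b => ?_) fun _ _ => Iff.rfl
  rw [h.adj]
  constructor
  · exact .inl
  · rintro (h | ⟨rfl, rfl⟩ | ⟨rfl, rfl⟩)
    · exact h
    · exact absurd ha hp
    · exact absurd ha hu

theorem IsJoin.disjoint_comp (h : IsJoin H H' p u) : Disjoint (comp H p) (comp H u) :=
  Finset.disjoint_left.2 fun _ h1 h2 =>
    h.not_reachable ((mem_comp.1 h1).trans (mem_comp.1 h2).symm)

theorem IsJoin.comp_eq [DecidableEq V] (h : IsJoin H H' p u) :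
    comp H' p = comp H p ∪ comp H u := by
  ext b
  rw [Finset.mem_union, mem_comp, mem_comp, mem_comp, h.reachable_iff]
  constructor
  · rintro (h1 | ⟨-, h1⟩ | ⟨h1, -⟩)
    · exact .inl h1
    · exact .inr h1
    · exact absurd h1 h.not_reachable
  · rintro (h1 | h1)
    · exact .inl h1
    · exact .inr (.inl ⟨.refl _, h1⟩)

theorem IsJoin.numDeleted_eq (h : IsJoin H H' p u) (S : Finset V) :
    numDeleted H' S p = numDeleted H S p + numDeleted H S u := by
  classical
  have hR := fun b => congrArg (b ∈ ·) h.comp_eq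
  simp only [Finset.mem_union, mem_comp, eq_iff_iff] at hR
  unfold numDeleted
  rw [← Finset.card_union_of_disjoint]
  · congr 1
    ext b
    simp only [Finset.mem_filter, Finset.mem_union, hR]
    tauto
  · refine Finset.disjoint_left.2 fun b h1 h2 => ?_
    simp only [Finset.mem_filter] at h1 h2
    exact h.not_reachable (h1.2.trans h2.2.symm)

theorem IsJoin.profile_zero (_h : IsJoin H H' p u) (S : Finset V) :
    profile H' S p 0 = profile H S p 0 := by
  by_cases hp : p ∈ S
  · rw [profile_of_mem hp, profile_of_mem hp]
  · rw [_root_.profile_zero hp, _root_.profile_zero hp]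

/-- Vertices on the side of `u` are one step farther from `p` than from `u`. The factor `profile H S
p 0` is 1 or 0 according as `p` survives, and if `u` is deleted its profile is zero, so no case
distinction is needed. -/
theorem IsJoin.profile_succ (h : IsJoin H H' p u) (S : Finset V) (i : ℕ) :
    profile H' S p (i + 1) = profile H S p (i + 1) + profile H S p 0 * profile H S u i := by
  classical
  by_cases hp : p ∈ S
  · simp [profile_of_mem hp]
  by_cases hu : u ∈ S
  · rw [profile_of_mem hu, mul_zero, add_zero]
    unfold profile
    rw [h.avoid_eq (.inr hu)]
  have hj := h.avoid hp hu
  rw [_root_.profile_zero hp, one_mul]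
  unfold profile
  rw [← Finset.card_union_of_disjoint]
  · congr 1
    ext b
    simp only [hp, hu, not_false_eq_true, true_and, Finset.mem_filter, Finset.mem_univ,
      Finset.mem_union]
    constructor
    · rintro ⟨h1, h2⟩
      rcases hj.reachable_iff.1 h1 with h3 | ⟨-, h3⟩ | ⟨h3, -⟩
      · exact .inl ⟨h3, by rw [← hj.dist_of_reachable h3, h2]⟩
      · refine .inr ⟨h3, ?_⟩
        have := hj.dist_across (.refl _) h3
        rw [h2, SimpleGraph.dist_self] at this
        omega
      · exact absurd h3 hj.not_reachable
    · rintro (⟨h1, h2⟩ | ⟨h1, h2⟩)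
      · exact ⟨h1.mono hj.le, by rw [hj.dist_of_reachable h1, h2]⟩
      · refine ⟨hj.reachable_iff.2 (.inr (.inl ⟨.refl _, h1⟩)), ?_⟩
        rw [hj.dist_across (.refl _) h1, SimpleGraph.dist_self, h2]
        omega
  · refine Finset.disjoint_left.2 fun b h1 h2 => ?_
    simp only [Finset.mem_filter] at h1 h2
    exact hj.not_reachable (h1.2.2.1.trans h2.2.2.1.symm)

theorem IsJoin.invDist_avoid (h : IsJoin H H' p u) (S : Finset V) {a b : V}
    (ha : H.Reachable p a) (hb : H.Reachable p b) :
    invDist (H'.avoid S) a b = invDist (H.avoid S) a b := by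
  by_cases hS : p ∈ S ∨ u ∈ S
  · rw [h.avoid_eq hS]
  rw [not_or] at hS
  have hj := h.avoid hS.1 hS.2
  by_cases hr : (H.avoid S).Reachable a b
  · exact hj.invDist_of_reachable hr
  · rw [invDist_of_not_reachable hr, invDist_of_not_reachable]
    intro hr'
    rcases hj.reachable_iff.1 hr' with h1 | ⟨-, h1⟩ | ⟨h1, -⟩
    · exact hr h1
    · exact h.not_reachable (hb.trans (h1.mono (avoid_le _ _)).symm)
    · exact h.not_reachable (ha.trans (h1.mono (avoid_le _ _)))

theorem sum_comp_eq_sum_range {α : Type*} (A : Finset α) (d : α → ℕ) {g : ℕ}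
    (hg : ∀ a ∈ A, d a < g) (f : ℕ → ℝ) :
    ∑ a ∈ A, f (d a) = ∑ i ∈ Finset.range g, ((A.filter fun a => d a = i).card : ℝ) * f i := by
  rw [← Finset.sum_fiberwise_of_maps_to (g := d) (t := Finset.range g)
    (fun a ha => Finset.mem_range.2 (hg a ha))]
  refine Finset.sum_congr rfl fun i _ => ?_
  rw [Finset.sum_congr rfl (g := fun _ => f i)
    (fun a ha => by rw [(Finset.mem_filter.1 ha).2]), Finset.sum_const, nsmul_eq_mul]

/-- The inverse distances between two components with the profiles `P` and `Q` that are joined by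
an edge. -/
noncomputable def crossCost (g : ℕ) (P Q : ℕ → ℕ) : ℝ :=
  ∑ i ∈ Finset.range g, ∑ j ∈ Finset.range g, (P i : ℝ) * (Q j : ℝ) / ((i + j : ℕ) + 1)

theorem crossCost_nonneg (g : ℕ) (P Q : ℕ → ℕ) : 0 ≤ crossCost g P Q :=
  Finset.sum_nonneg fun _ _ => Finset.sum_nonneg fun _ _ => by positivity

/-- A surviving connection runs through the edge `p u`, so its length is the sum of the distances to
`p` and to `u`, plus 1. Grouping by these two distances gives the double sum; if `p` or `u` is
deleted, both sides vanish. -/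
theorem IsJoin.sum_cross (h : IsJoin H H' p u) (S : Finset V) {g : ℕ}
    (hP : ∀ i, g ≤ i → profile H S p i = 0) (hQ : ∀ i, g ≤ i → profile H S u i = 0) :
    ∑ a ∈ comp H p, ∑ b ∈ comp H u, invDist (H'.avoid S) a b =
      crossCost g (profile H S p) (profile H S u) := by
  classical
  by_cases hS : p ∈ S ∨ u ∈ S
  · rw [h.avoid_eq hS]
    have h1 : crossCost g (profile H S p) (profile H S u) = 0 := by
      refine Finset.sum_eq_zero fun i _ => Finset.sum_eq_zero fun j _ => ?_
      rcases hS with hS | hS <;> simp [profile_of_mem hS]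
    rw [h1]
    refine Finset.sum_eq_zero fun a ha => Finset.sum_eq_zero fun b hb =>
      invDist_of_not_reachable fun hr => h.not_reachable ?_
    exact (mem_comp.1 ha).trans ((hr.mono (avoid_le _ _)).trans (mem_comp.1 hb).symm)
  rw [not_or] at hS
  obtain ⟨hp, hu⟩ := hS
  have hj := h.avoid hp hu
  have hsub : ∀ v, comp (H.avoid S) v ⊆ comp H v := fun v b hb =>
    mem_comp.2 ((mem_comp.1 hb).mono (avoid_le _ _))
  have hlt : ∀ v, v ∉ S → (∀ i, g ≤ i → profile H S v i = 0) → ∀ a ∈ comp (H.avoid S) v,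
      (H.avoid S).dist v a < g := by
    intro v hv hz a ha
    by_contra! hlt
    have := hz _ hlt
    rw [profile, Finset.card_eq_zero, Finset.filter_eq_empty_iff] at this
    exact this (Finset.mem_univ a) ⟨hv, mem_comp.1 ha, rfl⟩
  have hprof : ∀ v, v ∉ S → ∀ i, profile H S v i =
      ((comp (H.avoid S) v).filter fun a => (H.avoid S).dist v a = i).card := by
    intro v hv i
    unfold profile comp
    rw [Finset.filter_filter]
    simp [hv]
  have hz : ∀ a ∈ comp H p, ∀ b ∈ comp H u, a ∉ comp (H.avoid S) p ∨ b ∉ comp (H.avoid S) u →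
      invDist (H'.avoid S) a b = 0 := by
    intro a ha b hb hab
    refine invDist_of_not_reachable fun hr => ?_
    rw [mem_comp, mem_comp] at hab
    rcases hj.reachable_iff.1 hr with h1 | ⟨h1, h2⟩ | ⟨h1, -⟩
    · exact h.not_reachable ((mem_comp.1 ha).trans
        ((h1.mono (avoid_le _ _)).trans (mem_comp.1 hb).symm))
    · exact hab.elim (fun h => h h1.symm) fun h => h h2
    · exact h.not_reachable ((mem_comp.1 ha).trans (h1.mono (avoid_le _ _)))
  calc ∑ a ∈ comp H p, ∑ b ∈ comp H u, invDist (H'.avoid S) a b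
      = ∑ a ∈ comp (H.avoid S) p, ∑ b ∈ comp (H.avoid S) u, invDist (H'.avoid S) a b := by
        rw [← Finset.sum_subset (hsub p) fun a ha ha' => Finset.sum_eq_zero fun b hb =>
          hz a ha b hb (.inl ha')]
        refine Finset.sum_congr rfl fun a ha => (Finset.sum_subset (hsub u) fun b hb hb' =>
          hz a (hsub p ha) b hb (.inr hb')).symm
    _ = ∑ a ∈ comp (H.avoid S) p, ∑ b ∈ comp (H.avoid S) u,
          1 / ((((H.avoid S).dist p a + (H.avoid S).dist u b : ℕ) : ℝ) + 1) := by
        refine Finset.sum_congr rfl fun a ha => Finset.sum_congr rfl fun b hb => ?_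
        rw [mem_comp] at ha hb
        rw [_root_.invDist_of_reachable (hj.reachable_iff.2 (.inr (.inl ⟨ha.symm, hb⟩))),
          hj.dist_across ha.symm hb, SimpleGraph.dist_comm (u := a)]
        push_cast
        congr 1
        ring
    _ = _ := by
        rw [sum_comp_eq_sum_range _ _ (hlt p hp hP) fun i => ∑ b ∈ comp (H.avoid S) u,
          1 / (((i + (H.avoid S).dist u b : ℕ) : ℝ) + 1)]
        refine Finset.sum_congr rfl fun i _ => ?_
        rw [sum_comp_eq_sum_range _ _ (hlt u hu hQ) fun j => 1 / (((i + j : ℕ) : ℝ) + 1),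
          Finset.mul_sum]
        refine Finset.sum_congr rfl fun j _ => ?_
        rw [hprof p hp, hprof u hu]
        ring

/-- The ordered pairs split into two diagonal blocks, which the join leaves unchanged, and two equal
cross blocks, which the factor `1 / 2` counts once. -/
theorem IsJoin.compIGL_eq (h : IsJoin H H' p u) (S : Finset V) {g : ℕ}
    (hP : ∀ i, g ≤ i → profile H S p i = 0) (hQ : ∀ i, g ≤ i → profile H S u i = 0) :
    compIGL H' S p = compIGL H S p + compIGL H S u +
      crossCost g (profile H S p) (profile H S u) := by
  classical
  have hsymm : ∑ a ∈ comp H u, ∑ b ∈ comp H p, invDist (H'.avoid S) a b =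
      ∑ a ∈ comp H p, ∑ b ∈ comp H u, invDist (H'.avoid S) a b := by
    rw [Finset.sum_comm]
    exact Finset.sum_congr rfl fun a _ => Finset.sum_congr rfl fun b _ => invDist_comm _ _ _
  have hp : ∑ a ∈ comp H p, ∑ b ∈ comp H p, invDist (H'.avoid S) a b =
      ∑ a ∈ comp H p, ∑ b ∈ comp H p, invDist (H.avoid S) a b :=
    Finset.sum_congr rfl fun a ha => Finset.sum_congr rfl fun b hb =>
      h.invDist_avoid S (mem_comp.1 ha) (mem_comp.1 hb)
  have hu : ∑ a ∈ comp H u, ∑ b ∈ comp H u, invDist (H'.avoid S) a b =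
      ∑ a ∈ comp H u, ∑ b ∈ comp H u, invDist (H.avoid S) a b :=
    Finset.sum_congr rfl fun a ha => Finset.sum_congr rfl fun b hb =>
      h.symm.invDist_avoid S (mem_comp.1 ha) (mem_comp.1 hb)
  unfold compIGL
  rw [h.comp_eq, Finset.sum_union h.disjoint_comp]
  simp_rw [Finset.sum_union h.disjoint_comp, Finset.sum_add_distrib]
  rw [hsymm, hp, hu, h.sum_cross S hP hQ]
  ring

end Partial

/-! ### Removing leaves from a tree -/

section Leaves

variable {V : Type*}

/-- The edges of `T` that are not inside of `R`. -/
def SimpleGraph.outside (T : SimpleGraph V) (R : Finset V) : SimpleGraph V where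
  Adj a b := T.Adj a b ∧ ¬(a ∈ R ∧ b ∈ R)
  symm := ⟨fun _ _ h => ⟨h.1.symm, fun h' => h.2 h'.symm⟩⟩
  loopless := ⟨fun _ h => h.1.ne rfl⟩

theorem SimpleGraph.outside_le (T : SimpleGraph V) (R : Finset V) : T.outside R ≤ T :=
  fun _ _ h => h.1

/-- No two vertices of `R` are connected outside of `R`. -/
def Separated (T : SimpleGraph V) (R : Finset V) : Prop :=
  ∀ a ∈ R, ∀ b ∈ R, a ≠ b → ¬(T.outside R).Reachable a b

/-- `u` is a leaf of the tree that `T` induces on `R`, and `p` is its neighbour. -/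
structure IsLeaf (T : SimpleGraph V) (R : Finset V) (u p : V) : Prop where
  mem : u ∈ R
  mem' : p ∈ R
  adj : T.Adj u p
  unique : ∀ w ∈ R, T.Adj u w → w = p

/-- The edges released by removing `u` from `R` are those from `u` to `R`, and there is only one.
Separatedness says that it joins two components. -/
theorem IsLeaf.isJoin [DecidableEq V] {T : SimpleGraph V} {R : Finset V} {u p : V}
    (h : IsLeaf T R u p)
    (hs : Separated T R) : IsJoin (T.outside R) (T.outside (R.erase u)) p u where
  adj a b := by
    simp only [SimpleGraph.outside, Finset.mem_erase]
    constructor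
    · rintro ⟨h1, h2⟩
      by_cases hab : a ∈ R ∧ b ∈ R
      · by_cases ha : a = u
        · subst ha
          exact .inr (.inr ⟨rfl, h.unique b hab.2 h1⟩)
        · by_cases hb : b = u
          · subst hb
            exact .inr (.inl ⟨h.unique a hab.1 h1.symm, rfl⟩)
          · exact absurd ⟨⟨ha, hab.1⟩, hb, hab.2⟩ h2
      · exact .inl ⟨h1, hab⟩
    · rintro (⟨h1, h2⟩ | ⟨rfl, rfl⟩ | ⟨rfl, rfl⟩)
      · exact ⟨h1, fun h' => h2 ⟨h'.1.2, h'.2.2⟩⟩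
      · exact ⟨h.adj.symm, by simp⟩
      · exact ⟨h.adj, by simp⟩
  not_reachable := hs p h.mem' u h.mem h.adj.ne.symm

theorem IsLeaf.separated [DecidableEq V] {T : SimpleGraph V} {R : Finset V} {u p : V}
    (h : IsLeaf T R u p)
    (hs : Separated T R) : Separated T (R.erase u) := by
  intro a ha b hb hab hr
  rw [Finset.mem_erase] at ha hb
  rcases (h.isJoin hs).reachable_iff.1 hr with h1 | ⟨-, h1⟩ | ⟨h1, -⟩
  · exact hs a ha.2 b hb.2 hab h1
  · exact hs u h.mem b hb.2 hb.1.symm h1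
  · exact hs a ha.2 u h.mem ha.1 h1

theorem separated_univ [Fintype V] (T : SimpleGraph V) : Separated T Finset.univ := by
  rintro a - b - hab ⟨w⟩
  cases w with
  | nil => exact hab rfl
  | cons h _ => exact absurd ⟨Finset.mem_univ _, Finset.mem_univ _⟩ h.2

/-- The induced subgraph is connected. -/
def ConnectedOn (T : SimpleGraph V) (R : Finset V) : Prop := (T.induce (R : Set V)).Connected

theorem exists_isLeaf {T : SimpleGraph V} (hT : T.IsTree) {R : Finset V} (hc : ConnectedOn T R)
    (hR : 1 < R.card) : ∃ u p, IsLeaf T R u p := by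
  classical
  have htree : (T.induce (R : Set V)).IsTree := ⟨hc, hT.isAcyclic.induce _⟩
  have : Nontrivial (R : Set V) := by
    obtain ⟨a, ha, b, hb, hab⟩ := Finset.one_lt_card.1 hR
    exact ⟨⟨a, ha⟩, ⟨b, hb⟩, fun h => hab (congrArg Subtype.val h)⟩
  obtain ⟨u, hu⟩ := htree.exists_vert_degree_one_of_nontrivial
  obtain ⟨p, hp, huniq⟩ := degree_eq_one_iff_existsUnique_adj.1 hu
  exact ⟨u, p, u.2, p.2, hp, fun w hw h => congrArg Subtype.val (huniq ⟨w, hw⟩ h)⟩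

theorem IsLeaf.connectedOn [DecidableEq V] {T : SimpleGraph V} {R : Finset V} {u p : V}
    (h : IsLeaf T R u p)
    (hc : ConnectedOn T R) : ConnectedOn T (R.erase u) := by
  classical
  have hdeg : (T.induce (R : Set V)).degree ⟨u, h.mem⟩ = 1 :=
    degree_eq_one_iff_existsUnique_adj.2 ⟨⟨p, h.mem'⟩, h.adj, fun w hw =>
      Subtype.ext (h.unique w w.2 hw)⟩
  have hcon := Connected.induce_compl_singleton_of_degree_eq_one hc hdeg
  let f : (T.induce (R : Set V)).induce {⟨u, h.mem⟩}ᶜ →g T.induce (R.erase u : Set V) :=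
    { toFun := fun x => ⟨x.1.1, by
        have h1 := x.2
        have h2 := x.1.2
        simp only [Set.mem_compl_iff, Set.mem_singleton_iff, Subtype.ext_iff] at h1
        rw [Finset.coe_erase]
        exact ⟨h2, h1⟩⟩
      map_rel' := fun h => h }
  have := hcon.map f fun y => by
    have hy := y.2
    simp only [Finset.coe_erase, Set.mem_sdiff, Finset.mem_coe, Set.mem_singleton_iff] at hy
    exact ⟨⟨⟨y.1, hy.1⟩, by simpa [Subtype.ext_iff] using hy.2⟩, rfl⟩
  unfold ConnectedOn
  rwa [Finset.coe_erase] at *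

theorem connectedOn_univ [Fintype V] {T : SimpleGraph V} (hT : T.IsTree) :
    ConnectedOn T Finset.univ := by
  unfold ConnectedOn
  rw [Finset.coe_univ]
  exact (SimpleGraph.induceUnivIso T).connected_iff.2 hT.connected

end Leaves

/-! ### Digits -/

/-- The digit `i` of `e` to the base `g + 1`; only the first `g` digits count. -/
def digit (g e i : ℕ) : ℕ := if i < g then e / (g + 1) ^ i % (g + 1) else 0

theorem digit_of_le {g e i : ℕ} (h : g ≤ i) : digit g e i = 0 := if_neg (by omega)

theorem digit_zero_right {g h l : ℕ} (hg : 0 < g) (hl : l < g + 1) :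
    digit g (h * (g + 1) + l) 0 = l := by
  rw [digit, if_pos hg, pow_zero, Nat.div_one, Nat.mul_comm, Nat.mul_add_mod, Nat.mod_eq_of_lt hl]

/-- Appending a last digit shifts the others; the machine relies on this to obtain digits without
division with remainder. -/
theorem digit_succ {g h l i : ℕ} (hi : i + 1 < g) (hl : l < g + 1) :
    digit g (h * (g + 1) + l) (i + 1) = digit g h i := by
  rw [digit, if_pos hi, digit, if_pos (by omega), pow_succ', ← Nat.div_div_eq_div_mul,
    Nat.mul_comm h, Nat.mul_add_div (by omega), Nat.div_eq_of_lt hl, add_zero]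

theorem digit_zero_left (g i : ℕ) : digit g 0 i = 0 := by simp [digit]

theorem digit_one {g : ℕ} (hg : 0 < g) : digit g 1 = fun i => if i = 0 then 1 else 0 := by
  ext i
  cases i with
  | zero => simpa using digit_zero_right (h := 0) (l := 1) hg (by omega)
  | succ i =>
    by_cases hi : i + 1 < g
    · simpa [digit_zero_left] using digit_succ (h := 0) (l := 1) hi (by omega)
    · simp [digit, hi]

theorem exists_digit_eq {g : ℕ} {P : ℕ → ℕ} (h1 : ∀ i, P i ≤ g) (h2 : ∀ i, g ≤ i → P i = 0) :
    ∃ e < (g + 1) ^ g, digit g e = P := by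
  have key : ∀ (m : ℕ) (Q : ℕ → ℕ), (∀ i, Q i ≤ g) → ∃ e < (g + 1) ^ m, ∀ i < m,
      e / (g + 1) ^ i % (g + 1) = Q i := by
    intro m
    induction m with
    | zero => exact fun Q _ => ⟨0, by simp, by simp⟩
    | succ m ih =>
      intro Q hQ
      obtain ⟨e, he, hd⟩ := ih (fun i => Q (i + 1)) fun i => hQ _
      have h0 := hQ 0
      refine ⟨(g + 1) * e + Q 0, ?_, fun i hi => ?_⟩
      · rw [pow_succ']
        calc (g + 1) * e + Q 0 < (g + 1) * (e + 1) := by rw [Nat.mul_add]; omega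
          _ ≤ _ := Nat.mul_le_mul_left _ he
      · cases i with
        | zero =>
          rw [pow_zero, Nat.div_one, Nat.mul_add_mod, Nat.mod_eq_of_lt (by omega)]
        | succ i =>
          rw [pow_succ', ← Nat.div_div_eq_div_mul, Nat.mul_add_div (by omega),
            Nat.div_eq_of_lt (by omega : Q 0 < g + 1), add_zero, hd i (by omega)]
  obtain ⟨e, he, hd⟩ := key g P h1
  refine ⟨e, he, funext fun i => ?_⟩
  by_cases hi : i < g
  · rw [digit, if_pos hi, hd i hi]
  · rw [digit, if_neg hi, h2 i (by omega)]

/-! ### Tables of partial solutions -/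

section Tables

variable {V : Type*} [Fintype V]

theorem profile_eq_zero_of_forall {H : SimpleGraph V} {S : Finset V} {v : V} {i : ℕ}
    (h : ∀ b, (H.avoid S).Reachable v b → (H.avoid S).dist v b ≠ i) : profile H S v i = 0 := by
  classical
  rw [profile, Finset.card_eq_zero, Finset.filter_eq_empty_iff]
  rintro b - ⟨-, h1, h2⟩
  exact h b h1 h2

/-- Every entry `tb v d e` below `INF` comes from a partial solution with `d` deletions and the
profile `e`. -/
def TableSound (T : SimpleGraph V) (g K : ℕ) (INF : ℝ) (R : Finset V) (tb : V → ℕ → ℕ → ℝ) :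
    Prop :=
  ∀ v ∈ R, ∀ d < K, ∀ e < (g + 1) ^ g, INF ≤ tb v d e ∨ ∃ S : Finset V,
    numDeleted (T.outside R) S v = d ∧ profile (T.outside R) S v = digit g e ∧
      compIGL (T.outside R) S v ≤ tb v d e

/-- The entries are lower bounds for the partial solutions with small components. -/
def TableComplete (T : SimpleGraph V) (g K : ℕ) (R : Finset V) (tb : V → ℕ → ℕ → ℝ) :
    Prop :=
  ∀ v ∈ R, ∀ S : Finset V, (∀ w, (comp (T.avoid S) w).card ≤ g) →
    numDeleted (T.outside R) S v < K → ∃ e < (g + 1) ^ g,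
      profile (T.outside R) S v = digit g e ∧
      tb v (numDeleted (T.outside R) S v) e ≤ compIGL (T.outside R) S v

/-- The profile `h` arises when a component with the profile `f` is attached to the root of a
component with the profile `e`. -/
def Matches (g e f h : ℕ) : Prop :=
  digit g h 0 = digit g e 0 ∧
    ∀ i < g, digit g h (i + 1) = digit g e (i + 1) + digit g e 0 * digit g f i

/-- Digits from position `g` on are zero, so the condition for `i = g - 1` excludes an overflow, and
beyond it the equation reads `0 = 0`. -/
theorem Matches.all {g e f h : ℕ} (hm : Matches g e f h) (i : ℕ) :
    digit g h (i + 1) = digit g e (i + 1) + digit g e 0 * digit g f i := by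
  by_cases hi : i < g
  · exact hm.2 i hi
  · rw [digit_of_le (i := i + 1) (by omega), digit_of_le (i := i + 1) (by omega),
      digit_of_le (e := f) (i := i) (by omega), mul_zero, add_zero]

/-- `tb'` arises from `tb` by attaching the component of `u` to that of `p`. -/
structure IsMerge (g K : ℕ) (INF : ℝ) (p u : V) (tb tb' : V → ℕ → ℕ → ℝ) : Prop where
  other : ∀ v, v ≠ p → tb' v = tb v
  sound : ∀ d < K, ∀ h < (g + 1) ^ g, INF ≤ tb' p d h ∨ ∃ d₁ < K, ∃ d₂ < K, ∃ e < (g + 1) ^ g,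
    ∃ f < (g + 1) ^ g, d₁ + d₂ = d ∧ Matches g e f h ∧
      tb p d₁ e + tb u d₂ f + crossCost g (digit g e) (digit g f) ≤ tb' p d h
  complete : ∀ d₁ d₂, d₁ + d₂ < K → ∀ e < (g + 1) ^ g, ∀ f < (g + 1) ^ g, ∀ h < (g + 1) ^ g,
    Matches g e f h →
      tb' p (d₁ + d₂) h ≤ tb p d₁ e + tb u d₂ f + crossCost g (digit g e) (digit g f)

/-- Nonnegativity ensures that a sum with a summand of at least `INF` is at least `INF`, so a finite
number can play the part of infinity. -/
theorem TableSound.nonneg {T : SimpleGraph V} {g K : ℕ} {INF : ℝ} {R : Finset V}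
    {tb : V → ℕ → ℕ → ℝ} (h : TableSound T g K INF R tb) (h0 : 0 ≤ INF) {v : V} (hv : v ∈ R)
    {d e : ℕ} (hd : d < K) (he : e < (g + 1) ^ g) : 0 ≤ tb v d e := by
  rcases h v hv d hd e he with h | ⟨S, -, -, h⟩
  · exact h0.trans h
  · exact (compIGL_nonneg _ _ _).trans h

variable [DecidableEq V]

theorem TableSound.merge {T : SimpleGraph V} {g K : ℕ} {INF : ℝ} {R : Finset V}
    {tb tb' : V → ℕ → ℕ → ℝ} {p u : V} (h : TableSound T g K INF R tb) (h0 : 0 ≤ INF)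
    (hs : Separated T R) (hl : IsLeaf T R u p) (hm : IsMerge g K INF p u tb tb') :
    TableSound T g K INF (R.erase u) tb' := by
  classical
  have hj := hl.isJoin hs
  intro v hv d hd x hx
  rw [Finset.mem_erase] at hv
  by_cases hvp : v = p
  · subst hvp
    rcases hm.sound d hd x hx with h1 | ⟨d₁, hd₁, d₂, hd₂, e, he, f, hf, rfl, hmatch, hle⟩
    · exact .inl h1
    have hc := crossCost_nonneg g (digit g e) (digit g f)
    have n1 := h.nonneg h0 hv.2 hd₁ he
    have n2 := h.nonneg h0 hl.mem hd₂ hf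
    rcases h v hv.2 d₁ hd₁ e he with h1 | ⟨S₁, c₁, p₁, b₁⟩
    · exact .inl (by linarith)
    rcases h u hl.mem d₂ hd₂ f hf with h1 | ⟨S₂, c₂, p₂, b₂⟩
    · exact .inl (by linarith)
    right
    -- A partial solution matters only within its own component, and the two components are
    -- disjoint; so the two solutions can be cut down and united.
    let S : Finset V := S₁.filter (fun b => (T.outside R).Reachable v b) ∪
      S₂.filter (fun b => (T.outside R).Reachable u b)
    have hS₁ : ∀ a, (T.outside R).Reachable v a → (a ∈ S₁ ↔ a ∈ S) := by
      intro a ha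
      simp only [S, Finset.mem_union, Finset.mem_filter, ha, and_true]
      refine ⟨.inl, ?_⟩
      rintro (h1 | ⟨-, h1⟩)
      · exact h1
      · exact absurd (ha.trans h1.symm) hj.not_reachable
    have hS₂ : ∀ a, (T.outside R).Reachable u a → (a ∈ S₂ ↔ a ∈ S) := by
      intro a ha
      simp only [S, Finset.mem_union, Finset.mem_filter, ha, and_true]
      refine ⟨.inr, ?_⟩
      rintro (⟨-, h1⟩ | h1)
      · exact absurd (h1.trans ha.symm) hj.not_reachable
      · exact h1
    obtain ⟨-, e1, e2, e3⟩ := partial_congr (H' := T.outside R) (fun a _ b => Iff.rfl) hS₁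
    obtain ⟨-, f1, f2, f3⟩ := partial_congr (H' := T.outside R) (fun a _ b => Iff.rfl) hS₂
    have hP : ∀ i, g ≤ i → profile (T.outside R) S v i = 0 := fun i hi => by
      rw [e2, p₁, digit_of_le hi]
    have hQ : ∀ i, g ≤ i → profile (T.outside R) S u i = 0 := fun i hi => by
      rw [f2, p₂, digit_of_le hi]
    refine ⟨S, ?_, ?_, ?_⟩
    · rw [hj.numDeleted_eq, e1, f1, c₁, c₂]
    · ext i
      cases i with
      | zero => rw [hj.profile_zero, e2, p₁, hmatch.1]
      | succ i => rw [hj.profile_succ, e2, f2, p₁, p₂, hmatch.all]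
    · rw [hj.compIGL_eq S hP hQ, e2, f2, e3, f3, p₁, p₂]
      linarith
  · rw [hm.other v hvp]
    have h1 := hs v hv.2 p hl.mem' hvp
    have h2 := hs v hv.2 u hl.mem hv.1
    rcases h v hv.2 d hd x hx with h3 | ⟨S, c, pr, b⟩
    · exact .inl h3
    · obtain ⟨-, e1, e2, e3⟩ := hj.partial_other h1 h2 S
      exact .inr ⟨S, by rw [e1, c], by rw [e2, pr], by rw [e3]; exact b⟩

/-- One global `S` serves for both components, and its deletions add up. Smallness is required in `T
- S` itself, so the hypothesis on `S` does not change from merge to merge. -/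
theorem TableComplete.merge {T : SimpleGraph V} {g K : ℕ} {INF : ℝ} {R : Finset V}
    {tb tb' : V → ℕ → ℕ → ℝ} {p u : V} (h : TableComplete T g K R tb)
    (hs : Separated T R) (hl : IsLeaf T R u p) (hm : IsMerge g K INF p u tb tb') :
    TableComplete T g K (R.erase u) tb' := by
  have hj := hl.isJoin hs
  intro v hv S hS hd
  rw [Finset.mem_erase] at hv
  by_cases hvp : v = p
  · subst hvp
    rw [hj.numDeleted_eq] at hd ⊢
    obtain ⟨e, he, pe, le⟩ := h v hv.2 S hS (by omega)
    obtain ⟨f, hf, pf, lf⟩ := h u hl.mem S hS (by omega)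
    -- Small components bound both the entries and the length of the merged profile by `g`, so it
    -- has a code.
    obtain ⟨x, hx, px⟩ := exists_digit_eq (g := g) (P := profile (T.outside (R.erase u)) S v)
      (fun i => (profile_le (T.outside_le _) S v i).trans (hS v))
      (fun i hi => profile_eq_zero (T.outside_le _) ((hS v).trans hi))
    refine ⟨x, hx, px.symm, ?_⟩
    have hmatch : Matches g e f x := by
      refine ⟨?_, fun i _ => ?_⟩
      · rw [px, ← pe, hj.profile_zero]
      · rw [px, ← pe, ← pf, hj.profile_succ]
    have := hm.complete _ _ hd e he f hf x hx hmatch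
    rw [hj.compIGL_eq S (fun i hi => profile_eq_zero (T.outside_le _) ((hS v).trans hi))
      (fun i hi => profile_eq_zero (T.outside_le _) ((hS u).trans hi)), pe, pf]
    linarith
  · rw [hm.other v hvp]
    have h1 := hs v hv.2 p hl.mem' hvp
    have h2 := hs v hv.2 u hl.mem hv.1
    obtain ⟨-, e1, e2, e3⟩ := hj.partial_other h1 h2 S
    rw [e1, e2, e3]
    rw [e1] at hd
    exact h v hv.2 S hS hd

/-- The entries of the table for single vertices. -/
noncomputable def initialEntry (INF : ℝ) (d e : ℕ) : ℝ :=
  if (d = 0 ∧ e = 1) ∨ (d = 1 ∧ e = 0) then 0 else INF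

theorem reachable_outside_univ {T : SimpleGraph V} {a b : V} :
    (T.outside Finset.univ).Reachable a b ↔ a = b := by
  constructor
  · intro h
    by_contra hne
    exact separated_univ T a (Finset.mem_univ _) b (Finset.mem_univ _) hne h
  · rintro rfl; exact .refl _

theorem numDeleted_univ (T : SimpleGraph V) (S : Finset V) (v : V) :
    numDeleted (T.outside Finset.univ) S v = if v ∈ S then 1 else 0 := by
  classical
  unfold numDeleted
  simp only [reachable_outside_univ]
  rw [Finset.filter_eq]
  split_ifs <;> simp

theorem profile_univ (T : SimpleGraph V) {g : ℕ} (hg : 0 < g) (S : Finset V) (v : V) :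
    profile (T.outside Finset.univ) S v = digit g (if v ∈ S then 0 else 1) := by
  classical
  ext i
  split_ifs with hv
  · rw [profile_of_mem hv, digit_zero_left]
  · rw [digit_one hg]
    cases i with
    | zero => rw [profile_zero hv]; rfl
    | succ i =>
      simp only [Nat.add_eq_zero_iff, one_ne_zero, and_false, if_false]
      refine profile_eq_zero_of_forall fun b h1 h2 => ?_
      obtain rfl := reachable_outside_univ.1 (h1.mono (avoid_le _ _))
      simp at h2

theorem compIGL_univ (T : SimpleGraph V) (S : Finset V) (v : V) :
    compIGL (T.outside Finset.univ) S v = 0 := by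
  have : comp (T.outside Finset.univ) v = {v} := by
    ext b; rw [mem_comp, reachable_outside_univ, Finset.mem_singleton, eq_comm]
  rw [compIGL, this]
  simp [invDist_self]

theorem tableSound_initial (T : SimpleGraph V) {g : ℕ} (hg : 0 < g) (K : ℕ) (INF : ℝ) :
    TableSound T g K INF Finset.univ fun _ => initialEntry INF := by
  intro v _ d _ e _
  simp only [initialEntry]
  split_ifs with h
  · rcases h with ⟨rfl, rfl⟩ | ⟨rfl, rfl⟩
    · refine .inr ⟨∅, ?_, ?_, ?_⟩
      · simp [numDeleted_univ]
      · simp [profile_univ T hg]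
      · rw [compIGL_univ]
    · refine .inr ⟨{v}, ?_, ?_, ?_⟩
      · simp [numDeleted_univ]
      · simp [profile_univ T hg]
      · rw [compIGL_univ]
  · exact .inl le_rfl

theorem tableComplete_initial (T : SimpleGraph V) {g : ℕ} (hg : 0 < g) (K : ℕ) (INF : ℝ) :
    TableComplete T g K Finset.univ fun _ => initialEntry INF := by
  intro v _ S _ _
  have h1 : 1 < (g + 1) ^ g := Nat.one_lt_pow (by omega) (by omega)
  refine ⟨if v ∈ S then 0 else 1, by split_ifs <;> omega, profile_univ T hg S v, ?_⟩
  rw [compIGL_univ, numDeleted_univ]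
  unfold initialEntry
  split_ifs <;> simp_all

/-- The problem can be decided with the last table. -/
theorem minIGL_iff_of_table {T : SimpleGraph V} (hT : T.IsTree) {k r : ℕ} {INF τ : ℝ} {ρ : V}
    {tb : V → ℕ → ℕ → ℝ} (hk : 0 < k) (hr : Fintype.card V ≤ r * k) (hτ : τ < INF)
    (h1 : TableSound T (compBound r) (k + 1) INF {ρ} tb)
    (h2 : TableComplete T (compBound r) (k + 1) {ρ} tb) :
    MinIGL T k τ ↔ ∃ e < (compBound r + 1) ^ compBound r, tb ρ k e ≤ τ := by
  classical
  have hout : T.outside {ρ} = T := by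
    ext a b
    simp only [SimpleGraph.outside, Finset.mem_singleton, and_iff_left_iff_imp]
    rintro h ⟨rfl, rfl⟩
    exact h.ne rfl
  have hnum : ∀ S : Finset V, numDeleted (T.outside {ρ}) S ρ = S.card := by
    intro S
    rw [hout]
    unfold numDeleted
    congr 1
    ext b
    simp [hT.connected.preconnected ρ b]
  have hIGL : ∀ S : Finset V, compIGL (T.outside {ρ}) S ρ =
      IGL (T.induce {v : V | v ∉ S}) := by
    intro S
    have : comp T ρ = Finset.univ :=
      Finset.eq_univ_of_forall fun b => mem_comp.2 (hT.connected ρ b)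
    rw [hout, IGL_induce, compIGL, this, totalInvDist]
  constructor
  · rintro ⟨S₀, hS₀, hle⟩
    -- The given solution may leave large components, for which the table promises nothing; an
    -- optimal set of the same size does not.
    obtain ⟨S, hS, hmin⟩ := (Finset.powersetCard k (Finset.univ : Finset V)).exists_min_image
      (fun S => totalInvDist (T.avoid S)) ⟨S₀, by simp [Finset.mem_powersetCard, hS₀]⟩
    simp only [Finset.mem_powersetCard, Finset.subset_univ, true_and] at hS hmin
    have hsmall : ∀ w, (comp (T.avoid S) w).card ≤ compBound r := fun w =>
      card_reachable_le_compBound hT (by omega) (by rwa [hS])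
        (fun S' hS' => hmin S' (hS'.trans hS)) w
    obtain ⟨e, he, -, hle'⟩ := h2 ρ (by simp) S hsmall (by rw [hnum]; omega)
    refine ⟨e, he, ?_⟩
    rw [hnum, hS, hIGL] at hle'
    refine hle'.trans (le_trans ?_ hle)
    rw [IGL_induce, IGL_induce]
    linarith [hmin S₀ hS₀]
  · rintro ⟨e, he, hle⟩
    rcases h1 ρ (by simp) k (by omega) e he with h | ⟨S, hS, -, h⟩
    · linarith
    · rw [hnum] at hS
      rw [hIGL] at h
      exact ⟨S, hS, h.trans hle⟩

end Tables

namespace RealRAM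

/-! ### Reading a modified store -/

section StoreLemmas

variable (S : Store) (x v : ℕ) (y : ℝ) (q : ℕ × ℕ × ℕ × ℕ)

@[simp] theorem Store.setN_n (z : ℕ) : (S.setN x v).n z = if z = x then v else S.n z := by
  simp [Store.setN, Function.update_apply]
@[simp] theorem Store.setN_r : (S.setN x v).r = S.r := rfl
@[simp] theorem Store.setN_na : (S.setN x v).na = S.na := rfl
@[simp] theorem Store.setN_ra : (S.setN x v).ra = S.ra := rfl
@[simp] theorem Store.setR_n : (S.setR x y).n = S.n := rfl
@[simp] theorem Store.setR_r (z : ℕ) : (S.setR x y).r z = if z = x then y else S.r z := by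
  simp [Store.setR, Function.update_apply]
@[simp] theorem Store.setR_na : (S.setR x y).na = S.na := rfl
@[simp] theorem Store.setR_ra : (S.setR x y).ra = S.ra := rfl
@[simp] theorem Store.putN_n : (S.putN q v).n = S.n := rfl
@[simp] theorem Store.putN_r : (S.putN q v).r = S.r := rfl
@[simp] theorem Store.putN_na (z : ℕ × ℕ × ℕ × ℕ) :
    (S.putN q v).na z = if z = q then v else S.na z := by
  simp [Store.putN, Function.update_apply]
@[simp] theorem Store.putN_ra : (S.putN q v).ra = S.ra := rfl
@[simp] theorem Store.putR_n : (S.putR q y).n = S.n := rfl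
@[simp] theorem Store.putR_r : (S.putR q y).r = S.r := rfl
@[simp] theorem Store.putR_na : (S.putR q y).na = S.na := rfl
@[simp] theorem Store.putR_ra (z : ℕ × ℕ × ℕ × ℕ) :
    (S.putR q y).ra z = if z = q then y else S.ra z := by
  simp [Store.putR, Function.update_apply]

end StoreLemmas

theorem Stmt.run_seq (A : ℕ → ℕ) (c₁ c₂ : Stmt) (S : Store) :
    (Stmt.seq c₁ c₂).run A S = c₂.run A (c₁.run A S) := rfl

/-! ### The program

The natural variables are: `0`: the number of vertices, `1`: the number of deletions, `2`: the
parameter `r`, `6`: the bound `g` for component sizes, `7`: `g + 1`, `8`: the number of profiles,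
`9`: the number of values for the number of deletions, `16`: whether a leaf was found, `21`: the
leaf, `22`: its neighbour, `31`: whether profiles do not match. The real variables are `0`: the
target, `1`: the value for `∞`, `2`: the cost of a merge, `4`: the answer. The natural arrays are
`0`: the digits of profiles, `1`: which vertices are removed. The real arrays are `0`: the table,
`1`: the new row of the table. -/

/-- `x := b ^ y`. -/
def powCode (x : ℕ) (b : NExp) (y : ℕ) : Stmt :=
  .seq (.setN x (.lit 1)) (.loop 3 y (.setN x (.mul (.var x) b)))

theorem run_powCode {A : ℕ → ℕ} {x y c : ℕ} {b : NExp} {S : Store} (hx : x ≠ 3) (hy : y ≠ x)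
    (hb : ∀ S', (∀ z, z ≠ x → z ≠ 3 → S'.n z = S.n z) → b.eval S' = c) :
    ((powCode x b y).run A S).n x = c ^ S.n y := by
  rw [powCode, Stmt.run_seq]
  have h1 : ((Stmt.setN x (.lit 1)).run A S).n y = S.n y := by simp [Stmt.run, hy]
  rw [← h1]
  refine (loop_induct (fun m S' => S'.n x = c ^ m ∧ ∀ z, z ≠ x → z ≠ 3 → S'.n z = S.n z) ?_ ?_).1
  · refine ⟨by simp [Stmt.run, NExp.eval], fun z hz _ => by simp [Stmt.run, hz]⟩
  · rintro m - S' - ⟨ih1, ih2⟩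
    have hb' : b.eval (S'.setN 3 m) = c := hb _ fun z hz hz' => by simp [hz', ih2 z hz hz']
    refine ⟨?_, fun z hz hz' => by simp [Stmt.run, hz, hz', ih2 z hz hz']⟩
    simp [Stmt.run, NExp.eval, hb', hx, ih1, pow_succ]

/-- Computes the least `r` with `n ≤ r * k`. -/
def ratioCode : Stmt :=
  .loop 3 0 (.iteN (.mul (.var 2) (.var 1)) (.var 0) (.setN 2 (.add (.var 2) (.lit 1))) .skip)

/-- Variable 2 is increased while it is too small; `n` rounds suffice because `k ≥ 1`. Its
minimality identifies it with the rounded-up parameter. -/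
theorem run_ratioCode {A : ℕ → ℕ} {S : Store} (h2 : S.n 2 = 0) (hk : 0 < S.n 1) :
    S.n 0 ≤ (ratioCode.run A S).n 2 * S.n 1 ∧
      ∀ q < (ratioCode.run A S).n 2, q * S.n 1 < S.n 0 := by
  have := loop_induct (A := A) (x := 3) (b := 0) (S := S)
    (c := .iteN (.mul (.var 2) (.var 1)) (.var 0) (.setN 2 (.add (.var 2) (.lit 1))) .skip)
    (fun m S' => (S'.n 2 = m ∨ S.n 0 ≤ S'.n 2 * S.n 1) ∧ ∀ q < S'.n 2, q * S.n 1 < S.n 0)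
    (by simp [h2]) ?_
  · refine ⟨?_, this.2⟩
    rcases this.1 with h | h
    · rw [ratioCode, h]; exact Nat.le_mul_of_pos_right _ hk
    · exact h
  · rintro m - S' ha ⟨ih1, ih2⟩
    have a0 : S'.n 0 = S.n 0 := ha.n 0 rfl
    have a1 : S'.n 1 = S.n 1 := ha.n 1 rfl
    by_cases hlt : S'.n 2 * S.n 1 < S.n 0
    · have e : ((Stmt.iteN (.mul (.var 2) (.var 1)) (.var 0) (.setN 2 (.add (.var 2) (.lit 1)))
          .skip).run A (S'.setN 3 m)).n 2 = S'.n 2 + 1 := by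
        simp [Stmt.run, NExp.eval, a0, a1, hlt]
      rw [e]
      refine ⟨?_, fun q hq => ?_⟩
      · rcases ih1 with h | h
        · exact .inl (by omega)
        · omega
      · rcases Nat.lt_succ_iff_lt_or_eq.1 hq with h | rfl
        · exact ih2 q h
        · exact hlt
    · have e : ((Stmt.iteN (.mul (.var 2) (.var 1)) (.var 0) (.setN 2 (.add (.var 2) (.lit 1)))
          .skip).run A (S'.setN 3 m)).n 2 = S'.n 2 := by
        simp [Stmt.run, NExp.eval, a0, a1, hlt]
      rw [e]
      exact ⟨.inr (by omega), ih2⟩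

/-- Computes the bound for the component sizes and the number of profiles. -/
def boundCode : Stmt :=
  .seq (.setN 4 (.mul (.var 2) (.var 2))) <|
  .seq (powCode 5 (.lit 3) 4) <|
  .seq (.setN 6 (.add (.mul (.var 4) (.var 5)) (.lit 1))) <|
  .seq (.setN 4 (.mul (.add (.var 2) (.var 6)) (.add (.var 2) (.var 6)))) <|
  .seq (powCode 5 (.lit 3) 4) <|
  .seq (.setN 6 (.add (.mul (.var 4) (.var 5)) (.lit 1))) <|
  .seq (.setN 7 (.add (.var 6) (.lit 1))) <|
  .seq (powCode 8 (.var 7) 6) <|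
  .seq (.setN 9 (.lit 0)) <|
  .iteN (.var 0) (.var 1) .skip (.setN 9 (.add (.var 1) (.lit 1)))

/-- Variable 9 is set to 0 when `k` exceeds `n`, for otherwise a loop bounded by `k + 1` could be
too long in terms of `n`. -/
theorem run_boundCode (A : ℕ → ℕ) (S : Store) :
    (boundCode.run A S).n 6 = compBound (S.n 2) ∧
    (boundCode.run A S).n 7 = compBound (S.n 2) + 1 ∧
    (boundCode.run A S).n 8 = (compBound (S.n 2) + 1) ^ compBound (S.n 2) ∧
    (boundCode.run A S).n 9 = if S.n 0 < S.n 1 then 0 else S.n 1 + 1 := by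
  have h3 : ∀ S' : Store, ((powCode 5 (.lit 3) 4).run A S').n 5 = 3 ^ S'.n 4 := fun S' =>
    run_powCode (by decide) (by decide) fun _ _ => rfl
  have h7 : ∀ S' : Store, ((powCode 8 (.var 7) 6).run A S').n 8 = S'.n 7 ^ S'.n 6 := fun S' =>
    run_powCode (by decide) (by decide) fun S'' h => h 7 (by decide) (by decide)
  have f3 : ∀ (S' : Store) (z : ℕ), z ≠ 5 → z ≠ 3 →
      ((powCode 5 (.lit 3) 4).run A S').n z = S'.n z := fun S' z h h' =>
    (Stmt.agree_run A _ S').n z (by simp [powCode, Stmt.writesN, h.symm, h'.symm])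
  have f7 : ∀ (S' : Store) (z : ℕ), z ≠ 8 → z ≠ 3 →
      ((powCode 8 (.var 7) 6).run A S').n z = S'.n z := fun S' z h h' =>
    (Stmt.agree_run A _ S').n z (by simp [powCode, Stmt.writesN, h.symm, h'.symm])
  have e : ∀ z, z = 6 ∨ z = 7 ∨ z = 8 ∨ z = 9 → (boundCode.run A S).n z =
      if z = 6 then compBound (S.n 2) else if z = 7 then compBound (S.n 2) + 1 else
      if z = 8 then (compBound (S.n 2) + 1) ^ compBound (S.n 2) else
      if S.n 0 < S.n 1 then 0 else S.n 1 + 1 := by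
    intro z hz
    unfold boundCode
    simp only [Stmt.run, NExp.eval]
    by_cases h : S.n 0 < S.n 1 <;> rcases hz with rfl | rfl | rfl | rfl <;>
      simp [compBound, sizeBound, h3, h7, f3, f7, h]
  exact ⟨e 6 (by simp), e 7 (by simp), e 8 (by simp), e 9 (by simp)⟩

/-- Computes the digits of the numbers of profiles. -/
def digitCode : Stmt :=
  .loop 10 8 <| .loop 11 7 <|
    .seq (.putN 0 (.add (.mul (.var 10) (.var 7)) (.var 11)) (.lit 0) (.lit 0) (.var 11)) <|
    .loop 12 6 <| .iteN (.add (.var 12) (.lit 1)) (.var 6)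
      (.putN 0 (.add (.mul (.var 10) (.var 7)) (.var 11)) (.add (.var 12) (.lit 1)) (.lit 0)
        (.get 0 (.var 10) (.var 12) (.lit 0)))
      .skip

/-- The row of `h * (g + 1) + l` is `l` followed by the digits of `h`. Rows are filled in increasing
order, and more of them than are needed. -/
theorem run_digitCode {A : ℕ → ℕ} {S : Store} {g : ℕ} (hg : 0 < g) (h6 : S.n 6 = g)
    (h7 : S.n 7 = g + 1) (h0 : ∀ e i, S.na (0, e, i, 0) = 0) :
    ∀ e < S.n 8, ∀ i, (digitCode.run A S).na (0, e, i, 0) = digit g e i := by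
  have main : ∀ e i, (digitCode.run A S).na (0, e, i, 0) =
      if e < S.n 8 * (g + 1) then digit g e i else 0 := by
    refine loop_induct (fun h S' => ∀ e i, S'.na (0, e, i, 0) =
      if e < h * (g + 1) then digit g e i else 0) (by simpa using h0) ?_
    intro h _ S₁ ha₁ ih₁
    have n6 : S₁.n 6 = g := (ha₁.n 6 rfl).trans h6
    have n7 : S₁.n 7 = g + 1 := (ha₁.n 7 rfl).trans h7
    have := loop_induct (A := A) (x := 11) (b := 7) (S := S₁.setN 10 h)
      (c := .seq (.putN 0 (.add (.mul (.var 10) (.var 7)) (.var 11)) (.lit 0) (.lit 0) (.var 11)) <|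
        .loop 12 6 <| .iteN (.add (.var 12) (.lit 1)) (.var 6)
          (.putN 0 (.add (.mul (.var 10) (.var 7)) (.var 11)) (.add (.var 12) (.lit 1)) (.lit 0)
            (.get 0 (.var 10) (.var 12) (.lit 0))) .skip)
      (fun l S' => ∀ e i, S'.na (0, e, i, 0) =
        if e < h * (g + 1) + l then digit g e i else 0) (by simpa using ih₁) ?_
    · intro e i
      have := this e i
      simp only [Store.setN_n, Nat.reduceEqDiff, if_false, n7] at this
      rw [show (h + 1) * (g + 1) = h * (g + 1) + (g + 1) by ring]
      exact this
    intro l hl S₂ ha₂ ih₂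
    have m6 : S₂.n 6 = g := (ha₂.n 6 rfl).trans (by simpa using n6)
    have m7 : S₂.n 7 = g + 1 := (ha₂.n 7 rfl).trans (by simpa using n7)
    have m10 : S₂.n 10 = h := (ha₂.n 10 rfl).trans (by simp)
    replace hl : l < g + 1 := by simpa [n7] using hl
    rw [Stmt.run_seq]
    set S₃ := (Stmt.putN 0 (.add (.mul (.var 10) (.var 7)) (.var 11)) (.lit 0) (.lit 0)
      (.var 11)).run A (S₂.setN 11 l) with hS₃
    have k6 : S₃.n 6 = g := by simp [hS₃, Stmt.run, m6]
    have k7 : S₃.n 7 = g + 1 := by simp [hS₃, Stmt.run, m7]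
    have k10 : S₃.n 10 = h := by simp [hS₃, Stmt.run, m10]
    have k11 : S₃.n 11 = l := by simp [hS₃, Stmt.run]
    have kna : ∀ e i, S₃.na (0, e, i, 0) = if e < h * (g + 1) + l ∨ (e = h * (g + 1) + l ∧ i ≤ 0)
        then digit g e i else 0 := by
      intro e i
      simp only [hS₃, Stmt.run, NExp.eval, Store.putN_na, Store.setN_n, Store.setN_na,
        Nat.reduceEqDiff, if_false, if_true, m7, m10, Prod.mk.injEq, true_and, and_true, ih₂]
      by_cases hei : e = h * (g + 1) + l ∧ i = 0
      · rw [if_pos hei, if_pos (by omega), hei.1, hei.2, digit_zero_right hg hl]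
      · rw [if_neg hei]
        congr 1
        apply propext
        omega
    have fin := loop_induct (A := A) (x := 12) (b := 6) (S := S₃)
      (c := .iteN (.add (.var 12) (.lit 1)) (.var 6)
          (.putN 0 (.add (.mul (.var 10) (.var 7)) (.var 11)) (.add (.var 12) (.lit 1)) (.lit 0)
            (.get 0 (.var 10) (.var 12) (.lit 0))) .skip)
      (fun m S' => ∀ e i, S'.na (0, e, i, 0) =
        if e < h * (g + 1) + l ∨ (e = h * (g + 1) + l ∧ i ≤ m) then digit g e i else 0) kna ?_
    · intro e i
      have := fin e i
      rw [this, k6]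
      by_cases he : e < h * (g + 1) + l
      · rw [if_pos (.inl he), if_pos (by omega)]
      · by_cases he' : e = h * (g + 1) + l
        · rw [if_pos (show e < h * (g + 1) + (l + 1) by omega)]
          by_cases hi : i ≤ g
          · rw [if_pos (.inr ⟨he', hi⟩)]
          · rw [if_neg (by omega), digit_of_le (by omega)]
        · rw [if_neg (by omega), if_neg (by omega)]
    intro m hm S₄ ha₄ ih₄
    have j6 : S₄.n 6 = g := (ha₄.n 6 rfl).trans k6
    have j7 : S₄.n 7 = g + 1 := (ha₄.n 7 rfl).trans k7
    have j10 : S₄.n 10 = h := (ha₄.n 10 rfl).trans k10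
    have j11 : S₄.n 11 = l := (ha₄.n 11 rfl).trans k11
    -- For `h > 0` row `h` is earlier than the current row and thus complete. For `h = 0` it is
    -- either complete (`l > 0`) or the current row itself, whose digits up to `m` are already
    -- there.
    have hread : S₄.na (0, h, m, 0) = digit g h m := by
      rw [ih₄, if_pos]
      rcases Nat.eq_zero_or_pos h with rfl | hpos
      · omega
      · exact .inl (by nlinarith)
    intro e i
    simp only [Stmt.run, NExp.eval, Store.setN_n, Nat.reduceEqDiff, if_false, if_true, j6, j7, j10,
      j11, Store.setN_na, hread]
    split_ifs with h1 h2 h2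
    · simp only [Store.putN_na, Prod.mk.injEq, true_and, and_true, Store.setN_na, ih₄]
      by_cases hei : e = h * (g + 1) + l ∧ i = m + 1
      · rw [if_pos hei, hei.1, hei.2, digit_succ h1 hl]
      · rw [if_neg hei, if_pos (by omega)]
    · simp only [Store.putN_na, Prod.mk.injEq, true_and, and_true, Store.setN_na, ih₄]
      rw [if_neg (by omega), if_neg (by omega)]
    · rw [Store.setN_na, ih₄]
      by_cases hei : e = h * (g + 1) + l ∧ i = m + 1
      · rw [if_neg (by omega), digit_of_le (by omega)]
      · rw [if_pos (by omega)]
    · rw [Store.setN_na, ih₄, if_neg (by omega)]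
  intro e he i
  rw [main, if_pos (by nlinarith)]

/-! ### The initial table -/

/-- Fills the table for single vertices. -/
def initCode : Stmt :=
  .seq (.setR 1 (.add (.mul (.var 0) (.var 0)) (.nat (.lit 1)))) <|
  .seq (.loop 13 0 <| .loop 14 9 <| .loop 15 8 <|
    .putR 0 (.var 13) (.var 14) (.var 15) (.var 1)) <|
  .loop 13 0 <|
    .seq (.putR 0 (.var 13) (.lit 0) (.lit 1) (.nat (.lit 0)))
      (.putR 0 (.var 13) (.lit 1) (.lit 0) (.nat (.lit 0)))

theorem run_initCode (A : ℕ → ℕ) (S : Store) :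
    (initCode.run A S).r 1 = S.r 0 * S.r 0 + 1 ∧ ∀ v < S.n 0, ∀ d < S.n 9, ∀ e < S.n 8,
      (initCode.run A S).ra (0, v, d, e) = initialEntry (S.r 0 * S.r 0 + 1) d e := by
  rw [initCode, Stmt.run_seq, Stmt.run_seq]
  set S₁ := (Stmt.setR 1 (.add (.mul (.var 0) (.var 0)) (.nat (.lit 1)))).run A S with hS₁
  have r1 : S₁.r 1 = S.r 0 * S.r 0 + 1 := by simp [hS₁, Stmt.run, RExp.eval, NExp.eval]
  have n1 : S₁.n = S.n := by simp [hS₁, Stmt.run]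
  rw [← r1, ← n1]
  set S₂ := (Stmt.loop 13 0 <| .loop 14 9 <| .loop 15 8 <|
    .putR 0 (.var 13) (.var 14) (.var 15) (.var 1)).run A S₁ with hS₂
  have a₂ : Agree _ S₁ S₂ := Stmt.agree_run A _ S₁
  have tab : ∀ v < S₁.n 0, ∀ d < S₁.n 9, ∀ e < S₁.n 8, S₂.ra (0, v, d, e) = S₁.r 1 := by
    intro v hv d hd e he
    have keep : ∀ S', S'.r 1 = S₁.r 1 → S'.ra (0, v, d, e) = S₁.r 1 →
        ((Stmt.putR 0 (.var 13) (.var 14) (.var 15) (.var 1)).run A S').ra (0, v, d, e) =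
          S₁.r 1 := by
      intro S' h h'
      simp only [Stmt.run, Store.putR_ra, RExp.eval, h, h', ite_self]
    refine loop_establish (fun S' => S'.ra (0, v, d, e) = S₁.r 1) hv ?_ ?_
    · intro S' a
      have a9 : (S'.setN 13 v).n 9 = S₁.n 9 := by simpa using a.n 9 rfl
      have a8 : (S'.setN 13 v).n 8 = S₁.n 8 := by simpa using a.n 8 rfl
      have ar : (S'.setN 13 v).r 1 = S₁.r 1 := a.r 1 rfl
      refine loop_establish (fun S' => S'.ra (0, v, d, e) = S₁.r 1) (a9.symm ▸ hd) ?_ ?_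
      · intro S'' a'
        have b8 : (S''.setN 14 d).n 8 = S₁.n 8 := by
          simpa using (a'.n 8 rfl).trans a8
        have br : (S''.setN 14 d).r 1 = S₁.r 1 := (a'.r 1 rfl).trans ar
        have b13 : (S''.setN 14 d).n 13 = v := by simpa using a'.n 13 rfl
        refine loop_establish (fun S' => S'.ra (0, v, d, e) = S₁.r 1) (b8.symm ▸ he) ?_ ?_
        · intro T c
          have c13 : T.n 13 = v := (c.n 13 rfl).trans b13
          have c14 : T.n 14 = d := by simpa using c.n 14 rfl
          have cr : T.r 1 = S₁.r 1 := (c.r 1 rfl).trans br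
          simp [Stmt.run, NExp.eval, RExp.eval, c13, c14, cr]
        · intro _ _ T c ih
          exact keep _ ((c.r 1 rfl).trans br) ih
      · intro _ _ S'' a' ih
        refine loop_preserve (fun S' => S'.ra (0, v, d, e) = S₁.r 1) ih ?_
        intro _ _ T c ih
        exact keep _ ((c.r 1 rfl).trans ((a'.r 1 rfl).trans ar)) ih
    · intro _ _ S' a ih
      refine loop_preserve (fun S' => S'.ra (0, v, d, e) = S₁.r 1) ih ?_
      intro _ _ S'' a' ih
      refine loop_preserve (fun S' => S'.ra (0, v, d, e) = S₁.r 1) ih ?_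
      intro _ _ T c ih
      exact keep _ ((c.r 1 rfl).trans ((a'.r 1 rfl).trans (a.r 1 rfl))) ih
  refine ⟨?_, fun v hv d hd e he => ?_⟩
  · rw [← show S₂.r 1 = S₁.r 1 from a₂.r 1 rfl]
    exact (Stmt.agree_run A _ S₂).r 1 rfl
  · have h0 : S₂.n 0 = S₁.n 0 := a₂.n 0 rfl
    by_cases hde : (d = 0 ∧ e = 1) ∨ (d = 1 ∧ e = 0)
    · rw [initialEntry, if_pos hde]
      refine loop_establish (fun S' => S'.ra (0, v, d, e) = 0) (h0.symm ▸ hv) ?_ ?_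
      · intro S' _
        rcases hde with ⟨rfl, rfl⟩ | ⟨rfl, rfl⟩ <;> simp [Stmt.run, NExp.eval, RExp.eval]
      · intro m _ S' _ ih
        simp [Stmt.run, NExp.eval, RExp.eval, ih]
    · rw [initialEntry, if_neg hde]
      refine loop_preserve (fun S' => S'.ra (0, v, d, e) = S₁.r 1) (tab v hv d hd e he) ?_
      intro m _ S' _ ih
      rw [not_or] at hde
      simp only [Stmt.run, NExp.eval, Store.putR_ra, Prod.mk.injEq, true_and, Store.setN_ra]
      rw [if_neg fun h => hde.2 h.2, if_neg fun h => hde.1 h.2, ih]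

/-! ### The search for a leaf -/

/-- Counts the remaining neighbours of vertex `u` (variable `17`) and finds one. -/
def countCode : Stmt :=
  .loop 18 0 <| .iteN (.get 1 (.var 18) (.lit 0) (.lit 0)) (.lit 1)
    (.seq (.inp 23 (.add (.mul (.var 17) (.var 0)) (.var 18)))
      (.iteN (.lit 0) (.var 23)
        (.seq (.setN 19 (.add (.var 19) (.lit 1))) (.setN 20 (.var 18))) .skip))
    .skip

/-- Finds a remaining vertex with exactly one remaining neighbour. -/
def leafCode : Stmt :=
  .seq (.setN 16 (.lit 0)) <| .loop 17 0 <|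
    .iteN (.get 1 (.var 17) (.lit 0) (.lit 0)) (.lit 1)
      (.seq (.setN 19 (.lit 0)) <| .seq countCode <|
        .iteN (.var 19) (.lit 2) (.iteN (.lit 0) (.var 19)
          (.seq (.setN 16 (.lit 1)) <| .seq (.setN 21 (.var 17)) (.setN 22 (.var 20))) .skip) .skip)
      .skip

/-- `w` is a remaining neighbour of `u`. -/
def Nbr (A : ℕ → ℕ) (S : Store) (u w : ℕ) : Prop :=
  S.na (1, w, 0, 0) = 0 ∧ 0 < A (u * S.n 0 + w)

open Classical in
theorem run_countCode (A : ℕ → ℕ) (S : Store) (h19 : S.n 19 = 0) :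
    (countCode.run A S).n 19 = ((Finset.range (S.n 0)).filter (Nbr A S (S.n 17))).card ∧
    (0 < (countCode.run A S).n 19 → (countCode.run A S).n 20 < S.n 0 ∧
      Nbr A S (S.n 17) ((countCode.run A S).n 20)) := by
  refine loop_induct (fun m S' =>
    S'.n 19 = ((Finset.range m).filter (Nbr A S (S.n 17))).card ∧
    (0 < S'.n 19 → S'.n 20 < S.n 0 ∧ Nbr A S (S.n 17) (S'.n 20))) (by simp [h19]) ?_
  rintro m hm S' a ⟨ih1, ih2⟩
  have a0 : S'.n 0 = S.n 0 := a.n 0 rfl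
  have a17 : S'.n 17 = S.n 17 := a.n 17 rfl
  have ana : S'.na (1, m, 0, 0) = S.na (1, m, 0, 0) := a.na 1 _ rfl
  rw [Finset.range_add_one, Finset.filter_insert]
  by_cases hn : Nbr A S (S.n 17) m
  · have hn' := hn
    obtain ⟨h1, h2⟩ := hn
    rw [if_pos hn', Finset.card_insert_of_notMem (by simp), ← ih1]
    simp [Stmt.run, NExp.eval, a0, a17, ana, h1, h2, hm, hn']
  · rw [if_neg hn, ← ih1]
    by_cases h1 : S.na (1, m, 0, 0) = 0
    · have h2 : A (S.n 17 * S.n 0 + m) = 0 := by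
        by_contra h
        exact hn ⟨h1, Nat.pos_of_ne_zero h⟩
      simpa [Stmt.run, NExp.eval, a0, a17, ana, h1, h2] using ih2
    · simpa [Stmt.run, NExp.eval, a0, a17, ana, h1] using ih2

/-- `u` is a remaining vertex whose only remaining neighbour is `p`. -/
def LeafAt (A : ℕ → ℕ) (S : Store) (u p : ℕ) : Prop :=
  u < S.n 0 ∧ S.na (1, u, 0, 0) = 0 ∧ p < S.n 0 ∧ ∀ w < S.n 0, Nbr A S u w ↔ w = p

theorem nbr_congr {A : ℕ → ℕ} {S S' : Store} (h0 : S'.n 0 = S.n 0)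
    (h1 : ∀ w, S'.na (1, w, 0, 0) = S.na (1, w, 0, 0)) (u w : ℕ) : Nbr A S' u w ↔ Nbr A S u w := by
  unfold Nbr; rw [h0, h1]

theorem leafAt_congr {A : ℕ → ℕ} {S S' : Store} (h0 : S'.n 0 = S.n 0)
    (h1 : ∀ w, S'.na (1, w, 0, 0) = S.na (1, w, 0, 0)) (u w : ℕ) :
    LeafAt A S' u w ↔ LeafAt A S u w := by
  unfold LeafAt; simp only [nbr_congr h0 h1, h0, h1]

/-- The body of the loop in `leafCode`. -/
def leafBody : Stmt :=
  .iteN (.get 1 (.var 17) (.lit 0) (.lit 0)) (.lit 1)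
      (.seq (.setN 19 (.lit 0)) <| .seq countCode <|
        .iteN (.var 19) (.lit 2) (.iteN (.lit 0) (.var 19)
          (.seq (.setN 16 (.lit 1)) <| .seq (.setN 21 (.var 17)) (.setN 22 (.var 20))) .skip) .skip)
      .skip

theorem run_leafBody (A : ℕ → ℕ) (S : Store) (h17 : S.n 17 < S.n 0) :
    ((∃ p, LeafAt A S (S.n 17) p) → (leafBody.run A S).n 16 = 1 ∧
      LeafAt A S ((leafBody.run A S).n 21) ((leafBody.run A S).n 22)) ∧
    ((¬∃ p, LeafAt A S (S.n 17) p) → (leafBody.run A S).n 16 = S.n 16 ∧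
      (leafBody.run A S).n 21 = S.n 21 ∧ (leafBody.run A S).n 22 = S.n 22) := by
  classical
  by_cases hal : S.na (1, S.n 17, 0, 0) = 0
  · set S₁ := countCode.run A (S.setN 19 0) with hS₁
    have hc := run_countCode A (S.setN 19 0) (by simp)
    have a := Stmt.agree_run A countCode (S.setN 19 0)
    rw [← hS₁] at hc a
    have a16 : S₁.n 16 = S.n 16 := by simpa using a.n 16 rfl
    have a17 : S₁.n 17 = S.n 17 := by simpa using a.n 17 rfl
    have a21 : S₁.n 21 = S.n 21 := by simpa using a.n 21 rfl
    have a22 : S₁.n 22 = S.n 22 := by simpa using a.n 22 rfl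
    have hN : Nbr A (S.setN 19 0) = Nbr A S := by
      funext u w
      exact propext (nbr_congr (by simp) (by simp) u w)
    simp only [hN, Store.setN_n, OfNat.zero_ne_ofNat, Nat.reduceEqDiff, if_false] at hc
    have key : (∃ p, LeafAt A S (S.n 17) p) ↔ S₁.n 19 = 1 := by
      constructor
      · rintro ⟨p, -, -, hp, huniq⟩
        rw [hc.1, Finset.card_eq_one]
        refine ⟨p, ?_⟩
        ext w
        simp only [Finset.mem_filter, Finset.mem_range, Finset.mem_singleton]
        constructor
        · rintro ⟨h1, h2⟩; exact (huniq w h1).1 h2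
        · rintro rfl; exact ⟨hp, (huniq w hp).2 rfl⟩
      · intro h1
        rw [hc.1, Finset.card_eq_one] at h1
        obtain ⟨p, hp⟩ := h1
        have hp' := Finset.ext_iff.1 hp
        simp only [Finset.mem_filter, Finset.mem_range, Finset.mem_singleton] at hp'
        have := (hp' p).2 rfl
        refine ⟨p, h17, hal, this.1, fun w hw => ⟨fun h => (hp' w).1 ⟨hw, h⟩, fun h => ?_⟩⟩
        rw [h]; exact this.2
    rw [key]
    constructor
    · intro h1
      obtain ⟨p, hp⟩ := key.2 h1
      obtain ⟨q1, q2⟩ := hc.2 (by omega)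
      obtain rfl := (hp.2.2.2 _ q1).1 q2
      simpa [leafBody, Stmt.run, NExp.eval, hal, ← hS₁, h1, a17] using hp
    · intro h1
      by_cases h2 : S₁.n 19 < 2
      · have h3 : S₁.n 19 = 0 := by omega
        simp [leafBody, Stmt.run, NExp.eval, hal, ← hS₁, h3, a16, a21, a22]
      · simp [leafBody, Stmt.run, NExp.eval, hal, ← hS₁, h2, a16, a21, a22]
  · constructor
    · rintro ⟨p, -, h, -⟩; exact absurd h hal
    · intro _
      simp [leafBody, Stmt.run, NExp.eval, hal]

/-- Later finds overwrite earlier ones, but a leaf and its neighbour are always recorded together,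
and the flag is never reset during the search. -/
theorem run_leafCode (A : ℕ → ℕ) (S : Store) :
    ((leafCode.run A S).n 16 ≠ 0 →
      LeafAt A S ((leafCode.run A S).n 21) ((leafCode.run A S).n 22)) ∧
    ((∃ u p, LeafAt A S u p) → (leafCode.run A S).n 16 ≠ 0) := by
  have body : ∀ (m : ℕ) (S' : Store), m < S.n 0 → Agree (.loop 17 0 leafBody) (S.setN 16 0) S' →
      ((∃ p, LeafAt A S m p) → (leafBody.run A (S'.setN 17 m)).n 16 = 1 ∧
      LeafAt A S ((leafBody.run A (S'.setN 17 m)).n 21) ((leafBody.run A (S'.setN 17 m)).n 22)) ∧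
    ((¬∃ p, LeafAt A S m p) → (leafBody.run A (S'.setN 17 m)).n 16 = S'.n 16 ∧
      (leafBody.run A (S'.setN 17 m)).n 21 = S'.n 21 ∧
      (leafBody.run A (S'.setN 17 m)).n 22 = S'.n 22) := by
    intro m S' hm a
    have a0 : S'.n 0 = S.n 0 := by simpa using a.n 0 rfl
    have h := run_leafBody A (S'.setN 17 m) (by simpa [a0] using hm)
    have hL : LeafAt A (S'.setN 17 m) = LeafAt A S := by
      funext u p
      exact propext (leafAt_congr (by simpa using a0) (fun w => by simpa using a.na 1 _ rfl) u p)
    simpa [hL] using h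
  constructor
  · refine loop_preserve (S := S.setN 16 0) (fun S' => S'.n 16 ≠ 0 → LeafAt A S (S'.n 21) (S'.n 22))
      (by simp) ?_
    intro m hm S' a ih
    obtain ⟨b1, b2⟩ := body m S' (by simpa using hm) a
    change (leafBody.run A (S'.setN 17 m)).n 16 ≠ 0 → LeafAt A S
      ((leafBody.run A (S'.setN 17 m)).n 21) ((leafBody.run A (S'.setN 17 m)).n 22)
    by_cases hp : ∃ p, LeafAt A S m p
    · exact fun _ => (b1 hp).2
    · rw [(b2 hp).1, (b2 hp).2.1, (b2 hp).2.2]; exact ih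
  · rintro ⟨u, p, hup⟩
    refine loop_establish (S := S.setN 16 0) (m₀ := u) (fun S' => S'.n 16 ≠ 0)
      (by simpa using hup.1) ?_ ?_
    · intro S' a
      change (leafBody.run A (S'.setN 17 u)).n 16 ≠ 0
      rw [((body u S' hup.1 a).1 ⟨p, hup⟩).1]
      exact one_ne_zero
    · intro m hm S' a ih
      obtain ⟨b1, b2⟩ := body m S' (by simpa using hm) a
      change (leafBody.run A (S'.setN 17 m)).n 16 ≠ 0
      by_cases hp : ∃ p, LeafAt A S m p
      · rw [(b1 hp).1]; exact one_ne_zero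
      · rw [(b2 hp).1]; exact ih

/-! ### Merging -/

/-- Sets the flag if `a` and `b` are different. -/
def differCode (a b : NExp) : Stmt :=
  .seq (.iteN a b (.setN 31 (.lit 1)) .skip) (.iteN b a (.setN 31 (.lit 1)) .skip)

/-- Compares the digit `i + 1` and adds the contributions of the digit `i` to the cost. -/
def checkBody : Stmt :=
  .seq (differCode (.get 0 (.var 28) (.add (.var 29) (.lit 1)) (.lit 0))
      (.add (.get 0 (.var 26) (.add (.var 29) (.lit 1)) (.lit 0))
        (.mul (.get 0 (.var 26) (.lit 0) (.lit 0)) (.get 0 (.var 27) (.var 29) (.lit 0))))) <|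
  .loop 30 6 <| .setR 2 (.add (.var 2) (.divSucc (.nat
      (.mul (.get 0 (.var 26) (.var 29) (.lit 0)) (.get 0 (.var 27) (.var 30) (.lit 0))))
      (.add (.var 29) (.var 30))))

/-- Decides whether the profile `28` arises from `26` and `27`, and computes the cost. -/
def checkCode : Stmt :=
  .seq (.setN 31 (.lit 0)) <| .seq (.setR 2 (.nat (.lit 0))) <|
  .seq (differCode (.get 0 (.var 28) (.lit 0) (.lit 0)) (.get 0 (.var 26) (.lit 0) (.lit 0))) <|
  .loop 29 6 checkBody

/-- The second comparison runs after the flag may have been set, so the expressions must not depend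
on the flag. -/
theorem run_differCode {A : ℕ → ℕ} {S : Store} {a b : NExp} {x y : ℕ}
    (ha : ∀ v, a.eval (S.setN 31 v) = x) (hb : ∀ v, b.eval (S.setN 31 v) = y)
    (ha' : a.eval S = x) (hb' : b.eval S = y) :
    (differCode a b).run A S = if x = y then S else S.setN 31 1 := by
  have h1 : ∀ S : Store, NExp.eval S (.lit 1) = 1 := fun _ => rfl
  unfold differCode
  simp only [Stmt.run, ha', hb', h1]
  rcases lt_trichotomy x y with h | h | h
  · simp [h, h.ne, ha, hb, h.le]
  · simp [h, ha', hb']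
  · simp [h, h.ne', ha', hb', not_lt.2 h.le]

/-- The array `0` holds the digits of `e`. -/
def HasDigits (S : Store) (g e : ℕ) : Prop := ∀ i, S.na (0, e, i, 0) = digit g e i

theorem run_checkBody {A : ℕ → ℕ} {S : Store} {g e f h : ℕ} (h6 : S.n 6 = g) (h26 : S.n 26 = e)
    (h27 : S.n 27 = f) (h28 : S.n 28 = h) (de : HasDigits S g e) (df : HasDigits S g f)
    (dh : HasDigits S g h) :
    (checkBody.run A S).n 31 = (if digit g h (S.n 29 + 1) = digit g e (S.n 29 + 1) +
      digit g e 0 * digit g f (S.n 29) then S.n 31 else 1) ∧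
    (checkBody.run A S).r 2 = S.r 2 + ∑ j ∈ Finset.range g,
      (digit g e (S.n 29) : ℝ) * (digit g f j : ℝ) / ((S.n 29 + j : ℕ) + 1) := by
  rw [checkBody, Stmt.run_seq, run_differCode (x := digit g h (S.n 29 + 1))
    (y := digit g e (S.n 29 + 1) + digit g e 0 * digit g f (S.n 29))
    (by intro v; simp [NExp.eval, h28, dh _]) (by intro v; simp [NExp.eval, h26, h27, de _, df _])
    (by simp [NExp.eval, h28, dh _]) (by simp [NExp.eval, h26, h27, de _, df _])]
  set S₁ := if digit g h (S.n 29 + 1) = digit g e (S.n 29 + 1) + digit g e 0 * digit g f (S.n 29)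
    then S else S.setN 31 1 with hS₁
  have k : ∀ z, z ≠ 31 → S₁.n z = S.n z := by
    intro z hz; rw [hS₁]; split_ifs <;> simp [hz]
  have kr : S₁.r = S.r := by rw [hS₁]; split_ifs <;> simp
  have kna : S₁.na = S.na := by rw [hS₁]; split_ifs <;> simp
  constructor
  · rw [(Stmt.agree_run A _ S₁).n 31 rfl, hS₁]
    split_ifs <;> simp
  · have := loop_induct (A := A) (x := 30) (b := 6) (S := S₁)
      (c := .setR 2 (.add (.var 2) (.divSucc (.nat
        (.mul (.get 0 (.var 26) (.var 29) (.lit 0)) (.get 0 (.var 27) (.var 30) (.lit 0))))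
        (.add (.var 29) (.var 30)))))
      (fun m S' => S'.r 2 = S.r 2 + ∑ j ∈ Finset.range m,
        (digit g e (S.n 29) : ℝ) * (digit g f j : ℝ) / ((S.n 29 + j : ℕ) + 1))
      (by simp [kr]) ?_
    · rw [this, k 6 (by decide), h6]
    · intro m _ S' a ih
      have a26 : S'.n 26 = e := (a.n 26 rfl).trans ((k 26 (by decide)).trans h26)
      have a27 : S'.n 27 = f := (a.n 27 rfl).trans ((k 27 (by decide)).trans h27)
      have a29 : S'.n 29 = S.n 29 := (a.n 29 rfl).trans (k 29 (by decide))
      have d1 : ∀ i, S'.na (0, e, i, 0) = digit g e i := fun i =>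
        (a.na 0 _ rfl).trans (by rw [kna, de])
      have d2 : ∀ i, S'.na (0, f, i, 0) = digit g f i := fun i =>
        (a.na 0 _ rfl).trans (by rw [kna, df])
      rw [Finset.sum_range_succ, ← add_assoc, ← ih]
      simp [Stmt.run, NExp.eval, RExp.eval, a26, a27, a29, d1, d2]

theorem run_checkCode {A : ℕ → ℕ} {S : Store} {g e f h : ℕ} (h6 : S.n 6 = g) (h26 : S.n 26 = e)
    (h27 : S.n 27 = f) (h28 : S.n 28 = h) (de : HasDigits S g e) (df : HasDigits S g f)
    (dh : HasDigits S g h) :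
    ((checkCode.run A S).n 31 = 0 ↔ Matches g e f h) ∧
    (checkCode.run A S).r 2 = crossCost g (digit g e) (digit g f) := by
  rw [checkCode, Stmt.run_seq, Stmt.run_seq, Stmt.run_seq]
  set S₀ := (Stmt.setR 2 (.nat (.lit 0))).run A ((Stmt.setN 31 (.lit 0)).run A S) with hS₀
  have k : ∀ z, z ≠ 31 → S₀.n z = S.n z := by
    intro z hz; simp [hS₀, Stmt.run, hz]
  have k31 : S₀.n 31 = 0 := by simp [hS₀, Stmt.run, NExp.eval]
  have kr : S₀.r 2 = 0 := by simp [hS₀, Stmt.run, NExp.eval, RExp.eval]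
  have kna : S₀.na = S.na := by simp [hS₀, Stmt.run]
  rw [run_differCode (x := digit g h 0) (y := digit g e 0)
    (by intro v; simp [NExp.eval, h28, dh _, k, kna])
    (by intro v; simp [NExp.eval, h26, de _, k, kna])
    (by simp [NExp.eval, h28, dh _, k, kna]) (by simp [NExp.eval, h26, de _, k, kna])]
  set S₁ := if digit g h 0 = digit g e 0 then S₀ else S₀.setN 31 1 with hS₁
  have m : ∀ z, z ≠ 31 → S₁.n z = S.n z := by
    intro z hz; rw [hS₁, ← k z hz]; split_ifs <;> simp [hz]
  have mr : S₁.r 2 = 0 := by rw [hS₁]; split_ifs <;> simp [kr]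
  have mna : S₁.na = S.na := by rw [hS₁, ← kna]; split_ifs <;> simp
  have := loop_induct (A := A) (x := 29) (b := 6) (c := checkBody) (S := S₁)
    (fun m S' => (S'.n 31 = 0 ↔ digit g h 0 = digit g e 0 ∧
      ∀ i < m, digit g h (i + 1) = digit g e (i + 1) + digit g e 0 * digit g f i) ∧
      S'.r 2 = ∑ i ∈ Finset.range m, ∑ j ∈ Finset.range g,
        (digit g e i : ℝ) * (digit g f j : ℝ) / ((i + j : ℕ) + 1)) ?_ ?_
  · rw [m 6 (by decide), h6] at this
    exact this
  · refine ⟨?_, by simp [mr]⟩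
    rw [hS₁]
    split_ifs with h <;> simp [h, k31]
  · rintro i - S' a ⟨ih1, ih2⟩
    have hd : ∀ x, HasDigits S g x → HasDigits (S'.setN 29 i) g x := fun x hx j => by
      simpa [mna, hx j] using a.na 0 (x, j, 0) rfl
    obtain ⟨b1, b2⟩ := run_checkBody (A := A) (S := S'.setN 29 i) (g := g) (e := e)
      (f := f) (h := h) (by simpa [m, h6] using a.n 6 rfl) (by simpa [m, h26] using a.n 26 rfl)
      (by simpa [m, h27] using a.n 27 rfl) (by simpa [m, h28] using a.n 28 rfl)
      (hd e de) (hd f df) (hd h dh)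
    rw [b1, b2, Finset.sum_range_succ, ← ih2]
    constructor
    · simp only [Store.setN_n, Nat.reduceEqDiff, if_false, if_true]
      split_ifs with hi
      · rw [ih1]
        refine and_congr_right fun _ => ⟨fun hall j hj => ?_, fun hall j hj => hall j (by omega)⟩
        rcases Nat.lt_succ_iff_lt_or_eq.1 hj with hj | rfl
        · exact hall j hj
        · exact hi
      · simp only [false_iff, not_and]
        exact fun _ hall => hi (hall i (by omega))
    · simp

/-! ### Invariants of nested loops -/

/-- Nested loops with the given variables and bounds. -/
def nest (c : Stmt) : List (ℕ × ℕ) → Stmt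
  | [] => c
  | q :: L => .loop q.1 q.2 (nest c L)

/-- The loop variables and bounds of `nest c L` are not overwritten. -/
def NestOk (c : Stmt) : List (ℕ × ℕ) → Prop
  | [] => True
  | q :: L => (nest c L).writesN q.1 = false ∧
      (∀ q' ∈ q :: L, (nest c (q :: L)).writesN q'.2 = false) ∧ NestOk c L

theorem nest_step {c : Stmt} {q : ℕ × ℕ} {L : List (ℕ × ℕ)} (ok : NestOk c (q :: L))
    {S S' S'' : Store} {m : ℕ} (a : Agree (nest c (q :: L)) S S')
    (a' : Agree (nest c L) (S'.setN q.1 m) S'') :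
    Agree (nest c (q :: L)) S S'' ∧ S''.n q.1 = m ∧
      ∀ q' ∈ L, (S'.setN q.1 m).n q'.2 = S.n q'.2 := by
  refine ⟨(a.trans (.setN_loop _ _ _ _ m)).trans a'.loop, ?_, fun q' hq' => ?_⟩
  · rw [a'.n _ ok.1]; simp
  · have h := ok.2.1 q' (List.mem_cons_of_mem _ hq')
    rw [(Agree.setN_loop q.1 q.2 (nest c L) S' m).n _ h]
    exact a.n _ h

/-- The properties in question concern arrays and real variables only, so setting a loop counter
(`hJ`) does not disturb them. -/
theorem nest_preserve {A : ℕ → ℕ} {c : Stmt} (J : Store → Prop)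
    (hJ : ∀ S' x v, J S' → J (S'.setN x v)) (L : List (ℕ × ℕ)) (ok : NestOk c L) (S : Store)
    (h0 : J S)
    (hs : ∀ S', Agree (nest c L) S S' → (∀ q ∈ L, S'.n q.1 < S.n q.2) → J S' → J (c.run A S')) :
    J ((nest c L).run A S) := by
  induction L generalizing S with
  | nil => exact hs S (.refl _ _) (by simp) h0
  | cons q L ih =>
    refine loop_preserve J h0 fun m hm S' a h => ih ok.2.2 _ (hJ _ _ _ h) fun S'' a' hb h' => ?_
    obtain ⟨h1, h2, h3⟩ := nest_step ok a a'
    refine hs S'' h1 (fun q' hq' => ?_) h'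
    rcases List.mem_cons.1 hq' with rfl | hq'
    · rw [h2]; exact hm
    · rw [← h3 q' hq']; exact hb q' hq'

theorem nest_establish {A : ℕ → ℕ} {c : Stmt} (Q : Store → Prop)
    (hQ : ∀ S' x v, Q S' → Q (S'.setN x v)) (L : List (ℕ × ℕ)) (ok : NestOk c L) (S : Store)
    (val : ℕ → ℕ) (hv : ∀ q ∈ L, val q.1 < S.n q.2)
    (he : ∀ S', Agree (nest c L) S S' → (∀ q ∈ L, S'.n q.1 = val q.1) → Q (c.run A S'))
    (hs : ∀ S', Agree (nest c L) S S' → (∀ q ∈ L, S'.n q.1 < S.n q.2) → Q S' → Q (c.run A S')) :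
    Q ((nest c L).run A S) := by
  induction L generalizing S with
  | nil => exact he S (.refl _ _) (by simp)
  | cons q L ih =>
    have hs' : ∀ m < S.n q.2, ∀ S', Agree (nest c (q :: L)) S S' → ∀ S'',
        Agree (nest c L) (S'.setN q.1 m) S'' →
        (∀ q' ∈ L, S''.n q'.1 < (S'.setN q.1 m).n q'.2) → Q S'' → Q (c.run A S'') := by
      intro m hm S' a S'' a' hb h
      obtain ⟨h1, h2, h3⟩ := nest_step ok a a'
      refine hs S'' h1 (fun q' hq' => ?_) h
      rcases List.mem_cons.1 hq' with rfl | hq'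
      · rw [h2]; exact hm
      · rw [← h3 q' hq']; exact hb q' hq'
    have hq := hv q (by simp)
    refine loop_establish Q hq (fun S' a => ih ok.2.2 _ (fun q' hq' => ?_) (fun S'' a' hval => ?_)
      (hs' _ hq S' a)) fun m hm S' a h =>
        nest_preserve Q hQ L ok.2.2 _ (hQ _ _ _ h) (hs' m hm S' a)
    · obtain ⟨-, -, h3⟩ := nest_step ok a (Agree.refl _ (S'.setN q.1 (val q.1)))
      rw [h3 q' hq']
      exact hv q' (by simp [hq'])
    · obtain ⟨h1, h2, -⟩ := nest_step ok a a'
      refine he S'' h1 fun q' hq' => ?_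
      rcases List.mem_cons.1 hq' with rfl | hq'
      · exact h2
      · exact hval q' hq'

/-! ### One merge of two rows -/

/-- Fills the new row with `∞`. -/
def clearCode : Stmt :=
  nest (.putR 1 (.var 14) (.var 15) (.lit 0) (.var 1)) [(14, 9), (15, 8)]

theorem nestOk_clear : NestOk (.putR 1 (.var 14) (.var 15) (.lit 0) (.var 1)) [(14, 9), (15, 8)] :=
  ⟨rfl, by simp only [List.forall_mem_cons]; exact ⟨rfl, rfl, by simp⟩,
   rfl, by simp only [List.forall_mem_cons]; exact ⟨rfl, by simp⟩, trivial⟩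

theorem run_clearCode (A : ℕ → ℕ) (S : Store) {d e : ℕ} (hd : d < S.n 9) (he : e < S.n 8) :
    (clearCode.run A S).ra (1, d, e, 0) = S.r 1 := by
  refine nest_establish (fun S' => S'.ra (1, d, e, 0) = S.r 1) (fun _ _ _ h => h) _ nestOk_clear S
    (fun x => if x = 14 then d else e) (by simp [hd, he]) ?_ ?_
  · intro S' a hv
    have h14 : S'.n 14 = d := hv (14, 9) (by simp)
    have h15 : S'.n 15 = e := hv (15, 8) (by simp)
    have r1 : S'.r 1 = S.r 1 := a.r 1 rfl
    simp [Stmt.run, NExp.eval, RExp.eval, h14, h15, r1]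
  · intro S' a _ ih
    have r1 : S'.r 1 = S.r 1 := a.r 1 rfl
    simp [Stmt.run, NExp.eval, RExp.eval, r1, ih]

/-- Replaces the row of the neighbour by the new row. -/
def copyCode : Stmt :=
  nest (.putR 0 (.var 22) (.var 14) (.var 15) (.get 1 (.var 14) (.var 15) (.lit 0)))
    [(14, 9), (15, 8)]

theorem nestOk_copy : NestOk (.putR 0 (.var 22) (.var 14) (.var 15)
    (.get 1 (.var 14) (.var 15) (.lit 0))) [(14, 9), (15, 8)] :=
  ⟨rfl, by simp only [List.forall_mem_cons]; exact ⟨rfl, rfl, by simp⟩,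
   rfl, by simp only [List.forall_mem_cons]; exact ⟨rfl, by simp⟩, trivial⟩

theorem run_copyCode (A : ℕ → ℕ) (S : Store) {d e : ℕ} (hd : d < S.n 9) (he : e < S.n 8) :
    (copyCode.run A S).ra (0, S.n 22, d, e) = S.ra (1, d, e, 0) := by
  refine nest_establish (fun S' => S'.ra (0, S.n 22, d, e) = S.ra (1, d, e, 0)) (fun _ _ _ h => h) _
    nestOk_copy S (fun x => if x = 14 then d else e)
    (by simp [hd, he]) ?_ ?_
  · intro S' a hv
    have h14 : S'.n 14 = d := hv (14, 9) (by simp)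
    have h15 : S'.n 15 = e := hv (15, 8) (by simp)
    have h22 : S'.n 22 = S.n 22 := a.n 22 rfl
    have r1 : ∀ i, S'.ra (1, i) = S.ra (1, i) := fun i => a.ra 1 i rfl
    simp [Stmt.run, NExp.eval, RExp.eval, h14, h15, h22, r1]
  · intro S' a _ ih
    have h22 : S'.n 22 = S.n 22 := a.n 22 rfl
    have r1 : ∀ i, S'.ra (1, i) = S.ra (1, i) := fun i => a.ra 1 i rfl
    simp only [Stmt.run, NExp.eval, RExp.eval, Store.putR_ra, Prod.mk.injEq, h22, r1, true_and, ih]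
    split_ifs with h
    · rw [h.1, h.2]
    · rfl

theorem run_copyCode_other (A : ℕ → ℕ) (S : Store) {v : ℕ} (hv : v ≠ S.n 22) (i : ℕ × ℕ) :
    (copyCode.run A S).ra (0, v, i) = S.ra (0, v, i) := by
  refine nest_preserve (fun S' => S'.ra (0, v, i) = S.ra (0, v, i)) (fun _ _ _ h => h) _
    nestOk_copy S rfl ?_
  intro S' a _ ih
  have h22 : S'.n 22 = S.n 22 := a.n 22 rfl
  simp [Stmt.run, NExp.eval, RExp.eval, h22, hv, ih]

/-- Lowers an entry of the new row, if the profiles match. -/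
def updateCode : Stmt :=
  .iteN (.var 31) (.lit 1)
    (.seq (.setR 3 (.add (.add (.get 0 (.var 22) (.var 24) (.var 26))
        (.get 0 (.var 21) (.var 25) (.var 27))) (.var 2)))
      (.iteR (.var 3) (.get 1 (.add (.var 24) (.var 25)) (.var 28) (.lit 0))
        (.putR 1 (.add (.var 24) (.var 25)) (.var 28) (.lit 0) (.var 3)) .skip)) .skip

/-- Combines all pairs of entries. -/
def combineCode : Stmt :=
  nest (.seq checkCode updateCode) [(24, 9), (25, 9), (26, 8), (27, 8), (28, 8)]

/-- What two entries give together. -/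
noncomputable def candidate (S : Store) (g d₁ d₂ e f : ℕ) : ℝ :=
  S.ra (0, S.n 22, d₁, e) + S.ra (0, S.n 21, d₂, f) + crossCost g (digit g e) (digit g f)

-- Each innermost round lowers at most one entry of the new row, to a candidate value. Soundness and
-- completeness of the combination are both read off from this formula.
open Classical in
theorem run_check_update {A : ℕ → ℕ} {S S' : Store} {g : ℕ} (h6 : S.n 6 = g)
    (hdig : ∀ e < S.n 8, HasDigits S g e) (a : Agree combineCode S S')
    (hv : ∀ q ∈ [(24, 9), (25, 9), (26, 8), (27, 8), (28, 8)], S'.n q.1 < S.n q.2) (d x : ℕ) :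
    ((Stmt.seq checkCode updateCode).run A S').ra (1, d, x, 0) =
      if (d = S'.n 24 + S'.n 25 ∧ x = S'.n 28) ∧ Matches g (S'.n 26) (S'.n 27) (S'.n 28) ∧
        candidate S g (S'.n 24) (S'.n 25) (S'.n 26) (S'.n 27) < S'.ra (1, d, x, 0)
      then candidate S g (S'.n 24) (S'.n 25) (S'.n 26) (S'.n 27) else S'.ra (1, d, x, 0) := by
  have hd : ∀ e < S.n 8, HasDigits S' g e := fun e he i => (a.na 0 _ rfl).trans (hdig e he i)
  obtain ⟨c1, c2⟩ := run_checkCode (A := A) (S := S') (g := g) ((a.n 6 rfl).trans h6) rfl rfl rfl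
    (hd _ (hv (26, 8) (by simp))) (hd _ (hv (27, 8) (by simp))) (hd _ (hv (28, 8) (by simp)))
  rw [Stmt.run_seq]
  have b := Stmt.agree_run A checkCode S'
  set S₁ := checkCode.run A S'
  have n21 : S₁.n 21 = S.n 21 := (b.n 21 rfl).trans (a.n 21 rfl)
  have n22 : S₁.n 22 = S.n 22 := (b.n 22 rfl).trans (a.n 22 rfl)
  have n24 : S₁.n 24 = S'.n 24 := b.n 24 rfl
  have n25 : S₁.n 25 = S'.n 25 := b.n 25 rfl
  have n26 : S₁.n 26 = S'.n 26 := b.n 26 rfl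
  have n27 : S₁.n 27 = S'.n 27 := b.n 27 rfl
  have n28 : S₁.n 28 = S'.n 28 := b.n 28 rfl
  have t0 : ∀ i, S₁.ra (0, i) = S.ra (0, i) := fun i => (b.ra 0 i rfl).trans (a.ra 0 i rfl)
  have t1 : ∀ i, S₁.ra (1, i) = S'.ra (1, i) := fun i => b.ra 1 i rfl
  by_cases hm : S₁.n 31 = 0
  · have hm' := c1.1 hm
    have hlt : S₁.n 31 < 1 := by omega
    simp only [updateCode, Stmt.run, NExp.eval, RExp.eval, hlt, if_true, Store.setR_n,
      Store.setR_ra, Store.setR_r, t0, t1, n21, n22, n24, n25, n26, n27, n28, c2]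
    change (if candidate S g (S'.n 24) (S'.n 25) (S'.n 26) (S'.n 27) < _
      then _ else _ : Store).ra _ = _
    split_ifs with h1 h2 h2
    · simp only [Store.putR_ra, h2.1.1, h2.1.2, if_true]
      rfl
    · simp only [Store.putR_ra, Prod.mk.injEq, true_and, and_true]
      rw [if_neg]
      · exact t1 _
      · rintro ⟨rfl, rfl⟩
        exact h2 ⟨⟨rfl, rfl⟩, hm', h1⟩
    · obtain ⟨⟨rfl, rfl⟩, -, h3⟩ := h2
      exact absurd h3 h1
    · exact t1 _
  · have hlt : ¬S₁.n 31 < 1 := by omega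
    rw [if_neg fun h => hm (c1.2 h.2.1)]
    simp only [updateCode, Stmt.run, NExp.eval, hlt, if_false, t1]

theorem nestOk_combine : NestOk (.seq checkCode updateCode)
    [(24, 9), (25, 9), (26, 8), (27, 8), (28, 8)] :=
  ⟨rfl, by simp only [List.forall_mem_cons]; exact ⟨rfl, rfl, rfl, rfl, rfl, by simp⟩,
   rfl, by simp only [List.forall_mem_cons]; exact ⟨rfl, rfl, rfl, rfl, by simp⟩,
   rfl, by simp only [List.forall_mem_cons]; exact ⟨rfl, rfl, rfl, by simp⟩,
   rfl, by simp only [List.forall_mem_cons]; exact ⟨rfl, rfl, by simp⟩,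
   rfl, by simp only [List.forall_mem_cons]; exact ⟨rfl, by simp⟩, trivial⟩

theorem run_combineCode_sound {A : ℕ → ℕ} {S : Store} {g : ℕ} (h6 : S.n 6 = g)
    (hdig : ∀ e < S.n 8, HasDigits S g e)
    (hinit : ∀ d < S.n 9, ∀ e < S.n 8, S.ra (1, d, e, 0) = S.r 1) :
    ∀ d < S.n 9, ∀ h < S.n 8, S.r 1 ≤ (combineCode.run A S).ra (1, d, h, 0) ∨
      ∃ d₁ < S.n 9, ∃ d₂ < S.n 9, ∃ e < S.n 8, ∃ f < S.n 8, d₁ + d₂ = d ∧ Matches g e f h ∧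
        candidate S g d₁ d₂ e f ≤ (combineCode.run A S).ra (1, d, h, 0) := by
  classical
  intro d hd h hh
  refine nest_preserve (fun S' => S.r 1 ≤ S'.ra (1, d, h, 0) ∨
      ∃ d₁ < S.n 9, ∃ d₂ < S.n 9, ∃ e < S.n 8, ∃ f < S.n 8, d₁ + d₂ = d ∧ Matches g e f h ∧
        candidate S g d₁ d₂ e f ≤ S'.ra (1, d, h, 0)) (fun _ _ _ h => h)
      _ nestOk_combine S (.inl (hinit d hd h hh).ge) ?_
  intro S' a hv ih
  rw [run_check_update h6 hdig a hv]
  split_ifs with hc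
  · obtain ⟨⟨rfl, rfl⟩, hm, -⟩ := hc
    exact .inr ⟨_, hv (24, 9) (by simp), _, hv (25, 9) (by simp), _, hv (26, 8) (by simp), _,
      hv (27, 8) (by simp), rfl, hm, le_rfl⟩
  · exact ih

theorem run_combineCode_complete {A : ℕ → ℕ} {S : Store} {g d₁ d₂ e f h : ℕ} (h6 : S.n 6 = g)
    (hdig : ∀ e < S.n 8, HasDigits S g e) (h₁ : d₁ < S.n 9) (h₂ : d₂ < S.n 9) (he : e < S.n 8)
    (hf : f < S.n 8) (hh : h < S.n 8) (hm : Matches g e f h) :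
    (combineCode.run A S).ra (1, d₁ + d₂, h, 0) ≤ candidate S g d₁ d₂ e f := by
  classical
  refine nest_establish (fun S' => S'.ra (1, d₁ + d₂, h, 0) ≤ candidate S g d₁ d₂ e f)
    (fun _ _ _ h => h) _ nestOk_combine S (fun x => if x = 24 then d₁ else if x = 25 then d₂
      else if x = 26 then e
      else if x = 27 then f else h) (by simp [h₁, h₂, he, hf, hh]) ?_ ?_
  · intro S' a hv
    have h24 : S'.n 24 = d₁ := hv (24, 9) (by simp)
    have h25 : S'.n 25 = d₂ := hv (25, 9) (by simp)
    have h26 : S'.n 26 = e := hv (26, 8) (by simp)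
    have h27 : S'.n 27 = f := hv (27, 8) (by simp)
    have h28 : S'.n 28 = h := hv (28, 8) (by simp)
    rw [run_check_update h6 hdig a (by simp [h24, h25, h26, h27, h28, h₁, h₂, he, hf, hh])]
    rw [h24, h25, h26, h27, h28]
    split_ifs with hc
    · exact le_rfl
    · exact not_lt.1 fun hlt => hc ⟨⟨rfl, rfl⟩, hm, hlt⟩
  · intro S' a hv ih
    rw [run_check_update h6 hdig a hv]
    split_ifs with hc
    · exact hc.2.2.le.trans ih
    · exact ih

/-- Attaches the component of the leaf `21` to that of its neighbour `22`. -/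
def mergeCode : Stmt := .seq clearCode (.seq combineCode copyCode)

/-- The new row is built in a separate array, so all candidates use the old row of the neighbour,
which is replaced only at the end. -/
theorem run_mergeCode {A : ℕ → ℕ} {S : Store} {g : ℕ} (h6 : S.n 6 = g)
    (hdig : ∀ e < S.n 8, HasDigits S g e) :
    (∀ v, v ≠ S.n 22 → ∀ i, (mergeCode.run A S).ra (0, v, i) = S.ra (0, v, i)) ∧
    (∀ d < S.n 9, ∀ h < S.n 8, S.r 1 ≤ (mergeCode.run A S).ra (0, S.n 22, d, h) ∨
      ∃ d₁ < S.n 9, ∃ d₂ < S.n 9, ∃ e < S.n 8, ∃ f < S.n 8, d₁ + d₂ = d ∧ Matches g e f h ∧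
        candidate S g d₁ d₂ e f ≤ (mergeCode.run A S).ra (0, S.n 22, d, h)) ∧
    (∀ d₁ d₂, d₁ + d₂ < S.n 9 → ∀ e < S.n 8, ∀ f < S.n 8, ∀ h < S.n 8, Matches g e f h →
      (mergeCode.run A S).ra (0, S.n 22, d₁ + d₂, h) ≤ candidate S g d₁ d₂ e f) := by
  rw [mergeCode, Stmt.run_seq, Stmt.run_seq]
  have a := Stmt.agree_run A clearCode S
  have hinit := fun d (hd : d < S.n 9) e (he : e < S.n 8) => run_clearCode A S hd he
  set S₁ := clearCode.run A S
  have b := Stmt.agree_run A combineCode S₁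
  have n6 : S₁.n 6 = S.n 6 := a.n 6 rfl
  have n8 : S₁.n 8 = S.n 8 := a.n 8 rfl
  have n9 : S₁.n 9 = S.n 9 := a.n 9 rfl
  have n21 : S₁.n 21 = S.n 21 := a.n 21 rfl
  have n22 : S₁.n 22 = S.n 22 := a.n 22 rfl
  have r1 : S₁.r 1 = S.r 1 := a.r 1 rfl
  have t0 : ∀ i, S₁.ra (0, i) = S.ra (0, i) := fun i => a.ra 0 i rfl
  have hcand : candidate S₁ g = candidate S g := by
    funext d₁ d₂ e f
    simp [candidate, n21, n22, t0]
  have hdig₁ : ∀ e < S₁.n 8, HasDigits S₁ g e := fun e he i =>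
    (a.na 0 _ rfl).trans (hdig e (n8 ▸ he) i)
  have hs := run_combineCode_sound (A := A) (n6.trans h6) hdig₁ (by rwa [n8, n9, r1])
  have hc := fun d₁ d₂ e f h => run_combineCode_complete (A := A) (d₁ := d₁) (d₂ := d₂) (e := e)
    (f := f) (h := h) (n6.trans h6) hdig₁
  rw [n8, n9, r1, hcand] at hs
  simp only [n8, n9, hcand] at hc
  set S₂ := combineCode.run A S₁
  have m8 : S₂.n 8 = S.n 8 := (b.n 8 rfl).trans n8
  have m9 : S₂.n 9 = S.n 9 := (b.n 9 rfl).trans n9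
  have m22 : S₂.n 22 = S.n 22 := (b.n 22 rfl).trans n22
  have copy : ∀ d < S.n 9, ∀ h < S.n 8,
      (copyCode.run A S₂).ra (0, S.n 22, d, h) = S₂.ra (1, d, h, 0) := by
    intro d hd h hh
    rw [← m22]
    exact run_copyCode A S₂ (m9 ▸ hd) (m8 ▸ hh)
  refine ⟨fun v hv i => ?_, fun d hd h hh => ?_, fun d₁ d₂ hd e he f hf h hh hm => ?_⟩
  · rw [run_copyCode_other A S₂ (m22 ▸ hv), b.ra 0 (v, i) rfl, t0]
  · rw [copy d hd h hh]
    exact hs d hd h hh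
  · rw [copy _ hd h hh]
    exact hc d₁ d₂ e f h (by omega) (by omega) he hf hh hm

/-! ### Elimination of leaves on the machine -/

/-- Removes a leaf, if there is one. -/
def elimBody : Stmt :=
  .seq leafCode <| .iteN (.lit 0) (.var 16)
    (.seq mergeCode (.putN 1 (.var 21) (.lit 0) (.lit 0) (.lit 1))) .skip

/-- Removes all vertices but one. -/
def elimCode : Stmt := .loop 32 0 elimBody

open Classical in
/-- The adjacency matrix, row by row. -/
noncomputable def matrixCells {n : ℕ} (T : SimpleGraph (Fin n)) (a : ℕ) : ℕ :=
  if ∃ i j : Fin n, a = i.val * n + j.val ∧ T.Adj i j then 1 else 0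

/-- Row and column are quotient and remainder of the address by `n`, so a cell belongs to one pair
only. -/
theorem matrixCells_pos {n : ℕ} (T : SimpleGraph (Fin n)) (u w : Fin n) :
    0 < matrixCells T (u * n + w) ↔ T.Adj u w := by
  unfold matrixCells
  split_ifs with h
  · obtain ⟨i, j, hij, hadj⟩ := h
    have hn : 0 < n := u.pos
    have h1 := congrArg (· / n) hij
    have h2 := congrArg (· % n) hij
    simp only [Nat.mul_comm _ n, Nat.mul_add_div hn,
      Nat.div_eq_of_lt w.isLt, Nat.div_eq_of_lt j.isLt,
      Nat.mul_add_mod, Nat.mod_eq_of_lt w.isLt, Nat.mod_eq_of_lt j.isLt, add_zero] at h1 h2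
    rw [Fin.ext h1, Fin.ext h2]
    simp [hadj]
  · simp only [lt_irrefl, false_iff]
    exact fun hadj => h ⟨u, w, rfl, hadj⟩

theorem matrixCells_eq_zero {n : ℕ} (T : SimpleGraph (Fin n)) {a : ℕ} (h : n * n ≤ a) :
    matrixCells T a = 0 := by
  refine if_neg ?_
  rintro ⟨i, j, rfl, -⟩
  have := i.isLt
  have := j.isLt
  nlinarith

/-- The vertices of `R` remain, and the table is correct for them. -/
structure Remaining {n : ℕ} (T : SimpleGraph (Fin n)) (g K : ℕ) (INF : ℝ) (R : Finset (Fin n))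
    (S : Store) : Prop where
  mem_iff : ∀ v : Fin n, S.na (1, v, 0, 0) = 0 ↔ v ∈ R
  connected : ConnectedOn T R
  separated : Separated T R
  sound : TableSound T g K INF R fun v d e => S.ra (0, v, d, e)
  complete : TableComplete T g K R fun v d e => S.ra (0, v, d, e)

/-- The values that the main loop does not change. -/
structure Prepared (n g K : ℕ) (INF : ℝ) (S : Store) : Prop where
  size : S.n 0 = n
  bound : S.n 6 = g
  profiles : S.n 8 = (g + 1) ^ g
  deletions : S.n 9 = K
  infinity : S.r 1 = INF
  digits : ∀ e < (g + 1) ^ g, HasDigits S g e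

theorem Prepared.agree {n g K : ℕ} {INF : ℝ} {S S' : Store} {c : Stmt} (h : Prepared n g K INF S)
    (a : Agree c S S') (h0 : c.writesN 0 = false) (h6 : c.writesN 6 = false)
    (h8 : c.writesN 8 = false) (h9 : c.writesN 9 = false) (h1 : c.writesR 1 = false)
    (hd : c.writesNA 0 = false) : Prepared n g K INF S' :=
  ⟨(a.n 0 h0).trans h.size, (a.n 6 h6).trans h.bound, (a.n 8 h8).trans h.profiles,
    (a.n 9 h9).trans h.deletions, (a.r 1 h1).trans h.infinity,
    fun e he i => (a.na 0 _ hd).trans (h.digits e he i)⟩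

theorem Remaining.leafAt_iff {n : ℕ} {T : SimpleGraph (Fin n)} {g K : ℕ} {INF : ℝ}
    {R : Finset (Fin n)} {S : Store} (h : Remaining T g K INF R S) (h0 : S.n 0 = n) (u p : Fin n) :
    LeafAt (matrixCells T) S u p ↔ IsLeaf T R u p := by
  have hN : ∀ w : Fin n, Nbr (matrixCells T) S u w ↔ w ∈ R ∧ T.Adj u w := fun w => by
    rw [Nbr, h0, matrixCells_pos, h.mem_iff]
  constructor
  · rintro ⟨-, hu, -, hp⟩
    rw [h0] at hp
    have hp' := (hN p).1 ((hp p p.isLt).2 rfl)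
    exact ⟨(h.mem_iff u).1 hu, hp'.1, hp'.2, fun w hw hadj =>
      Fin.ext ((hp w w.isLt).1 ((hN w).2 ⟨hw, hadj⟩))⟩
  · intro hl
    refine ⟨h0 ▸ u.isLt, (h.mem_iff u).2 hl.mem, h0 ▸ p.isLt, fun w hw => ?_⟩
    obtain ⟨w, rfl⟩ : ∃ w' : Fin n, (w' : ℕ) = w := ⟨⟨w, h0 ▸ hw⟩, rfl⟩
    rw [hN, Fin.val_inj]
    exact ⟨fun hw => hl.unique w hw.1 hw.2, fun hw => hw ▸ ⟨hl.mem', hl.adj⟩⟩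

theorem Remaining.elimBody {n : ℕ} {T : SimpleGraph (Fin n)} (hT : T.IsTree) {g K : ℕ} {INF : ℝ}
    (hINF : 0 ≤ INF) {R : Finset (Fin n)} {S : Store} (h : Remaining T g K INF R S)
    (hp : Prepared n g K INF S) :
    ∃ R' : Finset (Fin n), R'.card ≤ max 1 (R.card - 1) ∧
      Remaining T g K INF R' (elimBody.run (matrixCells T) S) := by
  obtain ⟨l1, l2⟩ := run_leafCode (matrixCells T) S
  rw [RealRAM.elimBody, Stmt.run_seq]
  have a := Stmt.agree_run (matrixCells T) leafCode S
  set S₁ := leafCode.run (matrixCells T) S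
  have hp₁ := hp.agree a rfl rfl rfl rfl rfl rfl
  have ra₁ : ∀ i, S₁.ra (0, i) = S.ra (0, i) := fun i => a.ra 0 i rfl
  have na₁ : ∀ i, S₁.na (1, i) = S.na (1, i) := fun i => a.na 1 i rfl
  by_cases h16 : S₁.n 16 = 0
  · refine ⟨R, ?_, ?_⟩
    -- The search fails only when at most one vertex is left: a larger connected part of a tree has
    -- a leaf.
    · by_contra hcard
      obtain ⟨u, p, hl⟩ := exists_isLeaf hT h.connected (R := R) (by omega)
      exact l2 ⟨u, p, (h.leafAt_iff hp.size u p).2 hl⟩ h16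
    · have hrun : (Stmt.iteN (.lit 0) (.var 16) (.seq mergeCode
          (.putN 1 (.var 21) (.lit 0) (.lit 0) (.lit 1))) .skip).run (matrixCells T) S₁ = S₁ := by
        simp [Stmt.run, NExp.eval, h16]
      rw [hrun]
      refine ⟨fun v => by rw [na₁, h.mem_iff], h.connected, h.separated, ?_, ?_⟩
      · simpa only [ra₁] using h.sound
      · simpa only [ra₁] using h.complete
  · have hleaf := l1 h16
    obtain ⟨u, hu⟩ : ∃ u : Fin n, (u : ℕ) = S₁.n 21 := ⟨⟨_, hp.size ▸ hleaf.1⟩, rfl⟩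
    obtain ⟨p, hpn⟩ : ∃ p : Fin n, (p : ℕ) = S₁.n 22 := ⟨⟨_, hp.size ▸ hleaf.2.2.1⟩, rfl⟩
    rw [← hu, ← hpn, h.leafAt_iff hp.size] at hleaf
    obtain ⟨m1, m2, m3⟩ := run_mergeCode (A := matrixCells T) hp₁.bound
      (fun e he => hp₁.digits e (hp₁.profiles ▸ he))
    have b := Stmt.agree_run (matrixCells T) mergeCode S₁
    have hrun : (Stmt.iteN (.lit 0) (.var 16) (.seq mergeCode
        (.putN 1 (.var 21) (.lit 0) (.lit 0) (.lit 1))) .skip).run (matrixCells T) S₁ =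
        (mergeCode.run (matrixCells T) S₁).putN (1, u, 0, 0) 1 := by
      have b21 : (mergeCode.run (matrixCells T) S₁).n 21 = u := (b.n 21 rfl).trans hu.symm
      simp [Stmt.run, NExp.eval, Nat.pos_of_ne_zero h16, b21]
    rw [hrun]
    set S₂ := mergeCode.run (matrixCells T) S₁
    simp only [candidate, hp₁.profiles, hp₁.deletions, hp₁.infinity, ← hpn, ← hu, ra₁] at m1 m2 m3
    have hm : IsMerge g K INF p u (fun v d e => S.ra (0, v, d, e))
        fun v d e => S₂.ra (0, v, d, e) :=
      ⟨fun v hv => by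
        funext d e
        exact m1 v (fun hvp => hv (Fin.ext hvp)) (d, e), m2, m3⟩
    refine ⟨R.erase u, ?_, ?_, hleaf.connectedOn h.connected, hleaf.separated h.separated, ?_, ?_⟩
    · rw [Finset.card_erase_of_mem hleaf.mem]
      exact le_max_right _ _
    · intro v
      have na₂ : S₂.na (1, v, 0, 0) = S₁.na (1, v, 0, 0) := b.na 1 _ rfl
      by_cases hv : v = u
      · simp [hv]
      · rw [Store.putN_na, if_neg (by simp [Fin.val_inj, hv]), na₂, na₁, h.mem_iff]
        simp [hv]
    · exact h.sound.merge hINF h.separated hleaf hm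
    · exact h.complete.merge h.separated hleaf hm

/-- At most `max 1 (n - m)` vertices remain after `m` rounds, so `n` rounds leave at most one;
connectedness keeps the set nonempty. -/
theorem Remaining.elimCode {n : ℕ} {T : SimpleGraph (Fin n)} (hT : T.IsTree) {g K : ℕ} {INF : ℝ}
    (hINF : 0 ≤ INF) {S : Store} (h : Remaining T g K INF Finset.univ S)
    (hp : Prepared n g K INF S) :
    ∃ ρ : Fin n, Remaining T g K INF {ρ} (elimCode.run (matrixCells T) S) := by
  obtain ⟨R, hR, h'⟩ := loop_induct (A := matrixCells T) (x := 32) (b := 0) (c := RealRAM.elimBody)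
    (S := S) (fun m S' => ∃ R : Finset (Fin n), R.card ≤ max 1 (n - m) ∧ Remaining T g K INF R S')
    ⟨Finset.univ, by simp, h⟩ (by
      rintro m - S' a ⟨R, hR, h'⟩
      obtain ⟨R', hR', h''⟩ := Remaining.elimBody hT hINF (S := S'.setN 32 m)
        ⟨h'.mem_iff, h'.connected, h'.separated, h'.sound, h'.complete⟩
        (hp.agree (a.trans (.setN_loop 32 0 _ S' m)) rfl rfl rfl rfl rfl rfl)
      exact ⟨R', by omega, h''⟩)
  have hne : R.Nonempty := by
    obtain ⟨v⟩ := h'.connected.nonempty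
    exact ⟨v, v.2⟩
  rw [hp.size, Nat.sub_self] at hR
  obtain ⟨ρ, rfl⟩ := Finset.card_eq_one.1 (le_antisymm (by simpa using hR) hne.card_pos)
  exact ⟨ρ, h'⟩

/-! ### Reading off the answer -/

/-- Sets the answer, if a table entry of a remaining vertex is at most the target. -/
def answerCode : Stmt :=
  .iteN (.lit 0) (.var 9)
    (nest (.iteN (.get 1 (.var 13) (.lit 0) (.lit 0)) (.lit 1)
      (.iteR (.var 0) (.get 0 (.var 13) (.var 1) (.var 15)) .skip (.setR 4 (.nat (.lit 1))))
      .skip) [(13, 0), (15, 8)]) .skip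

theorem nestOk_answer : NestOk (.iteN (.get 1 (.var 13) (.lit 0) (.lit 0)) (.lit 1)
      (.iteR (.var 0) (.get 0 (.var 13) (.var 1) (.var 15)) .skip (.setR 4 (.nat (.lit 1))))
      .skip) [(13, 0), (15, 8)] :=
  ⟨rfl, by simp only [List.forall_mem_cons]; exact ⟨rfl, rfl, by simp⟩,
   rfl, by simp only [List.forall_mem_cons]; exact ⟨rfl, by simp⟩, trivial⟩

theorem run_answerCode (A : ℕ → ℕ) (S : Store) (h4 : S.r 4 = 0) :
    0 < (answerCode.run A S).r 4 ↔ 0 < S.n 9 ∧ ∃ v < S.n 0, S.na (1, v, 0, 0) = 0 ∧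
      ∃ e < S.n 8, S.ra (0, v, S.n 1, e) ≤ S.r 0 := by
  by_cases h9 : 0 < S.n 9
  swap
  · simp [answerCode, Stmt.run, NExp.eval, h9, h4]
  have hrun : answerCode.run A S = (nest (.iteN (.get 1 (.var 13) (.lit 0) (.lit 0)) (.lit 1)
      (.iteR (.var 0) (.get 0 (.var 13) (.var 1) (.var 15)) .skip (.setR 4 (.nat (.lit 1))))
      .skip) [(13, 0), (15, 8)]).run A S := by
    rw [answerCode]
    simp only [Stmt.run, NExp.eval, h9, if_true]
  rw [hrun]
  constructor
  · refine nest_preserve (fun S' => 0 < S'.r 4 → 0 < S.n 9 ∧ ∃ v < S.n 0, S.na (1, v, 0, 0) = 0 ∧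
      ∃ e < S.n 8, S.ra (0, v, S.n 1, e) ≤ S.r 0) (fun _ _ _ h => h) _ nestOk_answer S
      (by simp [h4]) ?_
    intro S' a hv ih
    have hv13 := hv (13, 0) (by simp)
    have hv15 := hv (15, 8) (by simp)
    have na1 : ∀ i, S'.na (1, i) = S.na (1, i) := fun i => a.na 1 i rfl
    have ra0 : ∀ i, S'.ra (0, i) = S.ra (0, i) := fun i => a.ra 0 i rfl
    have n1 : S'.n 1 = S.n 1 := a.n 1 rfl
    have r0 : S'.r 0 = S.r 0 := a.r 0 rfl
    simp only [Stmt.run, NExp.eval, RExp.eval, na1, ra0, n1, r0, Nat.lt_one_iff]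
    split_ifs with h1 h2
    · exact ih
    · exact fun _ => ⟨h9, _, hv13, h1, _, hv15, not_lt.1 h2⟩
    · exact ih
  · rintro ⟨-, v, hv, hv', e, he, hle⟩
    refine nest_establish (fun S' => 0 < S'.r 4) (fun _ _ _ h => h) _ nestOk_answer S
      (fun x => if x = 13 then v else e) (by simp [hv, he]) ?_ ?_
    · intro S' a hval
      have h13 : S'.n 13 = v := hval (13, 0) (by simp)
      have h15 : S'.n 15 = e := hval (15, 8) (by simp)
      have na1 : S'.na (1, v, 0, 0) = 0 := (a.na 1 _ rfl).trans hv'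
      have ra0 : ∀ i, S'.ra (0, i) = S.ra (0, i) := fun i => a.ra 0 i rfl
      have n1 : S'.n 1 = S.n 1 := a.n 1 rfl
      have r0 : S'.r 0 = S.r 0 := a.r 0 rfl
      simp [Stmt.run, NExp.eval, RExp.eval, h13, h15, na1, ra0, n1, r0, not_lt.2 hle]
    · intro S' a _ ih
      simp only [Stmt.run]
      split_ifs
      · exact ih
      · simp [RExp.eval, NExp.eval]
      · exact ih

/-- The dynamic program, after the computation of the bounds. -/
def tableCode : Stmt := .seq digitCode <| .seq initCode <| .seq elimCode answerCode

theorem compBound_pos (r : ℕ) : 0 < compBound r := Nat.succ_pos _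

theorem run_tableCode {n : ℕ} {T : SimpleGraph (Fin n)} (hT : T.IsTree) {k r : ℕ} (hk : 0 < k)
    (hr : n ≤ r * k) {S : Store} (h0 : S.n 0 = n) (h1 : S.n 1 = k) (h6 : S.n 6 = compBound r)
    (h7 : S.n 7 = compBound r + 1) (h8 : S.n 8 = (compBound r + 1) ^ compBound r)
    (h9 : S.n 9 = if n < k then 0 else k + 1) (h4 : S.r 4 = 0) (hna : ∀ q, S.na q = 0) :
    0 < (tableCode.run (matrixCells T) S).r 4 ↔ MinIGL T k (S.r 0) := by
  rw [tableCode, Stmt.run_seq, Stmt.run_seq, Stmt.run_seq]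
  have a₁ := Stmt.agree_run (matrixCells T) digitCode S
  have hdig := run_digitCode (A := matrixCells T) (compBound_pos r) h6 h7 fun _ _ => hna _
  set S₁ := digitCode.run (matrixCells T) S
  have a₂ := Stmt.agree_run (matrixCells T) initCode S₁
  obtain ⟨i1, i2⟩ := run_initCode (matrixCells T) S₁
  set S₂ := initCode.run (matrixCells T) S₁
  have r0 : S₁.r 0 = S.r 0 := a₁.r 0 rfl
  have n0 : S₁.n 0 = n := (a₁.n 0 rfl).trans h0
  have n8 : S₁.n 8 = (compBound r + 1) ^ compBound r := (a₁.n 8 rfl).trans h8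
  have n9 : S₁.n 9 = if n < k then 0 else k + 1 := (a₁.n 9 rfl).trans h9
  have hp : Prepared n (compBound r) (if n < k then 0 else k + 1) (S.r 0 * S.r 0 + 1) S₂ :=
    ⟨(a₂.n 0 rfl).trans n0, (a₂.n 6 rfl).trans ((a₁.n 6 rfl).trans h6), (a₂.n 8 rfl).trans n8,
      (a₂.n 9 rfl).trans n9, by rw [i1, r0],
      fun e he i => (a₂.na 0 _ rfl).trans (hdig e (h8 ▸ he) i)⟩
  rw [n0, n8, n9, r0] at i2
  have hrem : Remaining T (compBound r) (if n < k then 0 else k + 1) (S.r 0 * S.r 0 + 1)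
      Finset.univ S₂ := by
    refine ⟨fun v => ?_, connectedOn_univ hT, separated_univ T, ?_, ?_⟩
    · have : S₂.na (1, v, 0, 0) = 0 := (a₂.na 1 _ rfl).trans ((a₁.na 1 _ rfl).trans (hna _))
      simp [this]
    · intro v hv d hd e he
      have := tableSound_initial T (compBound_pos r) (if n < k then 0 else k + 1)
        (S.r 0 * S.r 0 + 1) v hv d hd e he
      simpa only [i2 v v.isLt d hd e he] using this
    · intro v hv D hD hd
      obtain ⟨e, he, h1, h2⟩ := tableComplete_initial T (compBound_pos r)
        (if n < k then 0 else k + 1) (S.r 0 * S.r 0 + 1) v hv D hD hd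
      refine ⟨e, he, h1, ?_⟩
      simpa only [i2 v v.isLt _ hd e he] using h2
  obtain ⟨ρ, hρ⟩ := hrem.elimCode hT (by nlinarith [mul_self_nonneg (S.r 0)]) hp
  have a₃ := Stmt.agree_run (matrixCells T) elimCode S₂
  set S₃ := elimCode.run (matrixCells T) S₂
  have hp₃ := hp.agree a₃ rfl rfl rfl rfl rfl rfl
  have m1 : S₃.n 1 = k := (a₃.n 1 rfl).trans ((a₂.n 1 rfl).trans ((a₁.n 1 rfl).trans h1))
  have mr0 : S₃.r 0 = S.r 0 := (a₃.r 0 rfl).trans ((a₂.r 0 rfl).trans r0)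
  have mr4 : S₃.r 4 = 0 := (a₃.r 4 rfl).trans ((a₂.r 4 rfl).trans ((a₁.r 4 rfl).trans h4))
  rw [run_answerCode _ _ mr4, hp₃.deletions, hp₃.size, hp₃.profiles, m1, mr0]
  -- Here no set of `k` vertices exists; the table has no rows, and the answer keeps its initial
  -- value 0.
  by_cases hnk : n < k
  · simp only [hnk, if_true, lt_irrefl, false_and, false_iff]
    rintro ⟨D, hD, -⟩
    have := Finset.card_le_univ D
    rw [Fintype.card_fin] at this
    omega
  · have hs := hρ.sound
    have hc := hρ.complete
    rw [if_neg hnk] at hs hc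
    -- The stand-in for infinity is `τ² + 1`, which exceeds every real `τ` and needs no knowledge of
    -- `n`.
    rw [minIGL_iff_of_table hT hk (by simpa using hr) (show S.r 0 < S.r 0 * S.r 0 + 1 by
      nlinarith [sq_nonneg (S.r 0 - 1), sq_nonneg (S.r 0)]) hs hc]
    simp only [hnk, if_false, Nat.succ_pos, true_and]
    constructor
    · rintro ⟨v, hv, hv', e, he, hle⟩
      have hvρ : (⟨v, hv⟩ : Fin n) = ρ := Finset.mem_singleton.1 ((hρ.mem_iff ⟨v, hv⟩).1 hv')
      exact ⟨e, he, hvρ ▸ hle⟩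
    · rintro ⟨e, he, hle⟩
      exact ⟨ρ, ρ.isLt, (hρ.mem_iff ρ).2 (by simp), e, he, hle⟩

/-! ### The machine program -/

/-- Decides the problem. -/
def decideCode : Stmt := .seq ratioCode <| .seq boundCode tableCode

/-- Moves the input to the registers where `decideCode` expects it. -/
def preludeCode : List Instr := [.move 4 1, .move 1 2, .mul 3 0 0]

/-- Gives the answer stored in register `17`. -/
def haltCode (off : ℕ) : List Instr :=
  [.const 2 0, .jlt 2 17 (off + 3), .halt false, .halt true]

/-- The program for MinIGL on trees. -/
def minIGLProgram : Program :=
  preludeCode ++ (decideCode.code 3 0 ++ haltCode (3 + decideCode.lines))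

/-- The variables at the start of `decideCode`. -/
noncomputable def startStore (n k : ℕ) (τ : ℝ) : Store where
  n x := if x = 0 then n else if x = 1 then k else 0
  r x := if x = 0 then τ else 0
  na _ := 0
  ra _ := 0

theorem haltsIn_haltCode {P : Program} {s : Config} {off : ℕ} (hpc : s.pc = off)
    (hP : CodeAt P off (haltCode off)) :
    ∃ t ≤ 3, ∃ ans, HaltsIn P s t ans ∧ (ans = true ↔ 0 < s.reg 17) := by
  subst hpc
  obtain ⟨h0, h1, h2, h3, -⟩ := hP
  by_cases h : 0 < s.reg 17
  · refine ⟨3, le_rfl, true, .step h0 rfl (.step (s' := (s.setReg 2 (0 : ℤ)).goto (s.pc + 3)) h1 ?_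
      (.halt h3)), by simp [h]⟩
    simp [exec, Config.setReg, h]
  · refine ⟨3, le_rfl, false, .step h0 rfl (.step (s' := (s.setReg 2 (0 : ℤ)).goto (s.pc + 2)) h1 ?_
      (.halt h2)), by simp [h]⟩
    simp [exec, Config.setReg, h]

theorem reach_preludeCode (x : TreeInstance) : ∃ s, Reach minIGLProgram x.input 3 s ∧ s.pc = 3 ∧
    Rel (matrixCells x.T) (x.n * x.n) (startStore x.n x.k x.τ) s := by
  have hcode : CodeAt minIGLProgram 0 preludeCode := codeAt_self_append [] preludeCode _
  have hrun : Runs preludeCode x.input _ :=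
    .cons rfl rfl (.cons rfl rfl (.cons rfl rfl (.nil _)))
  have hmem : ∀ a, x.input.mem a = matrixCells x.T a := fun a => by
    simp only [TreeInstance.input, matrixCells]
    split_ifs <;> simp
  refine ⟨_, hrun.2 _ hcode, rfl, fun y => ?_, fun y => ?_, ?_, fun a _ => hmem a, fun q => ?_,
    fun q => ?_⟩
  · have h3 : 4 * y ≠ 3 := by omega
    have h1 : 4 * y ≠ 1 := by omega
    have h2 : 4 * y ≠ 2 := by omega
    rcases eq_or_ne y 0 with rfl | hy0
    · simp [Config.setReg, TreeInstance.input, startStore]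
    rcases eq_or_ne y 1 with rfl | hy1
    · simp [Config.setReg, TreeInstance.input, startStore]
    · have h4 : 4 * y ≠ 4 := by omega
      simp [Config.setReg, TreeInstance.input, startStore, h1, h2, h3, h4,
        hy0, hy1]
  · rcases eq_or_ne y 0 with rfl | hy0
    · simp [Config.setReg, TreeInstance.input, startStore]
    · have h0 : 4 * y + 1 ≠ 0 := by omega
      have h2 : 4 * y + 1 ≠ 2 := by omega
      have h3 : 4 * y + 1 ≠ 3 := by omega
      have h4 : 4 * y + 1 ≠ 4 := by omega
      simp [Config.setReg, TreeInstance.input, startStore, h2, h3, h4, hy0]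
  · simp [Config.setReg, TreeInstance.input]
  · change x.input.mem _ = _
    rw [hmem, matrixCells_eq_zero _ (by omega)]
    simp [startStore]
  · change x.input.mem _ = _
    rw [hmem, matrixCells_eq_zero _ (by omega)]
    simp [startStore]

theorem haltsIn_minIGLProgram (x : TreeInstance) : ∃ t ans, HaltsIn minIGLProgram x.input t ans ∧
    (ans = true ↔ 0 < (decideCode.run (matrixCells x.T) (startStore x.n x.k x.τ)).r 4) ∧
    t ≤ decideCode.cost (matrixCells x.T) (startStore x.n x.k x.τ) + 6 := by
  obtain ⟨s, hs, hpc, hrel⟩ := reach_preludeCode x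
  have hcode : CodeAt minIGLProgram 3 (decideCode.code 3 0) := by
    have := codeAt_self_append preludeCode (decideCode.code 3 0)
      (haltCode (3 + decideCode.lines))
    rwa [List.append_assoc] at this
  have hhalt : CodeAt minIGLProgram (3 + decideCode.lines) (haltCode (3 + decideCode.lines)) := by
    have := codeAt_self_append (preludeCode ++ decideCode.code 3 0)
      (haltCode (3 + decideCode.lines)) []
    rwa [List.append_nil, List.append_assoc, List.length_append, Stmt.length_code] at this
  obtain ⟨t₁, ht₁, s₁, hs₁, hpc₁, hrel₁, -⟩ := decideCode.arrives
    (A := matrixCells x.T)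
    (fun a ha => matrixCells_eq_zero x.T ha) 3 0 _ s hrel hpc hcode
  obtain ⟨t₂, ht₂, ans, hans, hans'⟩ := haltsIn_haltCode hpc₁ hhalt
  refine ⟨_, ans, hs.haltsIn (hs₁.haltsIn hans), ?_, by omega⟩
  rw [hans', ← hrel₁.r 4]

/-! ### Running time -/

/-- A bound for the values of the loop bounds that depend on the parameter. -/
def paramBound (r : ℕ) : ℕ := (compBound r + 1) ^ (compBound r + 1)

theorem primrec_paramBound : Primrec paramBound := by
  have hpow : Primrec₂ ((· ^ ·) : ℕ → ℕ → ℕ) := Primrec₂.unpaired'.1 Nat.Primrec.pow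
  have hsize : Primrec sizeBound :=
    Primrec.succ.comp (Primrec.nat_mul.comp .id (hpow.comp (.const 3) .id))
  have hadd : Primrec fun r : ℕ => r + sizeBound (r * r) :=
    Primrec.nat_add.comp .id (hsize.comp (Primrec.nat_mul.comp .id .id))
  have hcomp : Primrec compBound := hsize.comp (Primrec.nat_mul.comp hadd hadd)
  exact hpow.comp (Primrec.succ.comp hcomp) (Primrec.succ.comp hcomp)

theorem le_sizeBound (m : ℕ) : m ≤ sizeBound m :=
  (Nat.le_mul_of_pos_right m (by positivity)).trans (Nat.le_succ _)

theorem cost_powCode (A : ℕ → ℕ) {x y N : ℕ} {b : NExp} {S : Store} (hx : y ≠ x) (h3 : y ≠ 3)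
    (hN : S.n y ≤ N) : (powCode x b y).cost A S ≤ (powCode x b y).maxCost N :=
  Stmt.cost_le_maxCost _ _ (by simpa [powCode, Stmt.loopVars] using hN)
    (by simp [powCode, Stmt.loopVars, Stmt.writesN, hx.symm, h3.symm])

/-- Variables that bound loops are overwritten between the loops here, so `Stmt.cost_le_maxCost`
applies only to each power separately. The exponents are intermediate values of the bound and hence
at most `compBound r`. -/
theorem cost_boundCode (A : ℕ → ℕ) {N : ℕ} {S : Store} (hN : compBound (S.n 2) ≤ N) :
    boundCode.cost A S ≤ boundCode.maxCost N := by
  have h3 : ∀ S' : Store, ((powCode 5 (.lit 3) 4).run A S').n 5 = 3 ^ S'.n 4 := fun S' =>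
    run_powCode (by decide) (by decide) fun _ _ => rfl
  have f3 : ∀ (S' : Store) (z : ℕ), z ≠ 5 → z ≠ 3 →
      ((powCode 5 (.lit 3) 4).run A S').n z = S'.n z := fun S' z h h' =>
    (Stmt.agree_run A _ S').n z (by simp [powCode, Stmt.writesN, h.symm, h'.symm])
  have hm : (S.n 2 + sizeBound (S.n 2 * S.n 2)) * (S.n 2 + sizeBound (S.n 2 * S.n 2)) ≤ N :=
    (le_sizeBound _).trans hN
  have hr : S.n 2 * S.n 2 ≤ N :=
    (Nat.mul_le_mul (Nat.le_add_right _ _) (Nat.le_add_right _ _)).trans hm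
  unfold boundCode
  refine Nat.add_le_add le_rfl (Nat.add_le_add (cost_powCode A (by decide) (by decide) ?_)
    (Nat.add_le_add le_rfl (Nat.add_le_add le_rfl (Nat.add_le_add
      (cost_powCode A (by decide) (by decide) ?_) (Nat.add_le_add le_rfl (Nat.add_le_add le_rfl
        (Nat.add_le_add (cost_powCode A (by decide) (by decide) ?_)
          (Nat.add_le_add le_rfl le_rfl))))))))
  · simpa [Stmt.run, NExp.eval] using hr
  · simpa [Stmt.run, NExp.eval, h3, f3, sizeBound] using hm
  · simpa [Stmt.run, NExp.eval, h3, f3, sizeBound, compBound] using hN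

theorem tableCode_loopVars : ∀ y ∈ tableCode.loopVars, y ∈ [0, 6, 7, 8, 9] := by
  decide +kernel

theorem tableCode_writesN : ∀ y ∈ tableCode.loopVars, tableCode.writesN y = false := by
  decide +kernel

theorem cost_decideCode (A : ℕ → ℕ) {N : ℕ} {S : Store} (h0 : S.n 0 + 1 ≤ N)
    (hN : paramBound ((ratioCode.run A S).n 2) ≤ N) :
    decideCode.cost A S ≤ decideCode.maxCost N := by
  have b := run_boundCode A (ratioCode.run A S)
  have a₁ := Stmt.agree_run A ratioCode S
  set S₁ := ratioCode.run A S
  have a₂ := Stmt.agree_run A boundCode S₁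
  have n0 : (boundCode.run A S₁).n 0 = S.n 0 := (a₂.n 0 rfl).trans (a₁.n 0 rfl)
  have n0₁ : S₁.n 0 = S.n 0 := a₁.n 0 rfl
  have n1 : S₁.n 1 = S.n 1 := a₁.n 1 rfl
  have hg : compBound (S₁.n 2) + 1 ≤ N := (Nat.le_self_pow (Nat.succ_ne_zero _) _).trans hN
  have hM : (compBound (S₁.n 2) + 1) ^ compBound (S₁.n 2) ≤ N :=
    (Nat.pow_le_pow_right (Nat.succ_pos _) (Nat.le_succ _)).trans hN
  have m0 : (boundCode.run A S₁).n 0 ≤ N := n0.trans_le (Nat.le_of_succ_le h0)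
  have m6 : (boundCode.run A S₁).n 6 ≤ N := b.1.trans_le (Nat.le_of_succ_le hg)
  have m7 : (boundCode.run A S₁).n 7 ≤ N := b.2.1.trans_le hg
  have m8 : (boundCode.run A S₁).n 8 ≤ N := b.2.2.1.trans_le hM
  -- Either the value is 0 or `k ≤ n`; this is why `N` must be at least `n + 1`.
  have m9 : (boundCode.run A S₁).n 9 ≤ N := by
    rw [b.2.2.2, n0₁, n1]
    split_ifs <;> omega
  have c₁ : ratioCode.cost A S ≤ ratioCode.maxCost N :=
    Stmt.cost_le_maxCost _ _ (by simpa [ratioCode, Stmt.loopVars] using Nat.le_of_succ_le h0)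
      (by decide)
  have c₂ : boundCode.cost A S₁ ≤ boundCode.maxCost N :=
    cost_boundCode A (Nat.le_of_succ_le hg)
  have c₃ : tableCode.cost A (boundCode.run A S₁) ≤ tableCode.maxCost N := by
    refine Stmt.cost_le_maxCost _ _ (fun y hy => ?_) tableCode_writesN
    have hy' := tableCode_loopVars y hy
    simp only [List.mem_cons, List.not_mem_nil, or_false] at hy'
    rcases hy' with rfl | rfl | rfl | rfl | rfl
    exacts [m0, m6, m7, m8, m9]
  simp only [decideCode, Stmt.cost, Stmt.maxCost]
  exact Nat.add_le_add c₁ (Nat.add_le_add c₂ c₃)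

theorem decideCode_correct (x : TreeInstance) :
    0 < (decideCode.run (matrixCells x.T) (startStore x.n x.k x.τ)).r 4 ↔ x.IsYes := by
  rw [decideCode, Stmt.run_seq, Stmt.run_seq]
  have hr := (run_ratioCode (A := matrixCells x.T) (S := startStore x.n x.k x.τ) rfl x.k_pos).1
  have a₁ := Stmt.agree_run (matrixCells x.T) ratioCode (startStore x.n x.k x.τ)
  set S₁ := ratioCode.run (matrixCells x.T) (startStore x.n x.k x.τ)
  obtain ⟨b6, b7, b8, b9⟩ := run_boundCode (matrixCells x.T) S₁
  have a₂ := Stmt.agree_run (matrixCells x.T) boundCode S₁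
  have n0 : S₁.n 0 = x.n := a₁.n 0 rfl
  have n1 : S₁.n 1 = x.k := a₁.n 1 rfl
  have := run_tableCode x.isTree x.k_pos hr ((a₂.n 0 rfl).trans n0) ((a₂.n 1 rfl).trans n1) b6 b7
    b8 (by rw [b9, n0, n1]) ((a₂.r 4 rfl).trans (a₁.r 4 rfl))
    (fun q => (a₂.na q.1 q.2 (by simp [boundCode, powCode, Stmt.writesNA])).trans
      (a₁.na q.1 q.2 (by simp [ratioCode, Stmt.writesNA])))
  rw [this, show (boundCode.run (matrixCells x.T) S₁).r 0 = x.τ from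
    (a₂.r 0 rfl).trans (a₁.r 0 rfl)]
  rfl

theorem ceil_ratio (x : TreeInstance) :
    ⌈x.ratio⌉₊ = (ratioCode.run (matrixCells x.T) (startStore x.n x.k x.τ)).n 2 := by
  obtain ⟨h1, h2⟩ := run_ratioCode (A := matrixCells x.T) (S := startStore x.n x.k x.τ) rfl x.k_pos
  change x.n ≤ _ * x.k at h1
  change ∀ q < _, q * x.k < x.n at h2
  have hk : (0 : ℚ) < x.k := by exact_mod_cast x.k_pos
  refine le_antisymm (Nat.ceil_le.2 ?_) (le_of_not_gt fun h => ?_)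
  · rw [TreeInstance.ratio, div_le_iff₀ hk]
    exact_mod_cast h1
  · have h3 := h2 _ h
    have h4 := Nat.le_ceil x.ratio
    rw [TreeInstance.ratio, div_le_iff₀ hk] at h4
    have h5 : x.n ≤ ⌈x.ratio⌉₊ * x.k := by exact_mod_cast h4
    omega

/-- With `F` the parameter bound, `N = (n + 1) * F` dominates both `n + 1` and `F`. As `n` and `F`
are positive, `N + 1 ≤ 3 * F * n`, which separates the parameter from `n`. The summand 6 pays for
the prelude and the final branch. -/
theorem cost_decideCode_le (x : TreeInstance) :
    decideCode.cost (matrixCells x.T) (startStore x.n x.k x.τ) + 6 ≤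
      (decideCode.maxCost 1 + 6) * (3 * paramBound ⌈x.ratio⌉₊) ^ decideCode.depth *
        x.n ^ decideCode.depth := by
  have hn : 1 ≤ x.n := by
    obtain ⟨v⟩ := x.isTree.connected.nonempty
    exact v.pos
  set F := paramBound ⌈x.ratio⌉₊
  have hF1 : 1 ≤ F := Nat.one_le_pow _ _ (Nat.succ_pos _)
  have hd : 1 ≤ ((x.n + 1) * F + 1) ^ decideCode.depth := Nat.one_le_pow _ _ (Nat.succ_pos _)
  have h1 : decideCode.cost (matrixCells x.T) (startStore x.n x.k x.τ) ≤
      decideCode.maxCost ((x.n + 1) * F) := by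
    refine cost_decideCode _ (Nat.le_mul_of_pos_right _ hF1) ?_
    rw [← ceil_ratio]
    exact Nat.le_mul_of_pos_left _ (Nat.succ_pos _)
  replace h1 := h1.trans (Stmt.maxCost_le _ _)
  have h2 : (x.n + 1) * F + 1 ≤ 3 * F * x.n := by
    nlinarith [Nat.mul_le_mul hn hF1, Nat.mul_le_mul_right F hn]
  generalize decideCode.cost (matrixCells x.T) (startStore x.n x.k x.τ) = t at h1
  generalize decideCode.maxCost 1 = C at h1 ⊢
  generalize decideCode.depth = d at h1 hd ⊢
  calc t + 6 ≤ C * ((x.n + 1) * F + 1) ^ d + 6 * ((x.n + 1) * F + 1) ^ d :=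
        Nat.add_le_add h1 (Nat.le_mul_of_pos_right 6 hd)
    _ = (C + 6) * ((x.n + 1) * F + 1) ^ d := by ring
    _ ≤ (C + 6) * (3 * F * x.n) ^ d := Nat.mul_le_mul_left _ (Nat.pow_le_pow_left h2 _)
    _ = _ := by rw [mul_pow _ x.n, mul_assoc]

end RealRAM

theorem theorem1 :
    RealRAM.FixedParameterTractable TreeInstance.input TreeInstance.n TreeInstance.ratio
      TreeInstance.IsYes := by
  refine ⟨RealRAM.minIGLProgram, fun r => (RealRAM.decideCode.maxCost 1 + 6) *
    (3 * RealRAM.paramBound r) ^ RealRAM.decideCode.depth, RealRAM.decideCode.depth, ?_,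
    fun x => ?_⟩
  · have hpow : Primrec₂ ((· ^ ·) : ℕ → ℕ → ℕ) := Primrec₂.unpaired'.1 Nat.Primrec.pow
    exact (Primrec.nat_mul.comp (.const _) (hpow.comp (Primrec.nat_mul.comp (.const 3)
      RealRAM.primrec_paramBound) (.const _))).to_comp
  · obtain ⟨t, ans, h, hans, ht⟩ := RealRAM.haltsIn_minIGLProgram x
    exact ⟨t, ans, h, hans.trans (RealRAM.decideCode_correct x),
      ht.trans (RealRAM.cost_decideCode_le x)⟩
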